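/- Let $k$ be an algebraically closed field of characteristic $0$ (for instance $k=\mathbb{C}$). Let $(S,D)$ be a formal smooth surface pair over $k$, that is, $S=\mathrm{Spec}\,\mathcal{O}$ with $\mathcal{O}\cong k[[x,y]]$, and $D\subset S$ is a closed subscheme isomorphic to $\mathrm{Spec}\,k[[x]]$. Let $P$ be the closed point of $S$, let $C=\mathbf{V}(F)\subset S$ with $F\in\mathcal{O}$ be a reduced curve not containing $D$, let $w=C.D=\dim_k\mathcal{O}/(\langle F\rangle+\mathbf{I}_D)$, and let $0\le m\le w$. For a local artinian $k$-algebra $A$ with residue field $k$, a deformation of $C\to(S\supset D\supset P)$ over $A$ consists of flat deformations $\mathcal{C}$ of $C$ and $\mathcal{S}$ of $S$ over $A$, a subscheme $\mathcal{D}\subset\mathcal{S}$ flat over $A$, a section $\mathcal{P}\subset\mathcal{D}$ over $A$, and an $A$-morphism $\mathcal{C}\to\mathcal{S}$, which restrict on the closed fibre to $D$, $P$ and the inclusion $C\hookrightarrow S$. Isomorphisms are pairs of $A$-isomorphisms $\mathcal{C}\to\mathcal{C}'$, $\mathcal{S}\to\mathcal{S}'$ that are the identity on the closed fibres, commute with the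 morphisms, and carry $\mathcal{D},\mathcal{P}$ to $\mathcal{D}',\mathcal{P}'$. Let $\mathrm{Def}^m(A)$ be the set of isomorphism classes of such deformations with $\mathcal{C}|_{\mathcal{D}}\supseteq m\mathcal{P}$, where $\mathcal{P}$ is regarded as a Cartier divisor on $\mathcal{D}$; it is a functor of $A$ by base change. Let $I_{mP}\subset\mathcal{O}$ be the ideal of $mP$, where $P$ is regarded as a Cartier divisor on $D$, and let $$I^{\mathrm{ea}}_{\mathrm{rel},D,P}(C)=\{\delta F\mid \delta\in\mathrm{Der}_k(\mathcal{O}),\ \delta(\mathbf{I}_D)\subseteq\mathbf{I}_D,\ \delta(\mathbf{I}_P)\subseteq\mathbf{I}_P\}+\langle F\rangle .$$ Then: 1. $I^{\mathrm{ea}}_{\mathrm{rel},D,P}(C)\subseteq I_{mP}$, and $I_{mP}/I^{\mathrm{ea}}_{\mathrm{rel},D,P}(C)$ is finite dimensional over $k$. 2. $g\mapsto[\mathbf{V}(F+\epsilon g)]$ induces an isomorphism of $k$-vector spaces from $I_{mP}/I^{\mathrm{ea}}_{\mathrm{rel},D,P}(C)$ to the tangent space $\mathrm{Def}^m(k[\epsilon])$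 with its natural vector space structure (the natural map $\mathrm{Def}^m(k[\epsilon]\times_k k[\epsilon])\to\mathrm{Def}^m(k[\epsilon])\times\mathrm{Def}^m(k[\epsilon])$ being bijective on pairs). 3. If $f_1,\dots,f_r\in I_{mP}$ represent a basis of $I_{mP}/I^{\mathrm{ea}}_{\mathrm{rel},D,P}(C)$, then $F+\sum_{i=1}^r t_if_i$ is a formal semiuniversal family for $\mathrm{Def}^m$ over $R=k[[t_1,\dots,t_r]]$: it defines a compatible system of elements of $\mathrm{Def}^m(R/\mathfrak{m}_R^{n+1})$ for $n\ge 0$, the associated transformation $h_R=\mathrm{Hom}(R,-)\to\mathrm{Def}^m$ is smooth, and $h_R(k[\epsilon])\to\mathrm{Def}^m(k[\epsilon])$ is bijective. In particular $\mathrm{Def}^m$ has a formally smooth semiuniversal family. The tangent map of this family, composed with the inverse of the isomorphism in 2, is a $k$-linear isomorphism from the tangent space $(\mathfrak{m}_R/\mathfrak{m}_R^2)^\vee$ of the base to $I_{mP}/I^{\mathrm{ea}}_{\mathrm{rel},D,P}(C)$. 4. If $x,y$ is a coordinate system on $S$ with $D=\mathbf{V}(y)$, then $I_{mP}=\langle x^m,y\rangle$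 and $I^{\mathrm{ea}}_{\mathrm{rel},D,P}(C)=\langle x\partial_xF,\ y\partial_xF,\ y\partial_yF,\ F\rangle$. -/

import Mathlib

open IsLocalRing TensorProduct

universe u v

noncomputable section

/-- The residue field of the local `k`-algebra `A` is `k`. -/
def HasResidueField (k A : Type*) [Field k] [CommRing A] [IsLocalRing A] [Algebra k A] : Prop :=
  Function.Bijective (algebraMap k (ResidueField A))

namespace HasResidueField

variable {k A B : Type*} [Field k] [CommRing A] [IsLocalRing A] [Algebra k A]
  [CommRing B] [IsLocalRing B] [Algebra k B]

/-- The reduction map `A → A / 𝔪 = k`. -/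
def res (h : HasResidueField k A) : A →ₐ[k] k :=
  ((AlgEquiv.ofBijective (Algebra.ofId k (ResidueField A)) h).symm : ResidueField A →ₐ[k] k).comp
    (IsScalarTower.toAlgHom k A (ResidueField A))

theorem ker_res (h : HasResidueField k A) : RingHom.ker h.res = maximalIdeal A := by
  ext a
  simp [res, RingHom.mem_ker]

theorem sub_res_mem (h : HasResidueField k A) (a : A) :
    a - algebraMap k A (h.res a) ∈ maximalIdeal A := by
  rw [← h.ker_res, RingHom.mem_ker]
  simp

theorem res_map (h : HasResidueField k A) (h' : HasResidueField k B) (φ : A →ₐ[k] B)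
    [IsLocalHom φ] (a : A) : h'.res (φ a) = h.res a := by
  have h1 : φ (a - algebraMap k A (h.res a)) ∈ maximalIdeal B := by
    rw [mem_maximalIdeal, mem_nonunits_iff, isUnit_map_iff φ]
    exact h.sub_res_mem a
  rw [← h'.ker_res, RingHom.mem_ker] at h1
  simpa [sub_eq_zero] using h1

theorem of_surjective (h : HasResidueField k A) (f : A →ₐ[k] B) (hf : Function.Surjective f) :
    HasResidueField k B := by
  refine ⟨(algebraMap k (ResidueField B)).injective, fun y => ?_⟩
  obtain ⟨b, rfl⟩ := residue_surjective y
  obtain ⟨a, rfl⟩ := hf b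
  have : IsLocalHom (f : A →+* B) := IsLocalHom.of_surjective _ hf
  refine ⟨h.res a, ?_⟩
  have h1 : f (a - algebraMap k A (h.res a)) ∈ maximalIdeal B := by
    rw [mem_maximalIdeal, mem_nonunits_iff]
    exact fun hu => h.sub_res_mem a (isUnit_of_map_unit (f : A →+* B) _ hu)
  rw [← ker_residue, RingHom.mem_ker] at h1
  rw [map_sub, map_sub, sub_eq_zero, AlgHom.commutes] at h1
  rw [h1]
  rfl

end HasResidueField

theorem hasResidueField_self (k : Type*) [Field k] : HasResidueField k k := by
  refine ⟨(algebraMap k (ResidueField k)).injective, fun y => ?_⟩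
  obtain ⟨b, rfl⟩ := residue_surjective y
  exact ⟨b, rfl⟩

/-- `π : X → X₀` identifies the closed fibre `X / 𝔪_A X` of the `A`-algebra `X` with the
`k`-algebra `X₀`. -/
structure IsClosedFiber (k A : Type*) [Field k] [CommRing A] [IsLocalRing A] [Algebra k A]
    {X X₀ : Type*} [CommRing X] [Algebra A X] [CommRing X₀] [Algebra k X₀] (π : X →+* X₀) :
    Prop where
  surjective : Function.Surjective π
  ker_eq : RingHom.ker π = (maximalIdeal A).map (algebraMap A X)
  map_const : ∀ c : k, π (algebraMap A X (algebraMap k A c)) = algebraMap k X₀ c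

namespace IsClosedFiber

theorem exists_sub_mem {k A B X : Type*} [Field k] [CommRing A] [Algebra k A]
    [CommRing B] [IsLocalRing B] [Algebra k B] [CommRing X] [Algebra A X] [Algebra A B]
    [IsScalarTower k A B] (hB : HasResidueField k B) (z : B ⊗[A] X) :
    ∃ x : X, z - 1 ⊗ₜ x ∈ (maximalIdeal B).map (algebraMap B (B ⊗[A] X)) := by
  induction z with
  | zero => exact ⟨0, by simp⟩
  | add z w hz hw =>
    obtain ⟨x, hx⟩ := hz
    obtain ⟨y, hy⟩ := hw
    refine ⟨x + y, ?_⟩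
    rw [tmul_add, add_sub_add_comm]
    exact add_mem hx hy
  | tmul b x =>
    refine ⟨algebraMap A X (algebraMap k A (hB.res b)) * x, ?_⟩
    have h1 : (1 : B) ⊗ₜ[A] (algebraMap A X (algebraMap k A (hB.res b)) * x) =
        (algebraMap k B (hB.res b)) ⊗ₜ x := by
      rw [← Algebra.smul_def, tmul_smul, smul_tmul', Algebra.smul_def, mul_one,
        ← IsScalarTower.algebraMap_apply]
    rw [h1, ← sub_tmul]
    have h2 : (b - algebraMap k B (hB.res b)) ⊗ₜ[A] x =
        algebraMap B (B ⊗[A] X) (b - algebraMap k B (hB.res b)) * (1 ⊗ₜ x) := by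
      simp [Algebra.TensorProduct.algebraMap_apply]
    rw [h2]
    exact Ideal.mul_mem_right _ _ (Ideal.mem_map_of_mem _ (hB.sub_res_mem b))

variable {k A B X X₀ : Type*} [Field k] [CommRing A] [IsLocalRing A] [Algebra k A]
  [CommRing B] [IsLocalRing B] [Algebra k B] [CommRing X] [Algebra A X] [CommRing X₀]
  [Algebra k X₀] {π : X →+* X₀}

theorem map_algebraMap (h : IsClosedFiber k A π) (hA : HasResidueField k A) (a : A) :
    π (algebraMap A X a) = algebraMap k X₀ (hA.res a) := by
  have h1 : algebraMap A X (a - algebraMap k A (hA.res a)) ∈ RingHom.ker π := by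
    rw [h.ker_eq]
    exact Ideal.mem_map_of_mem _ (hA.sub_res_mem a)
  rw [RingHom.mem_ker, map_sub, map_sub, sub_eq_zero, h.map_const] at h1
  exact h1

variable [Algebra A B] [IsScalarTower k A B] [IsLocalHom (algebraMap A B)]

/-- The map `B ⊗ X → X₀`, `b ⊗ x ↦ b(0) π(x)`, for a local homomorphism `A → B`. -/
def baseChange (h : IsClosedFiber k A π) (hA : HasResidueField k A) (hB : HasResidueField k B) :
    B ⊗[A] X →+* X₀ :=
  letI : Algebra A X₀ := (π.comp (algebraMap A X)).toAlgebra
  (Algebra.TensorProduct.productMap (R := A)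
    { (algebraMap k X₀).comp (hB.res : B →+* k) with
      commutes' := fun a => by
        have : IsLocalHom (IsScalarTower.toAlgHom k A B) :=
          ⟨fun a ha => isUnit_of_map_unit (algebraMap A B) a ha⟩
        change algebraMap k X₀ (hB.res (IsScalarTower.toAlgHom k A B a)) = π (algebraMap A X a)
        rw [hA.res_map hB, h.map_algebraMap hA] }
    { π with commutes' := fun _ => rfl } : B ⊗[A] X →ₐ[A] X₀).toRingHom

@[simp]
theorem baseChange_tmul (h : IsClosedFiber k A π) (hA : HasResidueField k A)
    (hB : HasResidueField k B) (b : B) (x : X) :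
    h.baseChange hA hB (b ⊗ₜ x) = algebraMap k X₀ (hB.res b) * π x :=
  rfl

theorem isClosedFiber_baseChange (h : IsClosedFiber k A π) (hA : HasResidueField k A)
    (hB : HasResidueField k B) : IsClosedFiber k B (h.baseChange hA hB) where
  surjective y := by
    obtain ⟨x, rfl⟩ := h.surjective y
    exact ⟨1 ⊗ₜ x, by simp⟩
  map_const c := by simp [Algebra.TensorProduct.algebraMap_apply]
  ker_eq := by
    have hle : (maximalIdeal B).map (algebraMap B (B ⊗[A] X)) ≤
        RingHom.ker (h.baseChange hA hB) := by
      rw [Ideal.map_le_iff_le_comap]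
      intro b hb
      rw [← hB.ker_res, RingHom.mem_ker] at hb
      simp [Algebra.TensorProduct.algebraMap_apply, RingHom.mem_ker, hb]
    refine le_antisymm (fun z hz => ?_) hle
    obtain ⟨x, hx⟩ := exists_sub_mem hB z
    have h1 := hle hx
    rw [RingHom.mem_ker] at h1 hz
    rw [map_sub, hz, baseChange_tmul, map_one, map_one, one_mul, zero_sub, neg_eq_zero] at h1
    rw [← RingHom.mem_ker, h.ker_eq] at h1
    have h2 : (1 : B) ⊗ₜ[A] x ∈ (maximalIdeal B).map (algebraMap B (B ⊗[A] X)) := by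
      have h3 := Ideal.mem_map_of_mem
        ((Algebra.TensorProduct.includeRight : X →ₐ[A] B ⊗[A] X) : X →+* B ⊗[A] X) h1
      rw [Ideal.map_map, AlgHom.comp_algebraMap, IsScalarTower.algebraMap_eq A B (B ⊗[A] X),
        ← Ideal.map_map] at h3
      have h4 : (maximalIdeal A).map (algebraMap A B) ≤ maximalIdeal B :=
        ((local_hom_TFAE (algebraMap A B)).out 0 2 rfl rfl).mp inferInstance
      exact Ideal.map_mono h4 h3
    have := add_mem hx h2
    rwa [sub_add_cancel] at this

end IsClosedFiber

theorem exists_pow_maximalIdeal_eq_bot (A : Type*) [CommRing A] [IsLocalRing A]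
    [IsArtinianRing A] : ∃ n, maximalIdeal A ^ n = ⊥ := by
  obtain ⟨n, hn⟩ := IsArtinianRing.isNilpotent_jacobson_bot (R := A)
  exact ⟨n, by rwa [jacobson_eq_maximalIdeal ⊥ bot_ne_top] at hn⟩

/-- A morphism over an artinian base is a closed immersion if it is one on the closed fibres. -/
theorem surjective_of_closedFiber {k A X X₀ Y Y₀ : Type*} [Field k] [CommRing A] [IsLocalRing A]
    [IsArtinianRing A] [Algebra k A] [CommRing X] [Algebra A X] [CommRing X₀] [Algebra k X₀]
    [CommRing Y] [Algebra A Y] [CommRing Y₀] [Algebra k Y₀] {π : X →+* X₀} {ρ : Y →+* Y₀}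
    (hπ : IsClosedFiber k A π) (hρ : IsClosedFiber k A ρ) (ι : X →ₐ[A] Y) (ι₀ : X₀ →+* Y₀)
    (hι : ∀ x, ρ (ι x) = ι₀ (π x)) (h : Function.Surjective ι₀) : Function.Surjective ι := by
  obtain ⟨n, hn⟩ := exists_pow_maximalIdeal_eq_bot A
  have h0 : (⊤ : Submodule A Y) ≤ LinearMap.range ι.toLinearMap ⊔ (maximalIdeal A) • ⊤ := by
    intro y _
    obtain ⟨x₀, hx₀⟩ := h (ρ y)
    obtain ⟨x, rfl⟩ := hπ.surjective x₀
    have h1 : y - ι x ∈ RingHom.ker ρ := by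
      rw [RingHom.mem_ker, map_sub, hι, hx₀, sub_self]
    rw [hρ.ker_eq, ← Submodule.restrictScalars_mem A, ← Ideal.smul_top_eq_map] at h1
    have := Submodule.add_mem_sup (LinearMap.mem_range_self ι.toLinearMap x) h1
    simpa using this
  have h1 : ∀ j : ℕ, (⊤ : Submodule A Y) ≤
      LinearMap.range ι.toLinearMap ⊔ (maximalIdeal A ^ j) • ⊤ := by
    intro j
    induction j with
    | zero => rw [pow_zero, Ideal.one_eq_top, Submodule.top_smul]; exact le_sup_right
    | succ j ih =>
      refine ih.trans (sup_le le_sup_left ?_)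
      calc (maximalIdeal A ^ j) • (⊤ : Submodule A Y)
          ≤ (maximalIdeal A ^ j) • (LinearMap.range ι.toLinearMap ⊔ (maximalIdeal A) • ⊤) :=
            Submodule.smul_mono le_rfl h0
        _ ≤ _ := by
            rw [Submodule.smul_sup, ← Submodule.mul_smul, ← pow_succ]
            exact sup_le_sup_right Submodule.smul_le_right _
  have h2 := h1 n
  rw [hn, Submodule.bot_smul, sup_bot_eq, top_le_iff] at h2
  exact LinearMap.range_eq_top.mp h2

theorem flat_quotient_span_singleton {A N : Type*} [CommRing A] [CommRing N] [Algebra A N]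
    [Module.Flat A N] (G : N) (hG : ∀ (J : Ideal A) (n : N),
      G * n ∈ J.map (algebraMap A N) → n ∈ J.map (algebraMap A N)) :
    Module.Flat A (N ⧸ Ideal.span {G}) := by
  rw [Module.Flat.iff_forall_isTrivialRelation]
  intro l f x hx
  choose n hn using fun i => Ideal.Quotient.mk_surjective (x i)
  obtain rfl : (fun i => Ideal.Quotient.mk _ (n i)) = x := funext hn
  have h1 : ∑ i, f i • n i ∈ Ideal.span {G} := by
    rw [← Ideal.Quotient.eq_zero_iff_mem, map_sum, ← hx]
    rfl
  obtain ⟨g, hg⟩ := Ideal.mem_span_singleton'.mp h1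
  have h2 : g ∈ (Ideal.span (Set.range f)).map (algebraMap A N) := by
    apply hG
    rw [mul_comm, hg]
    refine sum_mem fun i _ => ?_
    rw [Algebra.smul_def]
    exact Ideal.mul_mem_right _ _ (Ideal.mem_map_of_mem _ (Ideal.subset_span ⟨i, rfl⟩))
  rw [Ideal.map_span, ← Set.range_comp, Ideal.mem_span_range_iff_exists_fun] at h2
  obtain ⟨c, hc⟩ := h2
  have h3 : ∑ i, f i • (n i - c i * G) = 0 := by
    simp only [smul_sub, Finset.sum_sub_distrib]
    rw [← hg, ← hc, Finset.sum_mul, sub_eq_zero]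
    refine Finset.sum_congr rfl fun i _ => ?_
    rw [Algebra.smul_def, Function.comp_apply]
    ring
  obtain ⟨κ, a, y, hy, ha⟩ := Module.Flat.iff_forall_isTrivialRelation.mp ‹_› h3
  refine ⟨κ, a, fun j => Ideal.Quotient.mk _ (y j), fun i => ?_, ha⟩
  have h4 : (Ideal.Quotient.mk (Ideal.span {G})) (n i) =
      Ideal.Quotient.mk (Ideal.span {G}) (n i - c i * G) := by
    rw [Ideal.Quotient.mk_eq_mk_iff_sub_mem, sub_sub_cancel]
    exact Ideal.mul_mem_left _ _ (Ideal.mem_span_singleton_self G)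
  have h5 := congrArg (Ideal.Quotient.mk (Ideal.span {G})) (hy i)
  rw [map_sum] at h5
  exact h4.trans h5

theorem mem_map_of_mul_mem {k A O : Type*} [Field k] [CommRing A] [Algebra k A] [CommRing O]
    [Algebra k O] {F : O} (hF : F ∈ nonZeroDivisors O) (G : A ⊗[k] O)
    (hG : IsNilpotent (G - 1 ⊗ₜ F)) (J : Ideal A) (n : A ⊗[k] O)
    (h : G * n ∈ J.map (algebraMap A (A ⊗[k] O))) : n ∈ J.map (algebraMap A (A ⊗[k] O)) := by
  have hk : RingHom.ker (Algebra.TensorProduct.map (Ideal.Quotient.mkₐ k J) (AlgHom.id k O)) =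
      J.map (algebraMap A (A ⊗[k] O)) := by
    rw [Algebra.TensorProduct.rTensor_ker _ (Ideal.Quotient.mkₐ_surjective k J),
      AlgHom.ker_coe, Ideal.Quotient.mkₐ_ker]
    rfl
  rw [← hk, RingHom.mem_ker] at h ⊢
  set p := Algebra.TensorProduct.map (Ideal.Quotient.mkₐ k J) (AlgHom.id k O)
  have hreg : ∀ z : (A ⧸ J) ⊗[k] O, (1 ⊗ₜ F) * z = 0 → z = 0 := by
    intro z hz
    have hinj : Function.Injective (LinearMap.mulLeft k F) := by
      rw [← LinearMap.ker_eq_bot, LinearMap.ker_eq_bot']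
      intro o ho
      exact (mem_nonZeroDivisors_iff.mp hF).1 o ho
    have h1 := Module.Flat.lTensor_preserves_injective_linearMap (M := A ⧸ J) _ hinj
    apply h1
    rw [map_zero, ← hz]
    clear hz
    induction z with
    | zero => simp
    | add z w hz hw => rw [map_add, mul_add, hz, hw]
    | tmul a o => simp
  obtain ⟨e, he⟩ := hG
  have hpow : ∀ j : ℕ, (1 ⊗ₜ F) ^ j * p n = (-p (G - 1 ⊗ₜ F)) ^ j * p n := by
    intro j
    induction j with
    | zero => simp
    | succ j ih =>
      have h1 : (1 ⊗ₜ F) * p n = -p (G - 1 ⊗ₜ F) * p n := by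
        have h2 : p (1 ⊗ₜ F) = 1 ⊗ₜ F := by simp [p]
        rw [map_sub, h2, neg_sub, sub_mul, ← map_mul p G, h, sub_zero]
      rw [pow_succ, mul_assoc, h1, pow_succ, ← mul_assoc, mul_comm _ (-p _), mul_assoc, ih]
      ring
  have h3 : (1 ⊗ₜ F) ^ e * p n = 0 := by
    rw [hpow, neg_pow, ← map_pow, he, map_zero, mul_zero, zero_mul]
  have h4 : ∀ (j : ℕ) (z : (A ⧸ J) ⊗[k] O), (1 ⊗ₜ F) ^ j * z = 0 → z = 0 := by
    intro j
    induction j with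
    | zero => intro z hz; simpa using hz
    | succ j ih =>
      intro z hz
      rw [pow_succ, mul_assoc] at hz
      exact hreg z (ih _ hz)
  exact h4 e _ h3

/-- Objects of `𝒜_k`: local artinian `k`-algebras with residue field `k`. -/
structure ArtAlg (k : Type u) [Field k] where
  carrier : Type u
  [commRing : CommRing carrier]
  [isLocalRing : IsLocalRing carrier]
  [isArtinianRing : IsArtinianRing carrier]
  [algebra : Algebra k carrier]
  hasResidueField : HasResidueField k carrier

/-- Objects of the category of complete local noetherian `k`-algebras with residue field `k`. -/
structure CompAlg (k : Type u) [Field k] where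
  carrier : Type u
  [commRing : CommRing carrier]
  [isLocalRing : IsLocalRing carrier]
  [isNoetherianRing : IsNoetherianRing carrier]
  [isAdicComplete : IsAdicComplete (maximalIdeal carrier) carrier]
  [algebra : Algebra k carrier]
  hasResidueField : HasResidueField k carrier

attribute [instance] ArtAlg.commRing ArtAlg.isLocalRing ArtAlg.isArtinianRing ArtAlg.algebra
  CompAlg.commRing CompAlg.isLocalRing CompAlg.isNoetherianRing CompAlg.isAdicComplete
  CompAlg.algebra

/-- Local homomorphisms of `k`-algebras. -/
abbrev LocalAlgHom (k R A : Type*) [Field k] [CommRing R] [CommRing A] [Algebra k R]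
    [Algebra k A] : Type _ :=
  {φ : R →ₐ[k] A // IsLocalHom φ}

section categories

variable {k : Type u} [Field k]

/-- Composition of local homomorphisms. -/
def LocalAlgHom.comp {R A B : Type*} [CommRing R] [CommRing A] [CommRing B] [Algebra k R]
    [Algebra k A] [Algebra k B] (ψ : LocalAlgHom k A B) (φ : LocalAlgHom k R A) :
    LocalAlgHom k R B :=
  ⟨ψ.1.comp φ.1, ⟨fun a ha => φ.2.map_nonunit a (ψ.2.map_nonunit (φ.1 a) ha)⟩⟩

instance : CategoryTheory.Category (ArtAlg k) where
  Hom A B := LocalAlgHom k A.carrier B.carrier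
  id A := ⟨AlgHom.id k A.carrier, ⟨fun _ ha => ha⟩⟩
  comp φ ψ := LocalAlgHom.comp ψ φ

theorem isArtinianRing_quotient_pow (R : Type*) [CommRing R] [IsLocalRing R] [IsNoetherianRing R]
    (n : ℕ) : IsArtinianRing (R ⧸ maximalIdeal R ^ (n + 1)) := by
  apply IsLocalRing.quotient_artinian_of_mem_minimalPrimes_of_isLocalRing
  rw [← Ideal.radical_minimalPrimes, Ideal.radical_pow _ n.succ_ne_zero,
    (maximalIdeal.isMaximal R).isPrime.radical, Ideal.minimalPrimes_eq_subsingleton_self]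
  rfl

theorem isLocalRing_quotient_pow (R : Type*) [CommRing R] [IsLocalRing R] (n : ℕ) :
    IsLocalRing (R ⧸ maximalIdeal R ^ (n + 1)) := by
  have : Nontrivial (R ⧸ maximalIdeal R ^ (n + 1)) := by
    rw [Ideal.Quotient.nontrivial_iff]
    exact ne_top_of_le_ne_top (maximalIdeal.isMaximal R).ne_top
      (Ideal.pow_le_self n.succ_ne_zero)
  exact IsLocalRing.of_surjective' (Ideal.Quotient.mk _) Ideal.Quotient.mk_surjective

/-- The artinian quotient `R / 𝔪ⁿ⁺¹` of a complete local algebra `R`. -/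
def CompAlg.trunc (R : CompAlg k) (n : ℕ) : ArtAlg k :=
  haveI := isLocalRing_quotient_pow R.carrier n
  { carrier := R.carrier ⧸ maximalIdeal R.carrier ^ (n + 1)
    isLocalRing := this
    isArtinianRing := isArtinianRing_quotient_pow R.carrier n
    hasResidueField := R.hasResidueField.of_surjective (Ideal.Quotient.mkₐ k _)
      (Ideal.Quotient.mkₐ_surjective k _) }

/-- The homomorphism `R / 𝔪ⁿ⁺¹ → A` induced by `φ : R → A`, if `𝔪_A ^ (n + 1) = 0`. -/
def CompAlg.factor (R : CompAlg k) {A : ArtAlg k} (φ : LocalAlgHom k R.carrier A.carrier) (n : ℕ)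
    (hn : maximalIdeal A.carrier ^ (n + 1) = ⊥) : R.trunc n ⟶ A :=
  ⟨Ideal.Quotient.liftₐ (maximalIdeal R.carrier ^ (n + 1)) φ.1 (by
      intro a ha
      have := φ.2
      have h1 : (maximalIdeal R.carrier).map (φ.1 : R.carrier →+* A.carrier) ≤
          maximalIdeal A.carrier := by
        rw [Ideal.map_le_iff_le_comap]
        intro x hx hu
        exact hx (this.map_nonunit x hu)
      have h2 := (Ideal.pow_right_mono h1 (n + 1))
        (Ideal.map_pow (φ.1 : R.carrier →+* A.carrier) _ _ ▸ Ideal.mem_map_of_mem _ ha)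
      rw [hn] at h2
      exact h2),
    ⟨by
      intro a ha
      obtain ⟨b, rfl⟩ := Ideal.Quotient.mk_surjective a
      exact (φ.2.map_nonunit b ha).map _⟩⟩

theorem ArtAlg.exists_pow_succ_eq_bot (A : ArtAlg k) :
    ∃ n, maximalIdeal A.carrier ^ (n + 1) = ⊥ := by
  obtain ⟨n, hn⟩ := exists_pow_maximalIdeal_eq_bot A.carrier
  exact ⟨n, by rw [pow_succ, hn, Ideal.bot_mul]⟩

/-- The projection `R / 𝔪ⁿ⁺² → R / 𝔪ⁿ⁺¹`. -/
def CompAlg.transition (R : CompAlg k) (n : ℕ) : R.trunc (n + 1) ⟶ R.trunc n :=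
  ⟨Ideal.Quotient.factorₐ k (Ideal.pow_le_pow_right (Nat.le_succ (n + 1))), by
    have : IsLocalRing (R.carrier ⧸ maximalIdeal R.carrier ^ (n + 1 + 1)) :=
      isLocalRing_quotient_pow R.carrier (n + 1)
    have : Nontrivial (R.carrier ⧸ maximalIdeal R.carrier ^ (n + 1)) :=
      (isLocalRing_quotient_pow R.carrier n).toNontrivial
    have h := IsLocalHom.of_surjective
      (Ideal.Quotient.factor (Ideal.pow_le_pow_right (I := maximalIdeal R.carrier)
        (Nat.le_succ (n + 1)))) (Ideal.Quotient.factor_surjective _)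
    exact ⟨fun a ha => h.map_nonunit a ha⟩⟩

open CategoryTheory

/-- The value `F̂(R) = lim F(R / 𝔪ⁿ⁺¹)` on a complete local algebra `R` of the extension of
`F : 𝒜_k → Set`. -/
def FormalElement (F : ArtAlg k ⥤ Type v) (R : CompAlg k) : Type v :=
  {ξ : ∀ n, F.obj (R.trunc n) // ∀ n, F.map (R.transition n) (ξ (n + 1)) = ξ n}

/-- The natural transformation `h_R → F` associated with an element of `F̂(R)`: a homomorphism
`φ : R → A` factors through some `R / 𝔪ⁿ⁺¹`, and the result does not depend on `n`. -/
def FormalElement.toMap {F : ArtAlg k ⥤ Type v} {R : CompAlg k} (ξ : FormalElement F R)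
    (A : ArtAlg k) (φ : LocalAlgHom k R.carrier A.carrier) : F.obj A :=
  F.map (R.factor φ A.exists_pow_succ_eq_bot.choose A.exists_pow_succ_eq_bot.choose_spec)
    (ξ.1 A.exists_pow_succ_eq_bot.choose)

/-- `h_R → F` is smooth: for every surjection `p : B → A` in `𝒜_k` the map
`h_R(B) → h_R(A) ×_{F(A)} F(B)` is surjective. -/
def FormalElement.IsVersal {F : ArtAlg k ⥤ Type v} {R : CompAlg k} (ξ : FormalElement F R) :
    Prop :=
  ∀ (B A : ArtAlg k) (p : B ⟶ A), Function.Surjective p.1 →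
    ∀ (φ : LocalAlgHom k R.carrier A.carrier) (η : F.obj B), F.map p η = ξ.toMap A φ →
      ∃ ψ : LocalAlgHom k R.carrier B.carrier, LocalAlgHom.comp p ψ = φ ∧ ξ.toMap B ψ = η

/-- The square-zero extension `k ⊕ V` by a finite-dimensional vector space `V`. -/
def ArtAlg.sqZero (k : Type u) [Field k] (V : Type u) [AddCommGroup V] [Module k V]
    [Module kᵐᵒᵖ V] [IsCentralScalar k V] [Module.Finite k V] : ArtAlg k :=
  haveI : IsLocalRing (TrivSqZeroExt k V) :=
    { isUnit_or_isUnit_of_add_one := by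
        intro a b h
        rw [TrivSqZeroExt.isUnit_iff_isUnit_fst, TrivSqZeroExt.isUnit_iff_isUnit_fst]
        exact IsLocalRing.isUnit_or_isUnit_of_add_one (congrArg TrivSqZeroExt.fst h) }
  { carrier := TrivSqZeroExt k V
    isLocalRing := this
    isArtinianRing :=
      haveI : Module.Finite k (TrivSqZeroExt k V) := inferInstanceAs (Module.Finite k (k × V))
      IsArtinianRing.of_finite k _
    hasResidueField := by
      refine ⟨(algebraMap k (ResidueField (TrivSqZeroExt k V))).injective, fun y => ?_⟩
      obtain ⟨b, rfl⟩ := residue_surjective y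
      refine ⟨b.fst, ?_⟩
      change residue _ (algebraMap k (TrivSqZeroExt k V) b.fst) = _
      rw [← sub_eq_zero, ← map_sub, residue_eq_zero_iff, mem_maximalIdeal, mem_nonunits_iff,
        TrivSqZeroExt.isUnit_iff_isUnit_fst]
      simp [TrivSqZeroExt.algebraMap_eq_inl] }

/-- The homomorphism `k ⊕ V → k ⊕ W` induced by a linear map. -/
def ArtAlg.sqZeroMap {V W : Type u} [AddCommGroup V] [Module k V]
    [Module kᵐᵒᵖ V] [IsCentralScalar k V] [Module.Finite k V] [AddCommGroup W] [Module k W]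
    [Module kᵐᵒᵖ W] [IsCentralScalar k W] [Module.Finite k W] (f : V →ₗ[k] W) :
    ArtAlg.sqZero k V ⟶ ArtAlg.sqZero k W :=
  ⟨TrivSqZeroExt.map f, ⟨fun a ha =>
    TrivSqZeroExt.isUnit_iff_isUnit_fst.mpr
      (TrivSqZeroExt.fst_map f a ▸ TrivSqZeroExt.isUnit_iff_isUnit_fst.mp ha)⟩⟩

/-- The dual numbers `k[ε]`. -/
abbrev ArtAlg.dual (k : Type u) [Field k] : ArtAlg k := ArtAlg.sqZero k k

/-- `ξ` is semiuniversal: it is versal and `h_R(k[ε]) → F(k[ε])` is bijective. -/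
def FormalElement.IsSemiuniversal {F : ArtAlg k ⥤ Type v} {R : CompAlg k}
    (ξ : FormalElement F R) : Prop :=
  ξ.IsVersal ∧ Function.Bijective (ξ.toMap (ArtAlg.dual k))

/-- `θ` identifies the vector space `T` with the tangent space `F(k[ε])` of `F`, where the sum of
`a, b ∈ F(k[ε])` is the image under `k[ε₁, ε₂] → k[ε]` of the unique element of
`F(k[ε₁, ε₂]) = F(k[ε] ×_k k[ε])` inducing `a` and `b`, and scalars `c` act through
`ε ↦ c ε`. -/
structure IsTangentSpace (F : ArtAlg k ⥤ Type v) (T : Type*) [AddCommGroup T] [Module k T]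
    (θ : T → F.obj (ArtAlg.dual k)) : Prop where
  bijective : Function.Bijective θ
  existsUnique : ∀ s t, ∃! z : F.obj (ArtAlg.sqZero k (k × k)),
    F.map (ArtAlg.sqZeroMap (LinearMap.fst k k k)) z = θ s ∧
      F.map (ArtAlg.sqZeroMap (LinearMap.snd k k k)) z = θ t
  map_add : ∀ s t (z : F.obj (ArtAlg.sqZero k (k × k))),
    F.map (ArtAlg.sqZeroMap (LinearMap.fst k k k)) z = θ s →
      F.map (ArtAlg.sqZeroMap (LinearMap.snd k k k)) z = θ t →
        θ (s + t) =
          F.map (ArtAlg.sqZeroMap (LinearMap.fst k k k + LinearMap.snd k k k)) z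
  map_smul : ∀ (c : k) t,
    θ (c • t) = F.map (ArtAlg.sqZeroMap (c • (LinearMap.id : k →ₗ[k] k))) (θ t)

theorem maximalIdeal_mvPowerSeries (n : ℕ) :
    maximalIdeal (MvPowerSeries (Fin n) k) = Ideal.span (Set.range MvPowerSeries.X) := by
  apply le_antisymm
  · induction n with
    | zero =>
      intro f hf
      have h1 : MvPowerSeries.isEmptyEquiv k (σ := Fin 0) f = 0 := by
        by_contra h
        exact hf ((MulEquiv.isUnit_map (MvPowerSeries.isEmptyEquiv k (σ := Fin 0))).mp
          (isUnit_iff_ne_zero.mpr h))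
      rw [map_eq_zero_iff _ (AlgEquiv.injective _)] at h1
      rw [h1]
      exact zero_mem _
    | succ n ih =>
      intro f hf
      set e := MvPowerSeries.finSuccEquiv k n
      have h1 : PowerSeries.constantCoeff (e f) ∈ maximalIdeal (MvPowerSeries (Fin n) k) := by
        intro hu
        rw [← PowerSeries.isUnit_iff_constantCoeff, MulEquiv.isUnit_map] at hu
        exact hf hu
      have h2 := PowerSeries.eq_X_mul_shift_add_const (e f)
      have h3 : f = MvPowerSeries.X 0 *
          e.symm (PowerSeries.mk fun p => PowerSeries.coeff (p + 1) (e f)) +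
             e.symm (PowerSeries.C (PowerSeries.constantCoeff (e f))) := by
        apply e.injective
        rw [map_add, map_mul, e.apply_symm_apply, e.apply_symm_apply,
          MvPowerSeries.finSuccEquiv_X_zero]
        exact h2
      rw [h3]
      refine add_mem (Ideal.mul_mem_right _ _ (Ideal.subset_span ⟨0, rfl⟩)) ?_
      have h4 := Ideal.mem_map_of_mem
        ((e.symm : _ →+* MvPowerSeries (Fin (n + 1)) k).comp PowerSeries.C) (ih h1)
      rw [Ideal.map_span] at h4
      refine Ideal.span_mono ?_ h4
      rintro _ ⟨_, ⟨j, rfl⟩, rfl⟩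
      refine ⟨j.succ, ?_⟩
      apply e.injective
      rw [MvPowerSeries.finSuccEquiv_X_succ]
      exact (e.apply_symm_apply _).symm
  · rw [Ideal.span_le]
    rintro _ ⟨j, rfl⟩ hu
    rw [MvPowerSeries.isUnit_iff_constantCoeff, MvPowerSeries.constantCoeff_X] at hu
    exact not_isUnit_zero hu

/-- The power series ring `k[[t₁, …, tᵣ]]`. -/
def CompAlg.powerSeries (k : Type u) [Field k] (r : ℕ) : CompAlg k where
  carrier := MvPowerSeries (Fin r) k
  isAdicComplete := by
    rw [maximalIdeal_mvPowerSeries]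
    infer_instance
  hasResidueField := by
    refine ⟨(algebraMap k (ResidueField (MvPowerSeries (Fin r) k))).injective, fun y => ?_⟩
    obtain ⟨b, rfl⟩ := residue_surjective y
    refine ⟨MvPowerSeries.constantCoeff b, ?_⟩
    change residue _ (algebraMap k (MvPowerSeries (Fin r) k) _) = _
    rw [← sub_eq_zero, ← map_sub, residue_eq_zero_iff, mem_maximalIdeal, mem_nonunits_iff,
      MvPowerSeries.isUnit_iff_constantCoeff]
    simp [MvPowerSeries.algebraMap_apply]

end categories

/-- The ideal of the subscheme `mP` of `S`, where `P` is viewed as a Cartier divisor on `D`;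
here `D ≤ P` are the ideals of `P ⊆ D ⊆ S`. -/
def multIdeal {S : Type*} [CommRing S] (D P : Ideal S) (m : ℕ) : Ideal S :=
  D ⊔ P ^ m

theorem ideal_map_map_eq {R S T U F G F' G' : Type*} [CommRing R] [CommRing S] [CommRing T]
    [CommRing U] [FunLike F R S] [RingHomClass F R S] [FunLike G S T] [RingHomClass G S T]
    [FunLike F' R U] [RingHomClass F' R U] [FunLike G' U T] [RingHomClass G' U T]
    (I : Ideal R) (f : F) (g : G) (f' : F') (g' : G') (h : ∀ x, g (f x) = g' (f' x)) :
    (I.map f).map g = (I.map f').map g' := by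
  have h1 := Ideal.map_map (I := I) (f : R →+* S) (g : S →+* T)
  have h2 := Ideal.map_map (I := I) (f' : R →+* U) (g' : U →+* T)
  have h3 : (g : S →+* T).comp (f : R →+* S) = (g' : U →+* T).comp (f' : R →+* U) :=
    RingHom.ext h
  rw [h3] at h1
  exact h1.trans h2.symm

theorem ideal_map_map_eq' {R S T F G F' : Type*} [CommRing R] [CommRing S] [CommRing T]
    [FunLike F R S] [RingHomClass F R S] [FunLike G S T] [RingHomClass G S T]
    [FunLike F' R T] [RingHomClass F' R T]
    (I : Ideal R) (f : F) (g : G) (f' : F') (h : ∀ x, g (f x) = f' x) :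
    (I.map f).map g = I.map f' :=
  (ideal_map_map_eq I f g f' (RingHom.id T) h).trans (Ideal.map_id _)

section deformations

variable {k : Type u} [Field k] {O : Type u} [CommRing O] [IsLocalRing O] [Algebra k O]

/-- A deformation of `C → (S ⊃ D ⊃ P)` over `A`, where `S = Spec O`, `P` is the closed point of `S`,
and `C` and `D` are given by their ideals. All schemes involved are affine, as infinitesimal
thickenings of affine schemes, so that they are given by their rings `OS` and `OC`, and the
subschemes of `Spec OS` deforming `D` and `P` are given by their ideals `ID` and `IP`. -/
structure LogDeformation (k : Type u) [Field k] {O : Type u} [CommRing O] [IsLocalRing O]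
    [Algebra k O] (C D : Ideal O) (A : Type u) [CommRing A] [IsLocalRing A] [Algebra k A] :
    Type (u + 1) where
  OS : Type u
  OC : Type u
  [commRingOS : CommRing OS]
  [commRingOC : CommRing OC]
  [algebraOS : Algebra A OS]
  [algebraOC : Algebra A OC]
  flatOS : Module.Flat A OS
  flatOC : Module.Flat A OC
  /-- the identification of the closed fibre of the deformation of `S` with `S` -/
  πS : OS →+* O
  /-- the identification of the closed fibre of the deformation of `C` with `C` -/
  πC : OC →+* O ⧸ C
  closedFiberS : IsClosedFiber k A πS
  closedFiberC : IsClosedFiber k A πC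
  ID : Ideal OS
  flatD : Module.Flat A (OS ⧸ ID)
  map_ID : ID.map πS = D
  IP : Ideal OS
  ID_le_IP : ID ≤ IP
  /-- the deformation of `P` is a section over `A` -/
  isSection : Function.Bijective (algebraMap A (OS ⧸ IP))
  map_IP : IP.map πS = maximalIdeal O
  /-- the morphism from the deformation of `C` to the deformation of `S` -/
  ι : OS →ₐ[A] OC
  /-- on closed fibres, `ι` is the inclusion of `C` into `S` -/
  πC_ι : ∀ s, πC (ι s) = Ideal.Quotient.mk C (πS s)

attribute [instance] LogDeformation.commRingOS LogDeformation.commRingOC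
  LogDeformation.algebraOS LogDeformation.algebraOC

namespace LogDeformation

variable {C D : Ideal O} {A B E : Type u} [CommRing A] [IsLocalRing A] [Algebra k A]
  [CommRing B] [IsLocalRing B] [Algebra k B] [CommRing E] [IsLocalRing E] [Algebra k E]

/-- Isomorphism of deformations. -/
def Equivalent (X Y : LogDeformation k C D A) : Prop :=
  ∃ (α : X.OC ≃ₐ[A] Y.OC) (β : X.OS ≃ₐ[A] Y.OS),
    (∀ s, Y.ι (β s) = α (X.ι s)) ∧ (∀ s, Y.πS (β s) = X.πS s) ∧ (∀ c, Y.πC (α c) = X.πC c) ∧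
      X.ID.map β = Y.ID ∧ X.IP.map β = Y.IP

theorem equivalent_refl (X : LogDeformation k C D A) : X.Equivalent X :=
  ⟨AlgEquiv.refl, AlgEquiv.refl, fun _ => rfl, fun _ => rfl, fun _ => rfl, Ideal.map_id _,
    Ideal.map_id _⟩

theorem Equivalent.symm {X Y : LogDeformation k C D A} (h : X.Equivalent Y) : Y.Equivalent X := by
  obtain ⟨α, β, h1, h2, h3, h4, h5⟩ := h
  refine ⟨α.symm, β.symm, fun s => ?_, fun s => ?_, fun s => ?_, ?_, ?_⟩
  · apply α.injective
    rw [← h1, α.apply_symm_apply, β.apply_symm_apply]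
  · rw [← h2, β.apply_symm_apply]
  · rw [← h3, α.apply_symm_apply]
  · rw [← h4]
    exact Ideal.map_of_equiv β.toRingEquiv
  · rw [← h5]
    exact Ideal.map_of_equiv β.toRingEquiv

theorem Equivalent.trans {X Y Z : LogDeformation k C D A} (h : X.Equivalent Y)
    (h' : Y.Equivalent Z) : X.Equivalent Z := by
  obtain ⟨α, β, h1, h2, h3, h4, h5⟩ := h
  obtain ⟨α', β', h1', h2', h3', h4', h5'⟩ := h'
  refine ⟨α.trans α', β.trans β', fun s => ?_, fun s => ?_, fun s => ?_, ?_, ?_⟩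
  · simp [h1, h1']
  · simp [h2, h2']
  · simp [h3, h3']
  · rw [← h4', ← h4]
    exact (Ideal.map_map (β : X.OS →+* Y.OS) (β' : Y.OS →+* Z.OS)).symm
  · rw [← h5', ← h5]
    exact (Ideal.map_map (β : X.OS →+* Y.OS) (β' : Y.OS →+* Z.OS)).symm

instance setoid (C D : Ideal O) (A : Type u) [CommRing A] [IsLocalRing A] [Algebra k A] :
    Setoid (LogDeformation k C D A) where
  r := Equivalent
  iseqv := ⟨equivalent_refl, Equivalent.symm, Equivalent.trans⟩

/-- The condition `𝒞|_𝒟 ⊇ m𝒫`. -/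
def ContainsMult (X : LogDeformation k C D A) (m : ℕ) : Prop :=
  RingHom.ker X.ι ≤ multIdeal X.ID X.IP m

theorem ι_surjective [IsArtinianRing A] (X : LogDeformation k C D A) :
    Function.Surjective X.ι :=
  surjective_of_closedFiber X.closedFiberS X.closedFiberC X.ι (Ideal.Quotient.mk C) X.πC_ι
    Ideal.Quotient.mk_surjective

variable [Algebra A B] [IsScalarTower k A B] [IsLocalHom (algebraMap A B)]

/-- The base change of a deformation along a local homomorphism `A → B`. -/
def baseChange (X : LogDeformation k C D A) (hA : HasResidueField k A)
    (hB : HasResidueField k B) : LogDeformation k C D B where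
  OS := B ⊗[A] X.OS
  OC := B ⊗[A] X.OC
  flatOS := have := X.flatOS; inferInstance
  flatOC := have := X.flatOC; inferInstance
  πS := X.closedFiberS.baseChange hA hB
  πC := X.closedFiberC.baseChange hA hB
  closedFiberS := X.closedFiberS.isClosedFiber_baseChange hA hB
  closedFiberC := X.closedFiberC.isClosedFiber_baseChange hA hB
  ID := X.ID.map (Algebra.TensorProduct.includeRight : X.OS →ₐ[A] B ⊗[A] X.OS)
  flatD := by
    have := X.flatD
    exact Module.Flat.of_linearEquiv
      (Algebra.TensorProduct.tensorQuotientEquiv (R := A) B X.OS B X.ID).symm.toLinearEquiv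
  map_ID := by
    conv_rhs => rw [← X.map_ID]
    exact ideal_map_map_eq' _ _ _ _ fun x => by simp
  IP := X.IP.map (Algebra.TensorProduct.includeRight : X.OS →ₐ[A] B ⊗[A] X.OS)
  ID_le_IP := Ideal.map_mono X.ID_le_IP
  isSection := by
    let e : B ≃ₐ[B] (B ⊗[A] X.OS ⧸ X.IP.map
        (Algebra.TensorProduct.includeRight : X.OS →ₐ[A] B ⊗[A] X.OS)) :=
      (Algebra.TensorProduct.rid A B B).symm.trans
        ((Algebra.TensorProduct.congr (AlgEquiv.refl : B ≃ₐ[B] B)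
          (AlgEquiv.ofBijective (Algebra.ofId A (X.OS ⧸ X.IP)) X.isSection)).trans
            (Algebra.TensorProduct.tensorQuotientEquiv B X.OS B X.IP))
    have h : ⇑(algebraMap B (B ⊗[A] X.OS ⧸ X.IP.map
        (Algebra.TensorProduct.includeRight : X.OS →ₐ[A] B ⊗[A] X.OS))) = e := by
      ext b
      exact (e.commutes b).symm
    rw [h]
    exact e.bijective
  map_IP := by
    conv_rhs => rw [← X.map_IP]
    exact ideal_map_map_eq' _ _ _ _ fun x => by simp
  ι := Algebra.TensorProduct.map (AlgHom.id B B) X.ι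
  πC_ι s := by
    induction s with
    | zero => simp
    | add x y hx hy => rw [map_add, map_add, map_add, map_add, hx, hy]
    | tmul b x => simp [X.πC_ι]

theorem Equivalent.baseChange {X Y : LogDeformation k C D A} (h : X.Equivalent Y)
    (hA : HasResidueField k A) (hB : HasResidueField k B) :
    (X.baseChange hA hB).Equivalent (Y.baseChange hA hB) := by
  obtain ⟨α, β, h1, h2, h3, h4, h5⟩ := h
  let α' : B ⊗[A] X.OC ≃ₐ[B] B ⊗[A] Y.OC := Algebra.TensorProduct.congr AlgEquiv.refl α
  let β' : B ⊗[A] X.OS ≃ₐ[B] B ⊗[A] Y.OS := Algebra.TensorProduct.congr AlgEquiv.refl β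
  have aux : ∀ (I : Ideal X.OS) (J : Ideal Y.OS), I.map β = J →
      (I.map (Algebra.TensorProduct.includeRight : X.OS →ₐ[A] B ⊗[A] X.OS)).map β' =
      J.map (Algebra.TensorProduct.includeRight : Y.OS →ₐ[A] B ⊗[A] Y.OS) := by
    rintro I _ rfl
    exact ideal_map_map_eq _ _ _ _ _ fun x => by simp [β']
  have k1 : ∀ s : B ⊗[A] X.OS, Algebra.TensorProduct.map (AlgHom.id B B) Y.ι (β' s) =
      α' (Algebra.TensorProduct.map (AlgHom.id B B) X.ι s) := by
    intro s
    induction s with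
    | zero => simp
    | add x y hx hy => simp only [map_add, hx, hy]
    | tmul b x => simp [α', β', h1]
  have k2 : ∀ s : B ⊗[A] X.OS, Y.closedFiberS.baseChange hA hB (β' s) =
      X.closedFiberS.baseChange hA hB s := by
    intro s
    induction s with
    | zero => simp
    | add x y hx hy => simp only [map_add, hx, hy]
    | tmul b x => simp [β', h2]
  have k3 : ∀ s : B ⊗[A] X.OC, Y.closedFiberC.baseChange hA hB (α' s) =
      X.closedFiberC.baseChange hA hB s := by
    intro s
    induction s with
    | zero => simp
    | add x y hx hy => simp only [map_add, hx, hy]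
    | tmul b x => simp [α', h3]
  exact ⟨α', β', k1, k2, k3, aux _ _ h4, aux _ _ h5⟩

theorem ContainsMult.baseChange [IsArtinianRing A] {X : LogDeformation k C D A} {m : ℕ}
    (h : X.ContainsMult m) (hA : HasResidueField k A) (hB : HasResidueField k B) :
    (X.baseChange hA hB).ContainsMult m := by
  have h1 : RingHom.ker (X.baseChange hA hB).ι = (RingHom.ker X.ι).map
      (Algebra.TensorProduct.includeRight : X.OS →ₐ[A] B ⊗[A] X.OS) :=
    Algebra.TensorProduct.lTensor_ker (A := B) X.ι X.ι_surjective
  rw [ContainsMult, h1]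
  refine (Ideal.map_mono h).trans ?_
  rw [multIdeal, Ideal.map_sup, Ideal.map_pow]
  exact le_rfl

theorem baseChange_id (X : LogDeformation k C D A) (hA : HasResidueField k A) (I : Algebra A A)
    (hI : I = Algebra.id A) (h1 : @IsScalarTower k A A _ I.toSMul _)
    (h2 : IsLocalHom (@algebraMap A A _ _ I)) :
    Equivalent (@baseChange k _ O _ _ _ C D A A _ _ _ _ _ _ I h1 h2 X hA hA) X := by
  subst hI
  have aux : ∀ I : Ideal X.OS,
      (I.map (Algebra.TensorProduct.includeRight : X.OS →ₐ[A] A ⊗[A] X.OS)).map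
        (Algebra.TensorProduct.lid A X.OS) = I := by
    intro I
    exact (ideal_map_map_eq' _ _ _ (RingHom.id X.OS) fun x => by simp).trans (Ideal.map_id I)
  have k1 : ∀ s : A ⊗[A] X.OS, X.ι (Algebra.TensorProduct.lid A X.OS s) =
      Algebra.TensorProduct.lid A X.OC (Algebra.TensorProduct.map (AlgHom.id A A) X.ι s) := by
    intro s
    induction s with
    | zero => simp
    | add x y hx hy => simp only [map_add, hx, hy]
    | tmul b x => simp
  have k2 : ∀ s : A ⊗[A] X.OS, X.πS (Algebra.TensorProduct.lid A X.OS s) =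
      X.closedFiberS.baseChange hA hA s := by
    intro s
    induction s with
    | zero => simp
    | add x y hx hy => simp only [map_add, hx, hy]
    | tmul b x => simp [Algebra.smul_def, X.closedFiberS.map_algebraMap hA]
  have k3 : ∀ s : A ⊗[A] X.OC, X.πC (Algebra.TensorProduct.lid A X.OC s) =
      X.closedFiberC.baseChange hA hA s := by
    intro s
    induction s with
    | zero => simp
    | add x y hx hy => simp only [map_add, hx, hy]
    | tmul b x => simp [Algebra.smul_def, X.closedFiberC.map_algebraMap hA]
  exact ⟨Algebra.TensorProduct.lid A X.OC, Algebra.TensorProduct.lid A X.OS, k1, k2, k3,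
    aux _, aux _⟩

theorem baseChange_baseChange [Algebra B E] [IsScalarTower k B E] [IsLocalHom (algebraMap B E)]
    [Algebra A E] [IsScalarTower k A E] [IsLocalHom (algebraMap A E)] [IsScalarTower A B E]
    (X : LogDeformation k C D A) (hA : HasResidueField k A) (hB : HasResidueField k B)
    (hE : HasResidueField k E) :
    (X.baseChange hA hE).Equivalent ((X.baseChange hA hB).baseChange hB hE) := by
  refine Equivalent.symm ?_
  let α : E ⊗[B] (B ⊗[A] X.OC) ≃ₐ[E] E ⊗[A] X.OC :=
    Algebra.TensorProduct.cancelBaseChange A B E E X.OC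
  let β : E ⊗[B] (B ⊗[A] X.OS) ≃ₐ[E] E ⊗[A] X.OS :=
    Algebra.TensorProduct.cancelBaseChange A B E E X.OS
  have aux : ∀ I : Ideal X.OS,
      ((I.map (Algebra.TensorProduct.includeRight : X.OS →ₐ[A] B ⊗[A] X.OS)).map
        (Algebra.TensorProduct.includeRight : B ⊗[A] X.OS →ₐ[B] E ⊗[B] (B ⊗[A] X.OS))).map β =
      I.map (Algebra.TensorProduct.includeRight : X.OS →ₐ[A] E ⊗[A] X.OS) := by
    intro I
    rw [ideal_map_map_eq' I _ _ (((Algebra.TensorProduct.includeRight :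
      B ⊗[A] X.OS →ₐ[B] E ⊗[B] (B ⊗[A] X.OS)) : B ⊗[A] X.OS →+* E ⊗[B] (B ⊗[A] X.OS)).comp
      ((Algebra.TensorProduct.includeRight : X.OS →ₐ[A] B ⊗[A] X.OS) : X.OS →+* B ⊗[A] X.OS))
      fun x => rfl]
    exact ideal_map_map_eq' I _ _ _ fun x => by simp [β]
  have hres : ∀ b : B, hE.res (algebraMap B E b) = hB.res b := by
    intro b
    have : IsLocalHom (IsScalarTower.toAlgHom k B E) :=
      ⟨fun a ha => isUnit_of_map_unit (algebraMap B E) a ha⟩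
    exact hB.res_map hE (IsScalarTower.toAlgHom k B E) b
  have k1 : ∀ s : E ⊗[B] (B ⊗[A] X.OS), Algebra.TensorProduct.map (AlgHom.id E E) X.ι (β s) =
      α (Algebra.TensorProduct.map (AlgHom.id E E)
        (Algebra.TensorProduct.map (AlgHom.id B B) X.ι) s) := by
    intro s
    induction s with
    | zero => simp
    | add x y hx hy => simp only [map_add, hx, hy]
    | tmul e z =>
      induction z with
      | zero => simp
      | add x y hx hy => simp only [tmul_add, map_add, hx, hy]
      | tmul b x => simp [α, β]
  have k2 : ∀ s : E ⊗[B] (B ⊗[A] X.OS), X.closedFiberS.baseChange hA hE (β s) =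
      (X.closedFiberS.isClosedFiber_baseChange hA hB).baseChange hB hE s := by
    intro s
    induction s with
    | zero => simp
    | add x y hx hy => simp only [map_add, hx, hy]
    | tmul e z =>
      induction z with
      | zero => simp
      | add x y hx hy => simp only [tmul_add, map_add, hx, hy]
      | tmul b x => simp [β, Algebra.smul_def, hres]; ring
  have k3 : ∀ s : E ⊗[B] (B ⊗[A] X.OC), X.closedFiberC.baseChange hA hE (α s) =
      (X.closedFiberC.isClosedFiber_baseChange hA hB).baseChange hB hE s := by
    intro s
    induction s with
    | zero => simp
    | add x y hx hy => simp only [map_add, hx, hy]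
    | tmul e z =>
      induction z with
      | zero => simp
      | add x y hx hy => simp only [tmul_add, map_add, hx, hy]
      | tmul b x => simp [α, Algebra.smul_def, hres]; ring
  exact ⟨α, β, k1, k2, k3, aux _, aux _⟩

end LogDeformation

end deformations

section logDef

open CategoryTheory

variable {k : Type u} [Field k] {O : Type u} [CommRing O] [IsLocalRing O] [Algebra k O]

/-- The base change of a deformation along a morphism `A → B` of artinian algebras. -/
def LogDeformation.pullback {C D : Ideal O} {A B : ArtAlg k} (φ : A ⟶ B)
    (X : LogDeformation k C D A.carrier) : LogDeformation k C D B.carrier :=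
  letI : Algebra A.carrier B.carrier := φ.1.toRingHom.toAlgebra
  haveI : IsScalarTower k A.carrier B.carrier :=
    IsScalarTower.of_algebraMap_eq fun c => (φ.1.commutes c).symm
  haveI : IsLocalHom (algebraMap A.carrier B.carrier) := ⟨fun a ha => φ.2.map_nonunit a ha⟩
  X.baseChange A.hasResidueField B.hasResidueField

theorem LogDeformation.pullback_equivalent {C D : Ideal O} {A B : ArtAlg k} (φ : A ⟶ B)
    {X Y : LogDeformation k C D A.carrier} (h : X.Equivalent Y) :
    (X.pullback φ).Equivalent (Y.pullback φ) :=
  letI : Algebra A.carrier B.carrier := φ.1.toRingHom.toAlgebra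
  haveI : IsScalarTower k A.carrier B.carrier :=
    IsScalarTower.of_algebraMap_eq fun c => (φ.1.commutes c).symm
  haveI : IsLocalHom (algebraMap A.carrier B.carrier) := ⟨fun a ha => φ.2.map_nonunit a ha⟩
  h.baseChange A.hasResidueField B.hasResidueField

theorem LogDeformation.ContainsMult.pullback {C D : Ideal O} {A B : ArtAlg k} (φ : A ⟶ B)
    {X : LogDeformation k C D A.carrier} {m : ℕ} (h : X.ContainsMult m) :
    (X.pullback φ).ContainsMult m :=
  letI : Algebra A.carrier B.carrier := φ.1.toRingHom.toAlgebra
  haveI : IsScalarTower k A.carrier B.carrier :=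
    IsScalarTower.of_algebraMap_eq fun c => (φ.1.commutes c).symm
  haveI : IsLocalHom (algebraMap A.carrier B.carrier) := ⟨fun a ha => φ.2.map_nonunit a ha⟩
  h.baseChange A.hasResidueField B.hasResidueField

theorem LogDeformation.pullback_id {C D : Ideal O} {A : ArtAlg k}
    (X : LogDeformation k C D A.carrier) : (X.pullback (𝟙 A)).Equivalent X :=
  X.baseChange_id A.hasResidueField _ (Algebra.algebra_ext _ _ fun _ => rfl) _ _

theorem LogDeformation.pullback_comp {C D : Ideal O} {A B E : ArtAlg k} (φ : A ⟶ B) (ψ : B ⟶ E)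
    (X : LogDeformation k C D A.carrier) :
    (X.pullback (φ ≫ ψ)).Equivalent ((X.pullback φ).pullback ψ) :=
  letI : Algebra A.carrier B.carrier := φ.1.toRingHom.toAlgebra
  haveI : IsScalarTower k A.carrier B.carrier :=
    IsScalarTower.of_algebraMap_eq fun c => (φ.1.commutes c).symm
  haveI : IsLocalHom (algebraMap A.carrier B.carrier) := ⟨fun a ha => φ.2.map_nonunit a ha⟩
  letI : Algebra B.carrier E.carrier := ψ.1.toRingHom.toAlgebra
  haveI : IsScalarTower k B.carrier E.carrier :=
    IsScalarTower.of_algebraMap_eq fun c => (ψ.1.commutes c).symm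
  haveI : IsLocalHom (algebraMap B.carrier E.carrier) := ⟨fun a ha => ψ.2.map_nonunit a ha⟩
  letI : Algebra A.carrier E.carrier := (φ ≫ ψ).1.toRingHom.toAlgebra
  haveI : IsScalarTower k A.carrier E.carrier :=
    IsScalarTower.of_algebraMap_eq fun c => ((φ ≫ ψ).1.commutes c).symm
  haveI : IsLocalHom (algebraMap A.carrier E.carrier) :=
    ⟨fun a ha => (φ ≫ ψ).2.map_nonunit a ha⟩
  haveI : IsScalarTower A.carrier B.carrier E.carrier :=
    IsScalarTower.of_algebraMap_eq fun _ => rfl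
  X.baseChange_baseChange A.hasResidueField B.hasResidueField E.hasResidueField

/-- The functor of isomorphism classes of deformations of `C → (S ⊃ D ⊃ P)`, `S = Spec O`, which
contain a family with `𝒞|_𝒟 ⊇ m𝒫`. -/
def logDef (k : Type u) [Field k] {O : Type u} [CommRing O] [IsLocalRing O] [Algebra k O]
    (C D : Ideal O) (m : ℕ) : ArtAlg k ⥤ Type (u + 1) where
  obj A := {c : Quotient (LogDeformation.setoid (k := k) C D A.carrier) //
    ∃ X : LogDeformation k C D A.carrier, X.ContainsMult m ∧ ⟦X⟧ = c}
  map φ := TypeCat.ofHom fun c => ⟨Quotient.map (fun X => X.pullback φ)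
      (fun _ _ h => LogDeformation.pullback_equivalent φ h) c.1, by
    obtain ⟨_, X, hX, rfl⟩ := c
    exact ⟨X.pullback φ, hX.pullback φ, rfl⟩⟩
  map_id A := by
    ext c
    obtain ⟨_, X, hX, rfl⟩ := c
    exact Quotient.sound (s := LogDeformation.setoid C D A.carrier) X.pullback_id
  map_comp {_ _ E} φ ψ := by
    ext c
    obtain ⟨_, X, hX, rfl⟩ := c
    exact Quotient.sound (s := LogDeformation.setoid C D E.carrier) (X.pullback_comp φ ψ)

end logDef

section pairs

variable {k : Type u} [Field k] {O : Type u} [CommRing O] [IsLocalRing O] [Algebra k O]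

/-- `(S, D)` is a formal smooth surface pair, where `S = Spec O` and `D` is given by its ideal. -/
structure IsFormalSurfacePair (k : Type*) [Field k] {O : Type*} [CommRing O] [Algebra k O]
    (D : Ideal O) : Prop where
  surface : Nonempty (O ≃ₐ[k] MvPowerSeries (Fin 2) k)
  curve : Nonempty ((O ⧸ D) ≃ₐ[k] PowerSeries k)

theorem IsFormalSurfacePair.hasResidueField {D : Ideal O} (h : IsFormalSurfacePair k D) :
    HasResidueField k O := by
  obtain ⟨e⟩ := h.surface
  exact (CompAlg.powerSeries k 2).hasResidueField.of_surjective
    (e.symm : MvPowerSeries (Fin 2) k →ₐ[k] O) e.symm.surjective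

theorem IsFormalSurfacePair.le_maximalIdeal {D : Ideal O} (h : IsFormalSurfacePair k D) :
    D ≤ maximalIdeal O := by
  obtain ⟨e⟩ := h.curve
  have : Nontrivial (O ⧸ D) := e.toEquiv.nontrivial
  exact IsLocalRing.le_maximalIdeal (Ideal.Quotient.nontrivial_iff.mp this)

theorem IsFormalSurfacePair.mem_nonZeroDivisors {k O : Type*} [Field k] [CommRing O]
    [Algebra k O] {D : Ideal O} (h : IsFormalSurfacePair k D)
    {F : O} (hF : F ∉ D) : F ∈ nonZeroDivisors O := by
  obtain ⟨e⟩ := h.surface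
  have : IsDomain (MvPowerSeries (Fin 2) k) := NoZeroDivisors.to_isDomain _
  have : IsDomain O := e.toMulEquiv.isDomain (MvPowerSeries (Fin 2) k)
  refine mem_nonZeroDivisors_of_ne_zero ?_
  rintro rfl
  exact hF D.zero_mem

/-- The intersection multiplicity of `C` and `D`, given by their ideals in `O`. -/
def intersectionMultiplicity (k : Type*) [Field k] {O : Type*} [CommRing O] [Algebra k O]
    (C D : Ideal O) : ℕ :=
  Module.finrank k (O ⧸ (C ⊔ D))

/-- The `O`-module of derivations of `O` preserving the ideals `D` and `P`. -/
def logDerivations (k : Type*) [Field k] {O : Type*} [CommRing O] [Algebra k O] (D P : Ideal O) :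
    Submodule O (Derivation k O O) where
  carrier := {δ | (∀ g ∈ D, δ g ∈ D) ∧ ∀ g ∈ P, δ g ∈ P}
  add_mem' hδ hδ' :=
    ⟨fun g hg => D.add_mem (hδ.1 g hg) (hδ'.1 g hg), fun g hg => P.add_mem (hδ.2 g hg) (hδ'.2 g hg)⟩
  zero_mem' := ⟨fun _ _ => D.zero_mem, fun _ _ => P.zero_mem⟩
  smul_mem' c _ hδ :=
    ⟨fun g hg => D.mul_mem_left c (hδ.1 g hg), fun g hg => P.mul_mem_left c (hδ.2 g hg)⟩

/-- The ideal `I^ea_{rel, D, P}(F) = {δ F | δ a derivation preserving D and P} + ⟨F⟩`, with `P` the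
closed point. -/
def relEquianalyticIdeal (k : Type*) [Field k] {O : Type*} [CommRing O] [IsLocalRing O]
    [Algebra k O] (D : Ideal O) (F : O) : Ideal O :=
  (logDerivations k D (maximalIdeal O)).map
    ({ toFun := fun δ => δ F, map_add' := fun _ _ => rfl, map_smul' := fun _ _ => rfl } :
      Derivation k O O →ₗ[O] O) ⊔
      Ideal.span {F}

/-- The quotient `I_{mP} / (I_{mP} ∩ I^ea_{rel, D, P}(F))`. -/
abbrev LogTangent (k : Type*) [Field k] {O : Type*} [CommRing O] [IsLocalRing O]
    [Algebra k O] (D : Ideal O) (F : O) (m : ℕ) : Type _ :=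
  multIdeal D (maximalIdeal O) m ⧸
    (relEquianalyticIdeal k D F).submoduleOf (multIdeal D (maximalIdeal O) m)

/-- The residue class of an element of `I_{mP}`. -/
def LogTangent.mk {D : Ideal O} {F : O} {m : ℕ} (g : multIdeal D (maximalIdeal O) m) :
    LogTangent k D F m :=
  Submodule.Quotient.mk g

theorem isClosedFiber_id {k O : Type*} [Field k] [CommRing O] [Algebra k O] :
    IsClosedFiber k k (RingHom.id O : O →+* O) where
  surjective := Function.surjective_id
  ker_eq := by
    rw [maximalIdeal_eq_bot, Ideal.map_bot]
    exact RingHom.ker_eq_bot_iff_eq_zero _ |>.mpr fun _ h => h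
  map_const _ := rfl

/-- The reduction map `A ⊗ O → O` of the trivial deformation of `S = Spec O` over `A`. -/
def reduction (O : Type u) [CommRing O] [Algebra k O] (A : ArtAlg k) : A.carrier ⊗[k] O →+* O :=
  haveI : IsLocalHom (algebraMap k A.carrier) := inferInstance
  IsClosedFiber.baseChange isClosedFiber_id (hasResidueField_self k) A.hasResidueField

theorem isClosedFiber_reduction (O : Type u) [CommRing O] [Algebra k O] (A : ArtAlg k) :
    IsClosedFiber k A.carrier (reduction O A) :=
  IsClosedFiber.isClosedFiber_baseChange _ _ _

theorem reduction_tmul {O : Type u} [CommRing O] [Algebra k O] (A : ArtAlg k) (a : A.carrier) (g : O) :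
    reduction O A (a ⊗ₜ g) = algebraMap k O (A.hasResidueField.res a) * g :=
  rfl

theorem reduction_one_tmul {O : Type u} [CommRing O] [Algebra k O] (A : ArtAlg k) (g : O) : reduction O A (1 ⊗ₜ g) = g := by
  rw [reduction_tmul, map_one, map_one, one_mul]

theorem isNilpotent_sub {O : Type u} [CommRing O] [Algebra k O] (A : ArtAlg k) {F : O} (G : A.carrier ⊗[k] O)
    (hG : reduction O A G = F) : IsNilpotent (G - 1 ⊗ₜ F) := by
  obtain ⟨n, hn⟩ := A.exists_pow_succ_eq_bot
  have h1 : G - 1 ⊗ₜ F ∈ RingHom.ker (reduction O A) := by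
    rw [RingHom.mem_ker, map_sub, hG, reduction_one_tmul, sub_self]
  rw [(isClosedFiber_reduction O A).ker_eq] at h1
  have h2 := Ideal.pow_mem_pow h1 (n + 1)
  rw [← Ideal.map_pow, hn, Ideal.map_bot, Ideal.mem_bot] at h2
  exact ⟨n + 1, h2⟩

/-- The deformation `V(G) ⊆ S_A` of `C = V(F)` in `S_A`, with the trivial deformations `D_A` and
`P_A` of `D` and `P`, where `S_A` is the spectrum of `A ⊗ O` (which is isomorphic to `A[[x, y]]`)
and `G` is an element of `A ⊗ O` reducing to `F` on the closed fibre. -/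
def embeddedDeformation {D : Ideal O} (hSD : IsFormalSurfacePair k D) {F : O} (hF : F ∉ D)
    (A : ArtAlg k) (G : A.carrier ⊗[k] O) (hG : reduction O A G = F) :
    LogDeformation k (Ideal.span {F}) D A.carrier where
  OS := A.carrier ⊗[k] O
  OC := (A.carrier ⊗[k] O) ⧸ Ideal.span {G}
  flatOS := inferInstance
  flatOC := flat_quotient_span_singleton G
    (mem_map_of_mul_mem (hSD.mem_nonZeroDivisors hF) G (isNilpotent_sub A G hG))
  πS := reduction O A
  πC := Ideal.quotientMap (Ideal.span {F}) (reduction O A) (by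
    rw [Ideal.span_singleton_le_iff_mem, Ideal.mem_comap, hG]
    exact Ideal.mem_span_singleton_self F)
  closedFiberS := isClosedFiber_reduction O A
  closedFiberC :=
    { surjective := Ideal.quotientMap_surjective (isClosedFiber_reduction O A).surjective
      map_const := fun c => by
        change Ideal.quotientMap _ _ _ (Ideal.Quotient.mk _ _) = _
        rw [Ideal.quotientMap_mk, (isClosedFiber_reduction O A).map_const]
        rfl
      ker_eq := by
        apply le_antisymm
        · intro z hz
          obtain ⟨x, rfl⟩ := Ideal.Quotient.mk_surjective z
          rw [RingHom.mem_ker, Ideal.quotientMap_mk, Ideal.Quotient.eq_zero_iff_mem,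
            Ideal.mem_span_singleton'] at hz
          obtain ⟨o, ho⟩ := hz
          obtain ⟨y, rfl⟩ := (isClosedFiber_reduction O A).surjective o
          have h1 : x - y * G ∈ RingHom.ker (reduction O A) := by
            rw [RingHom.mem_ker, map_sub, map_mul, hG, ho, sub_self]
          rw [(isClosedFiber_reduction O A).ker_eq] at h1
          have h2 := Ideal.mem_map_of_mem (Ideal.Quotient.mk (Ideal.span {G})) h1
          rw [Ideal.map_map] at h2
          have h3 : Ideal.Quotient.mk (Ideal.span {G}) (x - y * G) = Ideal.Quotient.mk _ x := by
            rw [Ideal.Quotient.mk_eq_mk_iff_sub_mem, sub_sub_cancel_left]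
            exact neg_mem (Ideal.mul_mem_left _ _ (Ideal.mem_span_singleton_self G))
          rw [h3] at h2
          exact h2
        · rw [Ideal.map_le_iff_le_comap]
          intro a ha
          have h1 : algebraMap A.carrier (A.carrier ⊗[k] O) a ∈ RingHom.ker (reduction O A) := by
            rw [(isClosedFiber_reduction O A).ker_eq]
            exact Ideal.mem_map_of_mem _ ha
          change Ideal.quotientMap _ _ _ (Ideal.Quotient.mk _ _) = _
          rw [Ideal.quotientMap_mk, h1, map_zero] }
  ID := D.map (Algebra.TensorProduct.includeRight : O →ₐ[k] A.carrier ⊗[k] O)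
  flatD := Module.Flat.of_linearEquiv
    (Algebra.TensorProduct.tensorQuotientEquiv (R := k) A.carrier O A.carrier D).symm.toLinearEquiv
  map_ID := (ideal_map_map_eq' _ _ _ (RingHom.id O) (reduction_one_tmul A)).trans (Ideal.map_id D)
  IP := (maximalIdeal O).map (Algebra.TensorProduct.includeRight : O →ₐ[k] A.carrier ⊗[k] O)
  ID_le_IP := Ideal.map_mono hSD.le_maximalIdeal
  isSection := by
    have hb : Function.Bijective (Algebra.ofId k (O ⧸ maximalIdeal O)) := hSD.hasResidueField
    let e : A.carrier ≃ₐ[A.carrier] (A.carrier ⊗[k] O ⧸ (maximalIdeal O).map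
        (Algebra.TensorProduct.includeRight : O →ₐ[k] A.carrier ⊗[k] O)) :=
      (Algebra.TensorProduct.rid k A.carrier A.carrier).symm.trans
        ((Algebra.TensorProduct.congr (AlgEquiv.refl : A.carrier ≃ₐ[A.carrier] A.carrier)
          (AlgEquiv.ofBijective (Algebra.ofId k (O ⧸ maximalIdeal O)) hb)).trans
            (Algebra.TensorProduct.tensorQuotientEquiv A.carrier O A.carrier (maximalIdeal O)))
    have h : ⇑(algebraMap A.carrier (A.carrier ⊗[k] O ⧸ (maximalIdeal O).map
        (Algebra.TensorProduct.includeRight : O →ₐ[k] A.carrier ⊗[k] O))) = e := by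
      ext b
      exact (e.commutes b).symm
    rw [h]
    exact e.bijective
  map_IP := (ideal_map_map_eq' _ _ _ (RingHom.id O) (reduction_one_tmul A)).trans
    (Ideal.map_id _)
  ι := Ideal.Quotient.mkₐ A.carrier (Ideal.span {G})
  πC_ι s := Ideal.quotientMap_mk

theorem reduction_add_sum {O : Type u} [CommRing O] [Algebra k O] {r : ℕ} (A : ArtAlg k) (F : O) (f : Fin r → O) (a : Fin r → A.carrier)
    (ha : ∀ i, a i ∈ maximalIdeal A.carrier) :
    reduction O A (1 ⊗ₜ F + ∑ i, a i ⊗ₜ f i) = F := by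
  rw [map_add, reduction_one_tmul, map_sum]
  refine add_eq_left.mpr (Finset.sum_eq_zero fun i _ => ?_)
  have h := ha i
  rw [← A.hasResidueField.ker_res, RingHom.mem_ker] at h
  rw [reduction_tmul, h, map_zero, zero_mul]

/-- The family `F + ∑ᵢ aᵢ fᵢ` over `A`, where `aᵢ ∈ 𝔪_A`. -/
def family {D : Ideal O} (hSD : IsFormalSurfacePair k D) {F : O} (hF : F ∉ D) {r : ℕ}
    (f : Fin r → O) (A : ArtAlg k) (a : Fin r → A.carrier)
    (ha : ∀ i, a i ∈ maximalIdeal A.carrier) :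
    LogDeformation k (Ideal.span {F}) D A.carrier :=
  embeddedDeformation hSD hF A (1 ⊗ₜ F + ∑ i, a i ⊗ₜ f i) (reduction_add_sum A F f a ha)

/-- The residue class of `tᵢ` in `k[[t₁, …, tᵣ]] / 𝔪ⁿ⁺¹`. -/
def truncX (k : Type u) [Field k] {r : ℕ} (n : ℕ) (i : Fin r) :
    ((CompAlg.powerSeries k r).trunc n).carrier :=
  Ideal.Quotient.mk (maximalIdeal (MvPowerSeries (Fin r) k) ^ (n + 1)) (MvPowerSeries.X i)

theorem truncX_mem {r : ℕ} (n : ℕ) (i : Fin r) :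
    truncX k n i ∈ maximalIdeal ((CompAlg.powerSeries k r).trunc n).carrier := by
  have h : MvPowerSeries.X i ∈ maximalIdeal (MvPowerSeries (Fin r) k) := by
    rw [maximalIdeal_mvPowerSeries]
    exact Ideal.subset_span ⟨i, rfl⟩
  have h0 : (Ideal.Quotient.mk (maximalIdeal (MvPowerSeries (Fin r) k) ^ (n + 1))
      (MvPowerSeries.X i)) ^ (n + 1) = 0 := by
    rw [← map_pow, Ideal.Quotient.eq_zero_iff_mem]
    exact Ideal.pow_mem_pow h _
  have h1 : truncX k n i ^ (n + 1) = 0 := h0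
  intro hu
  exact not_isUnit_zero (h1 ▸ hu.pow (n + 1))

/-- The element `ε` of `k[ε]`. -/
def dualEps (k : Type u) [Field k] : (ArtAlg.dual k).carrier :=
  (TrivSqZeroExt.inr 1 : TrivSqZeroExt k k)

theorem dualEps_mem : dualEps k ∈ maximalIdeal (ArtAlg.dual k).carrier := by
  intro hu
  exact not_isUnit_zero (TrivSqZeroExt.isUnit_iff_isUnit_fst.mp hu)

/-- The first order deformation `F + ε g` over `k[ε]`. -/
def firstOrderFamily {D : Ideal O} (hSD : IsFormalSurfacePair k D) {F : O} (hF : F ∉ D) (g : O) :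
    LogDeformation k (Ideal.span {F}) D (ArtAlg.dual k).carrier :=
  family hSD hF (fun _ : Fin 1 => g) (ArtAlg.dual k) (fun _ => dualEps k) fun _ => dualEps_mem

/-- The restriction to `k[[t₁, …, tᵣ]] / 𝔪ⁿ⁺¹` of the family `F + ∑ᵢ tᵢ fᵢ` over
`k[[t₁, …, tᵣ]]`. -/
def truncatedFamily {D : Ideal O} (hSD : IsFormalSurfacePair k D) {F : O} (hF : F ∉ D) {r : ℕ}
    (f : Fin r → O) (n : ℕ) :
    LogDeformation k (Ideal.span {F}) D ((CompAlg.powerSeries k r).trunc n).carrier :=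
  family hSD hF f ((CompAlg.powerSeries k r).trunc n) (truncX k n) (truncX_mem n)

end pairs

end

/-!
Let `S_A` denote the trivial deformation `Spec (A ⊗ O)` of `S`, and `I^ea` the ideal
`I^ea_{rel, D, P}(C)`. Deformations are given by equations, the equations up to isomorphism are
controlled to first order by `I^ea`, and the first order statement is lifted along powers of the
maximal ideal.

**Equations.** On a formal smooth surface pair there are coordinates `x, y` with `D = V(y)`
(`IsFormalSurfacePair.exists_coordinates`). Lifting `y` into the ideal of `𝒟` and `x` into that of
`𝒫` trivializes `(𝒮, 𝒟, 𝒫)` over an artinian base (`LogDeformation.exists_trivialization`), and by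
flatness the ideal of the curve is generated by a single lift `G ∈ A ⊗ O` of `F`
(`LogDeformation.exists_equivalent_embeddedDeformation`). The condition `𝒞|_𝒟 ⊇ m𝒫` becomes
`G ∈ A ⊗ I_{mP}`, and `V(G) ≅ V(G')` if and only if `β G = u G'` for a unit `u` and an automorphism
`β` of `S_A` preserving the trivial deformations of `D` and `P`, both trivial on the closed fibre
(`embeddedDeformation_equivalent_iff`).

**First order.** Let `J ⊆ 𝔪_A` be an ideal. In characteristic zero a vector field on `S_A` with
coefficients in `J` that preserves `D` and `P` can be exponentiated to such an automorphism
(`IsLogVector.exists_isLogAut`); conversely every automorphism which is trivial modulo `J` agrees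
with a vector field up to `𝔪_A J` (`IsLogAut.exists_isLogVector`). Hence automorphisms lift along
surjections `B → A` (`IsLogAut.exists_lift`), and a change of the equation by `δF + hF` with
coefficients in `J` can be undone by an isomorphism, up to `𝔪_A J`
(`IsLogVector.exists_isLogAut_sub_mem`). If `f₁, …, fᵣ` span `I_{mP}` modulo `I^ea`, any change of
the equation with coefficients in `J` is therefore, up to isomorphism and up to `𝔪_A J`, a change
of the parameters of the family `F + ∑ᵢ tᵢ fᵢ` (`exists_embeddedClass_eq_of_sub_mem`). If `𝔪_A² = 0`
these statements are exact, which identifies the tangent space with `I_{mP} / I^ea`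
(`contract_sub_mem_of_embeddedClass_eq`, `isTangentSpace_tangentClass`).

**Versality.** Given a surjection `p : B → A`, a member of the family over `A` and a lift of it
over `B`, the isomorphism over `A` lifts to `B`, so that the equation of the lift may be assumed to
differ from a member of the family by coefficients in `ker p`. The preceding step, applied to
`J = 𝔪_B^j ker p` for `j = 0, 1, …`, moves the difference into the parameters without changing their
images in `A`, and stops because `𝔪_B` is nilpotent (`exists_familyClass_eq_of_map_eq`). With the
computation of the tangent space this makes the family semiuniversal
(`isSemiuniversal_formalFamily`).

**Finiteness and coordinates.** A derivation of `k[[x, y]]` is determined by its values on `x` and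
`y` (`derivation_mvPowerSeries_two_apply`), which gives the generators of `I^ea`
(`relEquianalyticIdeal_span_X_one`). A non-maximal prime containing them does not contain `y`, as
`F` does not vanish on `D`; so it contains `F, ∂ₓF, ∂_yF`. Such a prime is a component of the
reduced curve `C` stable under `∂ₓ` and `∂_y`, and in characteristic zero `0` is the only such ideal
(`eq_maximalIdeal_of_pderiv_mem`). Thus `I^ea` contains a power of the maximal ideal
(`exists_pow_le_relEquianalyticIdeal`). Finally `m ≤ C.D` is what puts `F` into `I_{mP}`
(`mem_multIdeal_of_le_intersectionMultiplicity`).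
-/

noncomputable section

/-! ### Formal power series and their homomorphisms -/

section powerSeries

variable {k : Type u} [Field k]

theorem exists_eq_C_add_sum_X_mul {r : ℕ} (f : MvPowerSeries (Fin r) k) :
    ∃ g : Fin r → MvPowerSeries (Fin r) k,
      f = MvPowerSeries.C (MvPowerSeries.constantCoeff f) + ∑ i, g i * MvPowerSeries.X i := by
  have h : f - MvPowerSeries.C (MvPowerSeries.constantCoeff f) ∈
      maximalIdeal (MvPowerSeries (Fin r) k) := by
    rw [mem_maximalIdeal, mem_nonunits_iff, MvPowerSeries.isUnit_iff_constantCoeff]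
    simp
  rw [maximalIdeal_mvPowerSeries, Ideal.mem_span_range_iff_exists_fun] at h
  obtain ⟨g, hg⟩ := h
  exact ⟨g, by rw [hg]; ring⟩

theorem exists_mvPolynomial_sub_mem {r : ℕ} (n : ℕ) (f : MvPowerSeries (Fin r) k) :
    ∃ p : MvPolynomial (Fin r) k,
      f - (p : MvPowerSeries (Fin r) k) ∈ maximalIdeal (MvPowerSeries (Fin r) k) ^ n := by
  induction n generalizing f with
  | zero => exact ⟨0, by simp⟩
  | succ n ih =>
    obtain ⟨g, hg⟩ := exists_eq_C_add_sum_X_mul f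
    choose p hp using fun i => ih (g i)
    refine ⟨MvPolynomial.C (MvPowerSeries.constantCoeff f) + ∑ i, p i * MvPolynomial.X i, ?_⟩
    have h1 : f - ((MvPolynomial.C (MvPowerSeries.constantCoeff f) +
        ∑ i, p i * MvPolynomial.X i : MvPolynomial (Fin r) k) : MvPowerSeries (Fin r) k) =
        ∑ i, (g i - (p i : MvPowerSeries (Fin r) k)) * MvPowerSeries.X i := by
      conv_lhs => rw [hg]
      rw [← MvPolynomial.coeToMvPowerSeries.ringHom_apply, map_add, map_sum]
      simp [Finset.sum_sub_distrib, sub_mul]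
    rw [h1, pow_succ]
    refine sum_mem fun i _ => Ideal.mul_mem_mul (hp i) ?_
    rw [maximalIdeal_mvPowerSeries]
    exact Ideal.subset_span ⟨i, rfl⟩

theorem map_maximalIdeal_mvPowerSeries_le {T : Type*} [CommRing T] [Algebra k T] (I : Ideal T)
    {r : ℕ} (φ : MvPowerSeries (Fin r) k →ₐ[k] T) (hφ : ∀ i, φ (MvPowerSeries.X i) ∈ I) :
    (maximalIdeal (MvPowerSeries (Fin r) k)).map φ ≤ I := by
  rw [maximalIdeal_mvPowerSeries, Ideal.map_span, Ideal.span_le]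
  rintro _ ⟨_, ⟨i, rfl⟩, rfl⟩
  exact hφ i

/-- A homomorphism out of `k[[t₁, …, tᵣ]]` is automatically continuous, hence determined by the
images of the `tᵢ`. -/
theorem mvPowerSeries_algHom_ext {T : Type*} [CommRing T] [Algebra k T] (I : Ideal T)
    [IsHausdorff I T] {r : ℕ} {φ ψ : MvPowerSeries (Fin r) k →ₐ[k] T}
    (hφ : ∀ i, φ (MvPowerSeries.X i) ∈ I)
    (h : ∀ i, φ (MvPowerSeries.X i) = ψ (MvPowerSeries.X i)) : φ = ψ := by
  have hpow : ∀ (χ : MvPowerSeries (Fin r) k →ₐ[k] T), (∀ i, χ (MvPowerSeries.X i) ∈ I) →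
      ∀ n, ∀ f ∈ maximalIdeal (MvPowerSeries (Fin r) k) ^ n, χ f ∈ I ^ n := fun χ hχ n f hf =>
    Ideal.pow_right_mono (map_maximalIdeal_mvPowerSeries_le I χ hχ) n
      (Ideal.map_pow χ _ _ ▸ Ideal.mem_map_of_mem χ hf)
  have hpoly : φ.comp (MvPolynomial.coeToMvPowerSeries.algHom k) =
      ψ.comp (MvPolynomial.coeToMvPowerSeries.algHom k) := by
    ext i
    simpa [MvPolynomial.coeToMvPowerSeries.algHom_apply] using h i
  ext f
  rw [IsHausdorff.eq_iff_smodEq (I := I)]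
  intro n
  rw [SModEq.sub_mem, smul_eq_mul, Ideal.mul_top]
  obtain ⟨p, hp⟩ := exists_mvPolynomial_sub_mem n f
  have h1 := hpow φ hφ n _ hp
  have h2 := hpow ψ (fun i => h i ▸ hφ i) n _ hp
  have h3 : φ (p : MvPowerSeries (Fin r) k) = ψ p := by
    simpa [MvPolynomial.coeToMvPowerSeries.algHom_apply] using DFunLike.congr_fun hpoly p
  have := sub_mem h1 h2
  rw [map_sub, map_sub, h3] at this
  simpa using this

theorem isHausdorff_of_pow_eq_bot {T : Type*} [CommRing T] {I : Ideal T} {n : ℕ}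
    (h : I ^ n = ⊥) : IsHausdorff I T := by
  refine ⟨fun x hx => ?_⟩
  have := hx n
  rw [h, Submodule.bot_smul, SModEq.zero, Submodule.mem_bot] at this
  exact this

theorem exists_mvPowerSeries_algHom_of_isNilpotent {T : Type*} [CommRing T] [Algebra k T] {r : ℕ}
    (b : Fin r → T) (hb : ∀ i, IsNilpotent (b i)) :
    ∃ φ : MvPowerSeries (Fin r) k →ₐ[k] T, ∀ i, φ (MvPowerSeries.X i) = b i := by
  -- `T` is viewed as a power series ring in no variables, where nilpotents can be substituted
  have ha : MvPowerSeries.HasSubst (fun i => (MvPowerSeries.C (b i) : MvPowerSeries Empty T)) :=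
    MvPowerSeries.hasSubst_of_constantCoeff_nilpotent fun i => by simpa using hb i
  refine ⟨((MvPowerSeries.isEmptyEquiv T (σ := Empty) :
    MvPowerSeries Empty T →ₐ[T] T).restrictScalars k).comp (MvPowerSeries.substAlgHom ha),
    fun i => ?_⟩
  rw [AlgHom.comp_apply, MvPowerSeries.substAlgHom_X]
  simp

theorem isNilpotent_mk_pow {T : Type*} [CommRing T] {I : Ideal T} {b : T} (hb : b ∈ I) (n : ℕ) :
    IsNilpotent (Ideal.Quotient.mk (I ^ n) b) :=
  ⟨n, by rw [← map_pow, Ideal.Quotient.eq_zero_iff_mem]; exact Ideal.pow_mem_pow hb n⟩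

/-- Power series can be evaluated at elements of an ideal `I` for which the target is complete. -/
theorem exists_mvPowerSeries_algHom {T : Type*} [CommRing T] [Algebra k T] (I : Ideal T)
    [IsAdicComplete I T] {r : ℕ} (b : Fin r → T) (hb : ∀ i, b i ∈ I) :
    ∃ φ : MvPowerSeries (Fin r) k →ₐ[k] T, ∀ i, φ (MvPowerSeries.X i) = b i := by
  choose f hf using fun n => exists_mvPowerSeries_algHom_of_isNilpotent (k := k)
    (fun i => Ideal.Quotient.mk (I ^ n) (b i)) fun i => isNilpotent_mk_pow (hb i) n
  have hcomp : ∀ {m n : ℕ} (hle : m ≤ n),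
      (Ideal.Quotient.factorₐ k (Ideal.pow_le_pow_right hle)).comp (f n) = f m := by
    intro m n hle
    have hbot : (I.map (Ideal.Quotient.mk (I ^ m))) ^ m = ⊥ := by
      rw [← Ideal.map_pow, Ideal.map_quotient_self]
    have := isHausdorff_of_pow_eq_bot hbot
    apply mvPowerSeries_algHom_ext (I.map (Ideal.Quotient.mk (I ^ m)))
    · intro i
      simp only [AlgHom.comp_apply, hf, Ideal.Quotient.factorₐ_apply_mk]
      exact Ideal.mem_map_of_mem _ (hb i)
    · intro i
      simp only [AlgHom.comp_apply, hf, Ideal.Quotient.factorₐ_apply_mk]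
  refine ⟨IsAdicComplete.liftAlgHom I f hcomp, fun i => ?_⟩
  rw [IsHausdorff.eq_iff_smodEq (I := I)]
  intro n
  rw [SModEq.sub_mem, smul_eq_mul, Ideal.mul_top, ← Ideal.Quotient.eq_zero_iff_mem, map_sub,
    IsAdicComplete.mk_liftAlgHom, hf, sub_self]

end powerSeries

/-! ### Completeness of nilpotent thickenings -/

section complete

theorem IsPrecomplete.of_surjective {R : Type*} [CommRing R] (I : Ideal R) {M N : Type*}
    [AddCommGroup M] [Module R M] [AddCommGroup N] [Module R N] (f : M →ₗ[R] N)
    (hf : Function.Surjective f) [IsPrecomplete I M] : IsPrecomplete I N := by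
  rw [← AdicCompletion.of_surjective_iff]
  intro y
  obtain ⟨x, rfl⟩ := AdicCompletion.map_surjective I hf y
  obtain ⟨m, rfl⟩ := AdicCompletion.of_surjective I M x
  exact ⟨f m, (AdicCompletion.map_of I f m).symm⟩

theorem IsPrecomplete.of_exact {R : Type u} [CommRing R] [IsNoetherianRing R] (I : Ideal R)
    {M N P : Type u} [AddCommGroup M] [Module R M] [AddCommGroup N] [Module R N] [AddCommGroup P]
    [Module R P] [Module.Finite R N] (f : M →ₗ[R] N) (g : N →ₗ[R] P) (hf : Function.Injective f)
    (hg : Function.Surjective g) (hfg : Function.Exact f g) [IsPrecomplete I M]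
    [IsPrecomplete I P] : IsPrecomplete I N := by
  rw [← AdicCompletion.of_surjective_iff]
  intro y
  obtain ⟨p, hp⟩ := AdicCompletion.of_surjective I P (AdicCompletion.map I g y)
  obtain ⟨n, rfl⟩ := hg p
  have h1 : AdicCompletion.map I g (y - AdicCompletion.of I N n) = 0 := by
    rw [map_sub, AdicCompletion.map_of, hp, sub_self]
  obtain ⟨x, hx⟩ := (AdicCompletion.map_exact hf hfg hg _).mp h1
  obtain ⟨m, rfl⟩ := AdicCompletion.of_surjective I M x
  refine ⟨n + f m, ?_⟩
  rw [map_add, ← AdicCompletion.map_of, hx]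
  abel

/-- A noetherian ring is complete as soon as its quotient by a nilpotent ideal is: the class of
precomplete finite modules is stable under extensions, and every quotient by a prime ideal is a
quotient of the given one. -/
theorem isPrecomplete_of_surjective_of_isNilpotent {S T : Type u} [CommRing S] [IsNoetherianRing S]
    [CommRing T] (π : S →+* T) (hπ : Function.Surjective π)
    (hn : IsNilpotent (RingHom.ker π)) (I : Ideal S) [IsPrecomplete (I.map π) T] :
    IsPrecomplete I S := by
  let _ : Algebra S T := π.toAlgebra
  have hT : IsPrecomplete I T := by
    rw [← IsPrecomplete.map_algebraMap_iff (S := T)]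
    assumption
  refine IsNoetherianRing.induction_on_isQuotientEquivQuotientPrime S (M := S) inferInstance
    (motive := fun N _ _ _ => IsPrecomplete I N) ?_ ?_ ?_
  · intro N _ _ _ _
    infer_instance
  · intro N _ _ _ p a
    have hle : RingHom.ker π ≤ p.asIdeal := by
      obtain ⟨n, hn⟩ := hn
      exact p.isPrime.le_of_pow_le (n := n) (hn.trans_le bot_le)
    obtain ⟨q, hq⟩ : ∃ q : T →+* S ⧸ p.asIdeal, ∀ s, q (π s) = Ideal.Quotient.mk p.asIdeal s :=
      ⟨RingHom.liftOfSurjective π hπ ⟨Ideal.Quotient.mk p.asIdeal, by simpa using hle⟩,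
        fun s => RingHom.liftOfRightInverse_comp_apply _ _ _
          ⟨Ideal.Quotient.mk p.asIdeal, by simpa using hle⟩ s⟩
    let e : T →ₗ[S] S ⧸ p.asIdeal :=
      { toFun := q
        map_add' := map_add q
        map_smul' := fun s t => by
          rw [Algebra.smul_def, map_mul]
          change q (π s) * _ = _
          rw [hq, RingHom.id_apply, Algebra.smul_def]
          rfl }
    have he : Function.Surjective e := by
      intro y
      obtain ⟨s, rfl⟩ := Ideal.Quotient.mk_surjective y
      exact ⟨π s, hq s⟩
    exact IsPrecomplete.of_surjective I (a.symm.toLinearMap ∘ₗ e) (a.symm.surjective.comp he)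
  · intro N₁ _ _ _ N₂ _ _ _ N₃ _ _ _ f g hf hg hfg h1 h3
    exact IsPrecomplete.of_exact I f g hf hg hfg

theorem isNoetherianRing_of_surjective_of_isNilpotent {S T : Type*} [CommRing S] [CommRing T]
    [IsNoetherianRing T] (π : S →+* T) (hπ : Function.Surjective π) (hfg : (RingHom.ker π).FG)
    (hn : IsNilpotent (RingHom.ker π)) : IsNoetherianRing S := by
  refine IsNoetherianRing.of_prime fun p hp => ?_
  have hle : RingHom.ker π ≤ p := by
    obtain ⟨n, hn⟩ := hn
    exact hp.le_of_pow_le (n := n) (hn.trans_le bot_le)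
  let _ : Algebra S T := π.toAlgebra
  have h1 : (p.map π).FG := IsNoetherian.noetherian _
  obtain ⟨s, hs, hs'⟩ := (Submodule.fg_def).mp h1
  choose l hl using hπ
  have h2 : p = Ideal.span (l '' s) ⊔ RingHom.ker π := by
    have h3 : (Ideal.span (l '' s)).map π = p.map π := by
      rw [Ideal.map_span, ← Set.image_comp, ← hs']
      have h5 : (π ∘ l : T → T) = id := funext hl
      rw [h5, Set.image_id]
    have h4 := congrArg (Ideal.comap π) h3
    rwa [Ideal.comap_map_of_surjective' π (fun y => ⟨l y, hl y⟩),
      Ideal.comap_map_of_surjective' π (fun y => ⟨l y, hl y⟩), sup_eq_left.mpr hle, eq_comm] at h4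
  rw [h2]
  exact Submodule.FG.sup (Submodule.fg_span (hs.image _)) hfg

end complete

/-! ### Flatness over an artinian base -/

section flat

/-- If `N` is flat, then `Tor₁(A / 𝔞, N) = 0`, that is, `K ∩ 𝔞 M = 𝔞 K` for the kernel `K` of any
surjection `M → N`. -/
theorem ker_inf_smul_top_le {A M N : Type*} [CommRing A] [AddCommGroup M] [Module A M]
    [AddCommGroup N] [Module A N] [Module.Flat A N] (f : M →ₗ[A] N) (hf : Function.Surjective f)
    (𝔞 : Ideal A) : LinearMap.ker f ⊓ 𝔞 • ⊤ ≤ 𝔞 • LinearMap.ker f := by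
  rintro x ⟨hx, hx'⟩
  let μ : 𝔞 ⊗[A] M →ₗ[A] M := (TensorProduct.lid A M).toLinearMap ∘ₗ 𝔞.subtype.rTensor M
  let ν : 𝔞 ⊗[A] N →ₗ[A] N := (TensorProduct.lid A N).toLinearMap ∘ₗ 𝔞.subtype.rTensor N
  obtain ⟨t, rfl⟩ : ∃ t, μ t = x := by
    refine Submodule.smul_induction_on hx' (fun a ha m _ => ⟨⟨a, ha⟩ ⊗ₜ m, by simp [μ]⟩) ?_
    rintro _ _ ⟨s, rfl⟩ ⟨t, rfl⟩
    exact ⟨s + t, map_add _ _ _⟩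
  have h1 : ν (f.lTensor 𝔞 t) = f (μ t) := by
    clear hx hx'
    induction t with
    | zero => simp
    | add s t hs ht => rw [map_add, map_add, hs, ht, map_add, map_add]
    | tmul a m => simp [μ, ν]
  have h2 : f.lTensor 𝔞 t = 0 := by
    apply ((TensorProduct.lid A N).injective.comp
      (Module.Flat.rTensor_preserves_injective_linearMap (M := N) 𝔞.subtype 𝔞.subtype_injective))
    refine (h1.trans hx).trans ?_
    simp
  have h3 := (lTensor_exact 𝔞 (LinearMap.exact_subtype_ker_map f) hf t).mp h2
  obtain ⟨s, rfl⟩ := h3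
  clear h1 h2 hx hx'
  induction s with
  | zero => simp
  | add s t hs ht =>
    rw [map_add, map_add]
    exact add_mem hs ht
  | tmul a m => simpa [μ] using Submodule.smul_mem_smul a.2 m.2

/-- Nakayama's lemma for kernels: over an artinian local base the kernel of a surjection onto a flat
module is determined by its image in the closed fibre. -/
theorem ker_le_of_le_sup_smul {A M N : Type*} [CommRing A] [IsLocalRing A] [IsArtinianRing A]
    [AddCommGroup M] [Module A M] [AddCommGroup N] [Module A N] [Module.Flat A N] (f : M →ₗ[A] N)
    (hf : Function.Surjective f) (K : Submodule A M) (hK : K ≤ LinearMap.ker f)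
    (h : LinearMap.ker f ≤ K ⊔ (maximalIdeal A) • ⊤) : LinearMap.ker f ≤ K := by
  obtain ⟨n, hn⟩ := exists_pow_maximalIdeal_eq_bot A
  have h0 : LinearMap.ker f ≤ K ⊔ (maximalIdeal A) • LinearMap.ker f := by
    intro x hx
    obtain ⟨y, hy, z, hz, rfl⟩ := Submodule.mem_sup.mp (h hx)
    have h1 : z ∈ LinearMap.ker f := by
      have := sub_mem hx (hK hy)
      rwa [add_sub_cancel_left] at this
    exact Submodule.add_mem_sup hy (ker_inf_smul_top_le f hf _ ⟨h1, hz⟩)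
  have h1 : ∀ j : ℕ, LinearMap.ker f ≤ K ⊔ (maximalIdeal A ^ j) • LinearMap.ker f := by
    intro j
    induction j with
    | zero => rw [pow_zero, Ideal.one_eq_top, Submodule.top_smul]; exact le_sup_right
    | succ j ih =>
      refine ih.trans (sup_le le_sup_left ?_)
      calc (maximalIdeal A ^ j) • LinearMap.ker f
          ≤ (maximalIdeal A ^ j) • (K ⊔ (maximalIdeal A) • LinearMap.ker f) :=
            Submodule.smul_mono le_rfl h0
        _ ≤ _ := by
            rw [Submodule.smul_sup, ← Submodule.mul_smul, ← pow_succ]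
            exact sup_le_sup_right Submodule.smul_le_right _
  have h2 := h1 n
  rwa [hn, Submodule.bot_smul, sup_bot_eq] at h2

/-- An ideal with flat quotient is generated by any elements of it that generate it on the closed
fibre. -/
theorem ideal_eq_of_flat_quotient {A S : Type*} [CommRing A] [IsLocalRing A] [IsArtinianRing A]
    [CommRing S] [Algebra A S] {I J : Ideal S} [Module.Flat A (S ⧸ J)] (hIJ : I ≤ J)
    (h : J ≤ I ⊔ (maximalIdeal A).map (algebraMap A S)) : I = J := by
  have hker : LinearMap.ker (Ideal.Quotient.mkₐ A J).toLinearMap = J.restrictScalars A := by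
    ext x
    simp [Ideal.Quotient.eq_zero_iff_mem]
  have := ker_le_of_le_sup_smul (Ideal.Quotient.mkₐ A J).toLinearMap
    (Ideal.Quotient.mkₐ_surjective A J) (I.restrictScalars A) (by rw [hker]; exact hIJ) (by
      rw [hker, Ideal.smul_top_eq_map, ← Submodule.restrictScalars_sup]
      exact h)
  rw [hker] at this
  exact le_antisymm hIJ this

end flat

theorem isPrecomplete_map_of_surjective {R T : Type*} [CommRing R] [CommRing T] (f : R →+* T)
    (hf : Function.Surjective f) (I : Ideal R) [IsPrecomplete I R] :
    IsPrecomplete (I.map f) T := by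
  let _ : Algebra R T := f.toAlgebra
  have : IsPrecomplete I T := IsPrecomplete.of_surjective I (Algebra.linearMap R T) hf
  exact IsPrecomplete.map_algebraMap_iff.mpr this

theorem injective_of_surjective_endomorphism_of_isNoetherianRing {R : Type*} [CommRing R]
    [IsNoetherianRing R] (f : R →+* R) (hf : Function.Surjective f) : Function.Injective f := by
  obtain ⟨n, hn⟩ := monotone_stabilizes_iff_noetherian.mpr ‹IsNoetherianRing R›
    ⟨fun n => RingHom.ker (f ^ n), monotone_nat_of_le_succ fun n x hx => by
      rw [RingHom.mem_ker] at hx ⊢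
      rw [pow_succ', RingHom.mul_def, RingHom.comp_apply, hx, map_zero]⟩
  rw [injective_iff_map_eq_zero]
  intro x hx
  have hfn : Function.Surjective (f ^ n) := by
    rw [RingHom.coe_pow]
    exact hf.iterate n
  obtain ⟨y, rfl⟩ := hfn x
  have h1 : y ∈ RingHom.ker (f ^ (n + 1)) := by
    rw [RingHom.mem_ker, pow_succ', RingHom.mul_def, RingHom.comp_apply, hx]
  have h2 : RingHom.ker (f ^ n) = RingHom.ker (f ^ (n + 1)) := hn (n + 1) n.le_succ
  rw [← h2] at h1
  exact h1

/-! ### Coordinates on a formal surface pair -/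

section pairs

variable {k : Type u} [Field k] {O : Type u} [CommRing O] [IsLocalRing O] [Algebra k O]

theorem IsFormalSurfacePair.isNoetherianRing {k O : Type*} [Field k] [CommRing O] [Algebra k O]
    {D : Ideal O} (hSD : IsFormalSurfacePair k D) : IsNoetherianRing O := by
  obtain ⟨e⟩ := hSD.surface
  exact isNoetherianRing_of_surjective (MvPowerSeries (Fin 2) k) O e.symm.toRingEquiv
    e.symm.surjective

theorem map_maximalIdeal_of_algEquiv {R : Type*} [CommRing R] [IsLocalRing R] [Algebra k R]
    (e : R ≃ₐ[k] O) : (maximalIdeal R).map e = maximalIdeal O :=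
  IsLocalRing.map_maximalIdeal_of_surjective (e : R →+* O) e.surjective

/-- If `O ≅ k[[t₁, …, tᵣ]]`, then any `r` generators of the maximal ideal are coordinates. -/
theorem exists_algEquiv_mvPowerSeries_of_maximalIdeal_eq_span {r : ℕ} [IsNoetherianRing O]
    (e₀ : O ≃ₐ[k] MvPowerSeries (Fin r) k) (b : Fin r → O)
    (hb : maximalIdeal O = Ideal.span (Set.range b)) :
    ∃ e : O ≃ₐ[k] MvPowerSeries (Fin r) k, ∀ i, e (b i) = MvPowerSeries.X i := by
  have hc : IsPrecomplete (maximalIdeal (MvPowerSeries (Fin r) k)) (MvPowerSeries (Fin r) k) :=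
    (CompAlg.powerSeries k r).isAdicComplete.toIsPrecomplete
  have hprec : IsPrecomplete (maximalIdeal O) O := by
    rw [← map_maximalIdeal_of_algEquiv e₀.symm]
    exact isPrecomplete_map_of_surjective (e₀.symm : MvPowerSeries (Fin r) k →+* O)
      e₀.symm.surjective _
  have : IsAdicComplete (maximalIdeal O) O := {}
  obtain ⟨φ, hφ⟩ := exists_mvPowerSeries_algHom (k := k) (maximalIdeal O) b fun i => by
    rw [hb]
    exact Ideal.subset_span ⟨i, rfl⟩
  have hmap : (maximalIdeal (MvPowerSeries (Fin r) k)).map (φ : MvPowerSeries (Fin r) k →+* O) =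
      maximalIdeal O := by
    rw [maximalIdeal_mvPowerSeries, Ideal.map_span, ← Set.range_comp, hb]
    congr 2
    exact funext hφ
  have hres : HasResidueField k O := (CompAlg.powerSeries k r).hasResidueField.of_surjective
    (e₀.symm : MvPowerSeries (Fin r) k →ₐ[k] O) e₀.symm.surjective
  have hsurj : Function.Surjective φ := by
    have : IsHausdorff ((maximalIdeal (MvPowerSeries (Fin r) k)).map
        (φ : MvPowerSeries (Fin r) k →+* O)) O := by
      rw [hmap]
      infer_instance
    refine surjective_of_mk_map_comp_surjective (φ : MvPowerSeries (Fin r) k →+* O)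
      (I := maximalIdeal (MvPowerSeries (Fin r) k)) fun y => ?_
    obtain ⟨y, rfl⟩ := Ideal.Quotient.mk_surjective y
    refine ⟨algebraMap k _ (hres.res y), ?_⟩
    rw [RingHom.comp_apply, eq_comm, Ideal.Quotient.mk_eq_mk_iff_sub_mem, hmap]
    have h1 := hres.sub_res_mem y
    rwa [← φ.commutes] at h1
  -- `φ` and `e₀` compose to a surjective endomorphism of a noetherian ring
  have hinj : Function.Injective φ := by
    have h1 := injective_of_surjective_endomorphism_of_isNoetherianRing
      ((φ : MvPowerSeries (Fin r) k →+* O).comp (e₀ : O →+* MvPowerSeries (Fin r) k))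
      (hsurj.comp e₀.surjective)
    exact (Function.Injective.of_comp_iff' φ e₀.bijective).mp h1
  refine ⟨(AlgEquiv.ofBijective φ ⟨hinj, hsurj⟩).symm, fun i => ?_⟩
  rw [AlgEquiv.symm_apply_eq]
  exact (hφ i).symm

/-- On a formal surface pair there are coordinates `x, y` in which `D` is the axis `y = 0`. -/
theorem IsFormalSurfacePair.exists_coordinates {D : Ideal O} (hSD : IsFormalSurfacePair k D) :
    ∃ e : O ≃ₐ[k] MvPowerSeries (Fin 2) k, D.map e = Ideal.span {MvPowerSeries.X 1} := by
  have := hSD.isNoetherianRing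
  obtain ⟨e₀⟩ := hSD.surface
  obtain ⟨c⟩ := hSD.curve
  let q : O →ₐ[k] PowerSeries k := (c : (O ⧸ D) →ₐ[k] PowerSeries k).comp (Ideal.Quotient.mkₐ k D)
  have hq : Function.Surjective q := c.surjective.comp (Ideal.Quotient.mkₐ_surjective k D)
  have hq0 : ∀ g, q g = 0 ↔ g ∈ D := fun g => by
    change c (Ideal.Quotient.mk D g) = 0 ↔ _
    rw [map_eq_zero_iff _ c.injective, Ideal.Quotient.eq_zero_iff_mem]
  obtain ⟨X, hX⟩ := hq PowerSeries.X
  have hloc : IsLocalHom (q : O →+* PowerSeries k) := IsLocalHom.of_surjective _ hq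
  have hXm : X ∈ maximalIdeal O := fun hu => by
    have h1 := hu.map q
    rw [hX] at h1
    exact PowerSeries.X_prime.not_isUnit h1
  have hdiv : ∀ g ∈ maximalIdeal O, ∃ a, ∃ d ∈ D, g = a * X + d := by
    intro g hg
    have h1 : ¬ IsUnit (q g) := fun hu => hg (hloc.map_nonunit g hu)
    rw [PowerSeries.isUnit_iff_constantCoeff, isUnit_iff_ne_zero, not_not,
      ← PowerSeries.X_dvd_iff] at h1
    obtain ⟨h, hh⟩ := h1
    obtain ⟨a, rfl⟩ := hq h
    refine ⟨a, g - a * X, ?_, by ring⟩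
    rw [← hq0, map_sub, map_mul, hX, hh, mul_comm, sub_self]
  let x := e₀.symm (MvPowerSeries.X 0)
  let y := e₀.symm (MvPowerSeries.X 1)
  have hmax : maximalIdeal O = Ideal.span {x, y} := by
    rw [← map_maximalIdeal_of_algEquiv e₀.symm, maximalIdeal_mvPowerSeries, Ideal.map_span,
      ← Set.range_comp]
    congr 1
    ext z
    simp [x, y, eq_comm]
  have hDm := hSD.le_maximalIdeal
  -- one of the two generators of the maximal ideal can be replaced by `X`, and then the other one
  -- can be moved into `D`
  obtain ⟨Y, hY, hXY⟩ : ∃ Y ∈ D, maximalIdeal O = Ideal.span {X, Y} := by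
    have key : ∀ u v : O, maximalIdeal O = Ideal.span {u, v} → ∀ α β, X = α * u + β * v →
        IsUnit α → ∃ Y ∈ D, maximalIdeal O = Ideal.span {X, Y} := by
      rintro u v huv α β hαβ ⟨α, rfl⟩
      obtain ⟨b, d, hd, hbd⟩ := hdiv v (by rw [huv]; exact Ideal.subset_span (by simp))
      refine ⟨d, hd, le_antisymm ?_ ?_⟩
      · have hv : v ∈ Ideal.span {X, d} := by
          rw [Ideal.mem_span_pair]
          exact ⟨b, 1, by rw [hbd]; ring⟩
        rw [huv, Ideal.span_le]
        rintro z (hz | hz)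
        · rw [hz]
          have h1 : u = (α⁻¹ : Oˣ) * (X - β * v) := by
            rw [hαβ, add_sub_cancel_right, Units.inv_mul_cancel_left]
          rw [SetLike.mem_coe, h1]
          exact Ideal.mul_mem_left _ _ (sub_mem (Ideal.subset_span (by simp))
            (Ideal.mul_mem_left _ _ hv))
        · rw [hz]
          exact hv
      · rw [Ideal.span_le]
        rintro _ (rfl | rfl)
        · exact hXm
        · exact hDm hd
    obtain ⟨a, d, hd, hx⟩ := hdiv x (by rw [hmax]; exact Ideal.subset_span (by simp))
    obtain ⟨b, d', hd', hy⟩ := hdiv y (by rw [hmax]; exact Ideal.subset_span (by simp))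
    have h1 := hXm
    rw [hmax, Ideal.mem_span_pair] at h1
    obtain ⟨α, β, hαβ⟩ := h1
    have h2 : IsUnit (α * a + β * b) := by
      by_contra h
      have h3 : IsUnit (1 - (α * a + β * b)) :=
        (IsLocalRing.isUnit_or_isUnit_one_sub_self _).resolve_left h
      have h4 : (1 - (α * a + β * b)) * X ∈ D := by
        have h5 : (1 - (α * a + β * b)) * X = α * d + β * d' := by
          have h6 : X = α * (a * X + d) + β * (b * X + d') := by rw [← hx, ← hy, hαβ]
          linear_combination h6
        rw [h5]
        exact add_mem (D.mul_mem_left _ hd) (D.mul_mem_left _ hd')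
      rw [Ideal.unit_mul_mem_iff_mem D h3, ← hq0, hX] at h4
      exact PowerSeries.X_ne_zero h4
    rcases IsLocalRing.isUnit_or_isUnit_of_isUnit_add h2 with h | h
    · exact key x y hmax α β hαβ.symm (isUnit_of_mul_isUnit_left h)
    · exact key y x (by rw [hmax, Set.pair_comm]) β α (by rw [add_comm, hαβ])
        (isUnit_of_mul_isUnit_left h)
  obtain ⟨e, he⟩ := exists_algEquiv_mvPowerSeries_of_maximalIdeal_eq_span e₀ ![X, Y] (by
    rw [hXY, Matrix.range_cons, Matrix.range_cons, Matrix.range_empty, Set.union_empty,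
      Set.singleton_union])
  have heX : e X = MvPowerSeries.X 0 := he 0
  have heY : e Y = MvPowerSeries.X 1 := he 1
  refine ⟨e, le_antisymm ?_ ?_⟩
  · -- `O / (Y)` is generated by `X`, so that `O → O / (Y)` factors through `O / D`
    let J : Ideal (MvPowerSeries (Fin 2) k) := Ideal.span {MvPowerSeries.X 1}
    let σ : PowerSeries k →ₐ[k] MvPowerSeries (Fin 2) k ⧸ J :=
      (Ideal.Quotient.mkₐ k J).comp (PowerSeries.substAlgHom (PowerSeries.HasSubst.X 0))
    have hσ : (σ.comp q).comp (e.symm : MvPowerSeries (Fin 2) k →ₐ[k] O) =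
        Ideal.Quotient.mkₐ k J := by
      have hJ : Nontrivial (MvPowerSeries (Fin 2) k ⧸ J) := by
        rw [Ideal.Quotient.nontrivial_iff]
        refine ne_top_of_le_ne_top (maximalIdeal.isMaximal (MvPowerSeries (Fin 2) k)).ne_top ?_
        rw [maximalIdeal_mvPowerSeries]
        exact Ideal.span_mono (by rintro _ rfl; exact ⟨1, rfl⟩)
      have : IsLocalRing (MvPowerSeries (Fin 2) k ⧸ J) :=
        IsLocalRing.of_surjective' (Ideal.Quotient.mk J) Ideal.Quotient.mk_surjective
      symm
      apply mvPowerSeries_algHom_ext (maximalIdeal (MvPowerSeries (Fin 2) k ⧸ J))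
      · intro i
        rw [← IsLocalRing.map_maximalIdeal_of_surjective (Ideal.Quotient.mk J)
          Ideal.Quotient.mk_surjective]
        refine Ideal.mem_map_of_mem (Ideal.Quotient.mk J) ?_
        rw [maximalIdeal_mvPowerSeries]
        exact Ideal.subset_span ⟨i, rfl⟩
      · intro i
        fin_cases i
        · change Ideal.Quotient.mk J (MvPowerSeries.X 0) = σ (q (e.symm (MvPowerSeries.X 0)))
          rw [← heX, e.symm_apply_apply, hX, heX, AlgHom.comp_apply, PowerSeries.substAlgHom_X]
          rfl
        · change Ideal.Quotient.mk J (MvPowerSeries.X 1) = σ (q (e.symm (MvPowerSeries.X 1)))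
          rw [← heY, e.symm_apply_apply, (hq0 Y).mpr hY, heY, map_zero,
            Ideal.Quotient.eq_zero_iff_mem]
          exact Ideal.mem_span_singleton_self _
    rw [Ideal.map_le_iff_le_comap]
    intro g hg
    have h1 := DFunLike.congr_fun hσ (e g)
    change σ (q (e.symm (e g))) = Ideal.Quotient.mk J (e g) at h1
    rw [e.symm_apply_apply, (hq0 g).mpr hg, map_zero, eq_comm,
      Ideal.Quotient.eq_zero_iff_mem] at h1
    exact h1
  · rw [Ideal.span_singleton_le_iff_mem, ← heY]
    exact Ideal.mem_map_of_mem e hY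

end pairs

/-! ### Trivialization of the deformations of a smooth pair -/

section trivialization

variable {k : Type u} [Field k] {O : Type u} [CommRing O] [IsLocalRing O] [Algebra k O]

theorem IsClosedFiber.isNilpotent_ker {A X X₀ : Type*} [CommRing A] [IsLocalRing A]
    [IsArtinianRing A] [Algebra k A] [CommRing X] [Algebra A X] [CommRing X₀] [Algebra k X₀]
    {π : X →+* X₀} (h : IsClosedFiber k A π) : IsNilpotent (RingHom.ker π) := by
  obtain ⟨n, hn⟩ := exists_pow_maximalIdeal_eq_bot A
  exact ⟨n, by rw [h.ker_eq, ← Ideal.map_pow, hn, Ideal.map_bot, Ideal.zero_eq_bot]⟩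

theorem isUnit_of_isUnit_map {S T : Type*} [CommRing S] [CommRing T] (π : S →+* T)
    (hπ : Function.Surjective π) (hn : IsNilpotent (RingHom.ker π)) {s : S} (hs : IsUnit (π s)) :
    IsUnit s := by
  obtain ⟨t, ht⟩ := hs.exists_right_inv
  obtain ⟨t, rfl⟩ := hπ t
  have h1 : s * t - 1 ∈ RingHom.ker π := by
    rw [RingHom.mem_ker, map_sub, map_mul, ht, map_one, sub_self]
  have h2 : IsNilpotent (s * t - 1) := by
    obtain ⟨n, hn⟩ := hn
    exact ⟨n, by simpa [hn] using Ideal.pow_mem_pow h1 n⟩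
  have h3 := h2.isUnit_one_add
  rw [add_sub_cancel] at h3
  exact isUnit_of_mul_isUnit_left h3

/-- Deformations of a formal smooth surface pair with a section are trivial: lifts of the
coordinates `x, y` of the pair into the ideals of the section and of the deformation of `D` define
`A ⊗ k[[x, y]] → 𝒪_𝒮`, which is an isomorphism since it is one on the closed fibre. -/
theorem LogDeformation.exists_trivialization {C D : Ideal O} (hSD : IsFormalSurfacePair k D)
    {A : ArtAlg k} (X : LogDeformation k C D A.carrier) :
    ∃ β : A.carrier ⊗[k] O ≃ₐ[A.carrier] X.OS, (∀ z, X.πS (β z) = reduction O A z) ∧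
      (D.map (Algebra.TensorProduct.includeRight : O →ₐ[k] A.carrier ⊗[k] O)).map β = X.ID ∧
      ((maximalIdeal O).map (Algebra.TensorProduct.includeRight :
        O →ₐ[k] A.carrier ⊗[k] O)).map β = X.IP := by
  obtain ⟨e, he⟩ := hSD.exists_coordinates
  have := hSD.isNoetherianRing
  let _ : Algebra k X.OS := ((algebraMap A.carrier X.OS).comp (algebraMap k A.carrier)).toAlgebra
  have : IsScalarTower k A.carrier X.OS := IsScalarTower.of_algebraMap_eq fun _ => rfl
  let π : X.OS →ₐ[k] O := { X.πS with commutes' := X.closedFiberS.map_const }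
  have hπ : Function.Surjective π := X.closedFiberS.surjective
  have hmax : maximalIdeal O = Ideal.span (Set.range fun i => e.symm (MvPowerSeries.X i)) := by
    rw [← map_maximalIdeal_of_algEquiv e.symm, maximalIdeal_mvPowerSeries, Ideal.map_span,
      ← Set.range_comp]
    rfl
  have hD : D = Ideal.span {e.symm (MvPowerSeries.X 1)} := by
    have h1 := congrArg (Ideal.map e.symm) he
    rw [ideal_map_map_eq' D e e.symm (RingHom.id O) fun x => e.symm_apply_apply x, Ideal.map_id,
      Ideal.map_span, Set.image_singleton] at h1
    exact h1
  -- lifts of the coordinates, the first one in the ideal of the section, the second one in the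
  -- ideal of the deformation of `D`
  obtain ⟨b, hb, hb0, hb1⟩ : ∃ b : Fin 2 → X.OS, (∀ i, π (b i) = e.symm (MvPowerSeries.X i)) ∧
      b 0 ∈ X.IP ∧ b 1 ∈ X.ID := by
    have h0 : e.symm (MvPowerSeries.X 0) ∈ X.IP.map X.πS := by
      rw [X.map_IP, hmax]
      exact Ideal.subset_span ⟨0, rfl⟩
    have h1 : e.symm (MvPowerSeries.X 1) ∈ X.ID.map X.πS := by
      rw [X.map_ID, hD]
      exact Ideal.mem_span_singleton_self _
    rw [Ideal.mem_map_iff_of_surjective _ X.closedFiberS.surjective] at h0 h1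
    obtain ⟨x, hx, hx'⟩ := h0
    obtain ⟨y, hy, hy'⟩ := h1
    refine ⟨![x, y], fun i => ?_, hx, hy⟩
    fin_cases i
    · exact hx'
    · exact hy'
  have hnil : IsNilpotent (RingHom.ker X.πS) := X.closedFiberS.isNilpotent_ker
  have hnoeth : IsNoetherianRing X.OS :=
    isNoetherianRing_of_surjective_of_isNilpotent X.πS X.closedFiberS.surjective (by
      rw [X.closedFiberS.ker_eq]
      exact Ideal.FG.map (IsNoetherian.noetherian _) _) hnil
  have hloc : IsLocalHom X.πS :=
    ⟨fun s hs => isUnit_of_isUnit_map X.πS X.closedFiberS.surjective hnil hs⟩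
  have : IsLocalRing X.OS := RingHom.domain_isLocalRing X.πS
  -- power series in the lifts converge, as the total space is a nilpotent thickening of `S`
  let I : Ideal X.OS := Ideal.span (Set.range b)
  have hI : I.map X.πS = maximalIdeal O := by
    rw [hmax, Ideal.map_span, ← Set.range_comp]
    congr 2
    exact funext hb
  have : IsPrecomplete (I.map X.πS) O := by
    rw [hI, ← map_maximalIdeal_of_algEquiv e.symm]
    have : IsPrecomplete (maximalIdeal (MvPowerSeries (Fin 2) k)) (MvPowerSeries (Fin 2) k) :=
      (CompAlg.powerSeries k 2).isAdicComplete.toIsPrecomplete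
    exact isPrecomplete_map_of_surjective (e.symm : MvPowerSeries (Fin 2) k →+* O)
      e.symm.surjective _
  have : IsPrecomplete I X.OS :=
    isPrecomplete_of_surjective_of_isNilpotent X.πS X.closedFiberS.surjective hnil I
  have : IsHausdorff I X.OS := IsHausdorff.of_isLocalRing _ _ fun h => by
    rw [h, Ideal.map_top] at hI
    exact (maximalIdeal.isMaximal O).ne_top hI.symm
  have : IsAdicComplete I X.OS := {}
  obtain ⟨φ, hφ⟩ := exists_mvPowerSeries_algHom (k := k) I b fun i => Ideal.subset_span ⟨i, rfl⟩
  have hπφ : π.comp φ = e.symm := by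
    apply mvPowerSeries_algHom_ext (maximalIdeal O)
    · intro i
      rw [AlgHom.comp_apply, hφ, hb, hmax]
      exact Ideal.subset_span ⟨i, rfl⟩
    · intro i
      rw [AlgHom.comp_apply, hφ, hb]
      rfl
  let β : A.carrier ⊗[k] O →ₐ[A.carrier] X.OS :=
    Algebra.TensorProduct.lift (Algebra.ofId _ _) (φ.comp e) fun _ _ => Commute.all _ _
  have hβ1 : ∀ g, β (1 ⊗ₜ g) = φ (e g) := fun g => by
    rw [Algebra.TensorProduct.lift_tmul, map_one, one_mul]
    rfl
  have hπβ1 : ∀ g, X.πS (β (1 ⊗ₜ g)) = g := fun g => by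
    rw [hβ1]
    refine (DFunLike.congr_fun hπφ (e g)).trans ?_
    exact e.symm_apply_apply g
  have hπβ : ∀ z, X.πS (β z) = reduction O A z := by
    intro z
    induction z with
    | zero => simp
    | add x y hx hy => simp only [map_add, hx, hy]
    | tmul a g =>
      have h1 : a ⊗ₜ[k] g = algebraMap A.carrier (A.carrier ⊗[k] O) a * (1 ⊗ₜ g) := by
        simp [Algebra.TensorProduct.algebraMap_apply]
      rw [reduction_tmul, h1, map_mul, map_mul, hπβ1, AlgHom.commutes,
        X.closedFiberS.map_algebraMap A.hasResidueField]
  have hsurj : Function.Surjective β :=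
    surjective_of_closedFiber (isClosedFiber_reduction O A) X.closedFiberS β (RingHom.id O) hπβ
      Function.surjective_id
  have := X.flatOS
  have hinj : Function.Injective β := by
    have h1 := ker_le_of_le_sup_smul β.toLinearMap hsurj ⊥ bot_le (by
      intro z hz
      have h2 : z ∈ RingHom.ker (reduction O A) := by
        have h3 : β z = 0 := hz
        rw [RingHom.mem_ker, ← hπβ, h3, map_zero]
      rw [(isClosedFiber_reduction O A).ker_eq, ← Submodule.restrictScalars_mem A.carrier,
        ← Ideal.smul_top_eq_map] at h2
      exact Submodule.mem_sup_right h2)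
    rw [injective_iff_map_eq_zero]
    intro z hz
    exact h1 hz
  -- by flatness, `β` identifies the ideals of the trivial deformations with the given ones as
  -- soon as it maps the former into the latter
  have hmem : ∀ (I₀ : Ideal O) (J : Ideal X.OS), Module.Flat A.carrier (X.OS ⧸ J) →
      (∀ g ∈ I₀, β (1 ⊗ₜ g) ∈ J) → J.map X.πS = I₀ →
      (I₀.map (Algebra.TensorProduct.includeRight : O →ₐ[k] A.carrier ⊗[k] O)).map β = J := by
    intro I₀ J _ hI₀ hJ
    apply ideal_eq_of_flat_quotient (A := A.carrier)
    · rw [Ideal.map_le_iff_le_comap, Ideal.map_le_iff_le_comap]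
      exact hI₀
    · intro s hs
      have h1 : X.πS s ∈ I₀ := hJ ▸ Ideal.mem_map_of_mem _ hs
      have h2 := Ideal.mem_map_of_mem β (Ideal.mem_map_of_mem
        (Algebra.TensorProduct.includeRight : O →ₐ[k] A.carrier ⊗[k] O) h1)
      have h3 : s - β (1 ⊗ₜ X.πS s) ∈ RingHom.ker X.πS := by
        rw [RingHom.mem_ker, map_sub, hπβ1, sub_self]
      rw [X.closedFiberS.ker_eq] at h3
      have := Submodule.add_mem_sup h2 h3
      simpa using this
  refine ⟨AlgEquiv.ofBijective β ⟨hinj, hsurj⟩, hπβ, hmem _ _ X.flatD ?_ X.map_ID,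
    hmem _ _ ?_ ?_ X.map_IP⟩
  · change D ≤ X.ID.comap (β.toRingHom.comp
      (Algebra.TensorProduct.includeRight : O →ₐ[k] A.carrier ⊗[k] O).toRingHom)
    conv_lhs => rw [hD]
    rw [Ideal.span_singleton_le_iff_mem, Ideal.mem_comap]
    change β (1 ⊗ₜ e.symm (MvPowerSeries.X 1)) ∈ X.ID
    rw [hβ1, e.apply_symm_apply, hφ]
    exact hb1
  · exact Module.Flat.of_linearEquiv (LinearEquiv.ofBijective
      (Algebra.linearMap A.carrier (X.OS ⧸ X.IP)) X.isSection).symm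
  · change maximalIdeal O ≤ X.IP.comap (β.toRingHom.comp
      (Algebra.TensorProduct.includeRight : O →ₐ[k] A.carrier ⊗[k] O).toRingHom)
    rw [hmax, Ideal.span_le]
    rintro _ ⟨i, rfl⟩
    change β (1 ⊗ₜ e.symm (MvPowerSeries.X i)) ∈ X.IP
    rw [hβ1, e.apply_symm_apply, hφ]
    fin_cases i
    · exact hb0
    · exact X.ID_le_IP hb1

end trivialization

/-! ### Embedded deformations -/

section embedded

open CategoryTheory

variable {k : Type u} [Field k] {O : Type u} [CommRing O] [IsLocalRing O] [Algebra k O]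

/-- A deformation is determined, up to isomorphism, by the log pair and the ideal of the curve. -/
theorem LogDeformation.equivalent_of_algEquiv {C D : Ideal O} {A : ArtAlg k}
    {X Y : LogDeformation k C D A.carrier} (β : X.OS ≃ₐ[A.carrier] Y.OS)
    (hπ : ∀ s, Y.πS (β s) = X.πS s) (hD : X.ID.map β = Y.ID) (hP : X.IP.map β = Y.IP)
    (hC : (RingHom.ker X.ι).map β = RingHom.ker Y.ι) : X.Equivalent Y := by
  let α : X.OC ≃ₐ[A.carrier] Y.OC :=
    (Ideal.quotientKerAlgEquivOfSurjective X.ι_surjective).symm.trans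
      ((Ideal.quotientEquivAlg _ _ β hC.symm).trans
        (Ideal.quotientKerAlgEquivOfSurjective Y.ι_surjective))
  have hα : ∀ s, Y.ι (β s) = α (X.ι s) := by
    intro s
    have h1 : (Ideal.quotientKerAlgEquivOfSurjective X.ι_surjective).symm (X.ι s) =
        Ideal.Quotient.mk _ s := by
      rw [AlgEquiv.symm_apply_eq]
      rfl
    change _ = Ideal.quotientKerAlgEquivOfSurjective Y.ι_surjective (Ideal.quotientEquivAlg _ _ β
      hC.symm ((Ideal.quotientKerAlgEquivOfSurjective X.ι_surjective).symm (X.ι s)))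
    rw [h1]
    rfl
  refine ⟨α, β, hα, hπ, fun c => ?_, hD, hP⟩
  obtain ⟨s, rfl⟩ := X.ι_surjective c
  rw [← hα, Y.πC_ι, hπ, X.πC_ι]

theorem LogDeformation.Equivalent.exists_algEquiv {C D : Ideal O} {A : ArtAlg k}
    {X Y : LogDeformation k C D A.carrier} (h : X.Equivalent Y) :
    ∃ β : X.OS ≃ₐ[A.carrier] Y.OS, (∀ s, Y.πS (β s) = X.πS s) ∧ X.ID.map β = Y.ID ∧
      X.IP.map β = Y.IP ∧ (RingHom.ker X.ι).map β = RingHom.ker Y.ι := by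
  obtain ⟨α, β, h1, h2, h3, h4, h5⟩ := h
  refine ⟨β, h2, h4, h5, ?_⟩
  ext s
  obtain ⟨s, rfl⟩ := β.surjective s
  rw [RingHom.mem_ker, h1, map_eq_zero_iff _ α.injective,
    Ideal.mem_map_iff_of_surjective _ β.surjective]
  constructor
  · rintro ⟨x, hx, hxs⟩
    rwa [← β.injective hxs]
  · exact fun hs => ⟨s, hs, rfl⟩

theorem LogDeformation.ContainsMult.of_equivalent {C D : Ideal O} {A : ArtAlg k}
    {X Y : LogDeformation k C D A.carrier} (h : X.Equivalent Y) {m : ℕ} (hX : X.ContainsMult m) :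
    Y.ContainsMult m := by
  obtain ⟨β, -, hD, hP, hC⟩ := h.exists_algEquiv
  rw [ContainsMult, ← hC, ← hD, ← hP]
  refine (Ideal.map_mono hX).trans ?_
  rw [multIdeal, Ideal.map_sup, Ideal.map_pow]
  exact le_rfl

theorem LogDeformation.equivalent_of_algEquiv_of_span {C D : Ideal O} {A : ArtAlg k}
    {X Y : LogDeformation k C D A.carrier} (β : X.OS ≃ₐ[A.carrier] Y.OS)
    (hπ : ∀ s, Y.πS (β s) = X.πS s) (hD : X.ID.map β = Y.ID) (hP : X.IP.map β = Y.IP)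
    {g : X.OS} {g' : Y.OS} (hg : RingHom.ker X.ι = Ideal.span {g})
    (hg' : RingHom.ker Y.ι = Ideal.span {g'}) (h : Ideal.span {β g} = Ideal.span {g'}) :
    X.Equivalent Y :=
  X.equivalent_of_algEquiv β hπ hD hP (by
    rw [hg, hg', Ideal.map_span, Set.image_singleton, h])

theorem LogDeformation.Equivalent.exists_algEquiv_of_span {C D : Ideal O} {A : ArtAlg k}
    {X Y : LogDeformation k C D A.carrier} (h : X.Equivalent Y)
    {g : X.OS} {g' : Y.OS} (hg : RingHom.ker X.ι = Ideal.span {g})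
    (hg' : RingHom.ker Y.ι = Ideal.span {g'}) :
    ∃ β : X.OS ≃ₐ[A.carrier] Y.OS, (∀ s, Y.πS (β s) = X.πS s) ∧ X.ID.map β = Y.ID ∧
      X.IP.map β = Y.IP ∧ Ideal.span {β g} = Ideal.span {g'} := by
  obtain ⟨β, hπ, hD, hP, hC⟩ := h.exists_algEquiv
  rw [hg, hg', Ideal.map_span, Set.image_singleton] at hC
  exact ⟨β, hπ, hD, hP, hC⟩

theorem LogDeformation.containsMult_iff_of_span {C D : Ideal O} {A : ArtAlg k}
    {X : LogDeformation k C D A.carrier} {g : X.OS} (hg : RingHom.ker X.ι = Ideal.span {g})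
    (m : ℕ) : X.ContainsMult m ↔ g ∈ multIdeal X.ID X.IP m := by
  rw [ContainsMult, hg, Ideal.span_singleton_le_iff_mem]

theorem LogDeformation.ker_baseChange_ι_of_span {C D : Ideal O} {A B : ArtAlg k}
    [Algebra A.carrier B.carrier] [IsScalarTower k A.carrier B.carrier]
    [IsLocalHom (algebraMap A.carrier B.carrier)] {X : LogDeformation k C D A.carrier} {g : X.OS}
    (hg : RingHom.ker X.ι = Ideal.span {g}) :
    RingHom.ker (X.baseChange A.hasResidueField B.hasResidueField).ι =
      (Ideal.span {1 ⊗ₜ g} : Ideal (B.carrier ⊗[A.carrier] X.OS)) := by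
  have h1 : RingHom.ker (X.baseChange A.hasResidueField B.hasResidueField).ι =
      (RingHom.ker X.ι).map (Algebra.TensorProduct.includeRight :
        X.OS →ₐ[A.carrier] B.carrier ⊗[A.carrier] X.OS) :=
    Algebra.TensorProduct.lTensor_ker (A := B.carrier) X.ι X.ι_surjective
  rw [h1, hg, Ideal.map_span, Set.image_singleton]
  rfl

/-- The extension of an ideal of `O` to `A ⊗ O`. -/
abbrev extIdeal (A : ArtAlg k) (I : Ideal O) : Ideal (A.carrier ⊗[k] O) :=
  I.map (Algebra.TensorProduct.includeRight : O →ₐ[k] A.carrier ⊗[k] O)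

/-- The extension of an ideal of `A` to `A ⊗ O`. -/
abbrev baseIdeal (O : Type u) [CommRing O] [Algebra k O] (A : ArtAlg k) (J : Ideal A.carrier) :
    Ideal (A.carrier ⊗[k] O) :=
  J.map (algebraMap A.carrier (A.carrier ⊗[k] O))

theorem ker_reduction (O : Type u) [CommRing O] [Algebra k O] (A : ArtAlg k) :
    RingHom.ker (reduction O A) = baseIdeal O A (maximalIdeal A.carrier) :=
  (isClosedFiber_reduction O A).ker_eq

theorem isUnit_of_reduction_eq_one {O : Type u} [CommRing O] [Algebra k O] {A : ArtAlg k}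
    {u : A.carrier ⊗[k] O} (hu : reduction O A u = 1) : IsUnit u :=
  isUnit_of_isUnit_map (reduction O A) (isClosedFiber_reduction O A).surjective
    (isClosedFiber_reduction O A).isNilpotent_ker (hu ▸ isUnit_one)

/-- Automorphisms of the trivial deformation of the pair `(S, D)` with the section `P`. -/
structure IsLogAut (A : ArtAlg k) (D : Ideal O)
    (β : A.carrier ⊗[k] O ≃ₐ[A.carrier] A.carrier ⊗[k] O) : Prop where
  reduction_apply : ∀ z, reduction O A (β z) = reduction O A z
  map_D : (extIdeal A D).map β = extIdeal A D
  map_P : (extIdeal A (maximalIdeal O)).map β = extIdeal A (maximalIdeal O)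

namespace IsLogAut

variable {A : ArtAlg k} {D : Ideal O} {β γ : A.carrier ⊗[k] O ≃ₐ[A.carrier] A.carrier ⊗[k] O}

theorem refl (A : ArtAlg k) (D : Ideal O) :
    IsLogAut A D (AlgEquiv.refl : A.carrier ⊗[k] O ≃ₐ[A.carrier] A.carrier ⊗[k] O) :=
  ⟨fun _ => rfl, Ideal.map_id _, Ideal.map_id _⟩

theorem trans (hβ : IsLogAut A D β) (hγ : IsLogAut A D γ) : IsLogAut A D (β.trans γ) := by
  have h : ∀ I : Ideal (A.carrier ⊗[k] O), I.map (β.trans γ) = (I.map β).map γ := fun I =>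
    (ideal_map_map_eq' I β γ (β.trans γ) fun _ => rfl).symm
  exact ⟨fun z => by rw [AlgEquiv.trans_apply, hγ.reduction_apply, hβ.reduction_apply],
    by rw [h, hβ.map_D, hγ.map_D], by rw [h, hβ.map_P, hγ.map_P]⟩

theorem map_multIdeal (hβ : IsLogAut A D β) (m : ℕ) :
    (extIdeal A (multIdeal D (maximalIdeal O) m)).map β =
      extIdeal A (multIdeal D (maximalIdeal O) m) := by
  rw [extIdeal, multIdeal, Ideal.map_sup, Ideal.map_sup, Ideal.map_pow, Ideal.map_pow, hβ.map_D,
    hβ.map_P]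

end IsLogAut

variable {D : Ideal O} (hSD : IsFormalSurfacePair k D) {F : O} (hF : F ∉ D)

theorem ker_embeddedDeformation_ι (A : ArtAlg k) (G : A.carrier ⊗[k] O)
    (hG : reduction O A G = F) :
    RingHom.ker (embeddedDeformation hSD hF A G hG).ι =
      (Ideal.span {G} : Ideal (embeddedDeformation hSD hF A G hG).OS) :=
  Ideal.Quotient.mkₐ_ker A.carrier (Ideal.span {G})

/-- Every deformation over an artinian base is isomorphic to an embedded one: the ambient pair
deforms trivially, and by flatness the ideal of the curve is generated by any lift of `F`. -/
theorem LogDeformation.exists_equivalent_embeddedDeformation {A : ArtAlg k}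
    (X : LogDeformation k (Ideal.span {F}) D A.carrier) :
    ∃ (G : A.carrier ⊗[k] O) (hG : reduction O A G = F),
      (embeddedDeformation hSD hF A G hG).Equivalent X := by
  obtain ⟨β, hπ, hD, hP⟩ := X.exists_trivialization hSD
  obtain ⟨s, hs, hsF⟩ : ∃ s ∈ RingHom.ker X.ι, X.πS s = F := by
    obtain ⟨s, hs⟩ := X.closedFiberS.surjective F
    have h1 : X.ι s ∈ RingHom.ker X.πC := by
      rw [RingHom.mem_ker, X.πC_ι, hs, Ideal.Quotient.eq_zero_iff_mem]
      exact Ideal.mem_span_singleton_self F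
    rw [X.closedFiberC.ker_eq, ← X.ι.comp_algebraMap, ← Ideal.map_map,
      Ideal.mem_map_iff_of_surjective (X.ι : X.OS →+* X.OC) X.ι_surjective] at h1
    obtain ⟨t, ht, hts⟩ := h1
    rw [← X.closedFiberS.ker_eq, RingHom.mem_ker] at ht
    refine ⟨s - t, ?_, by rw [map_sub, hs, ht, sub_zero]⟩
    rw [RingHom.mem_ker, map_sub, sub_eq_zero]
    exact hts.symm
  have hG : reduction O A (β.symm s) = F := by
    rw [← hπ, β.apply_symm_apply, hsF]
  suffices h : RingHom.ker X.ι = Ideal.span {s} from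
    ⟨β.symm s, hG, LogDeformation.equivalent_of_algEquiv_of_span β hπ hD hP
      (ker_embeddedDeformation_ι hSD hF A _ hG) h
      (congrArg (fun z => Ideal.span {z}) (β.apply_symm_apply s))⟩
  symm
  have := X.flatOC
  have : Module.Flat A.carrier (X.OS ⧸ RingHom.ker X.ι) :=
    Module.Flat.of_linearEquiv
      (Ideal.quotientKerAlgEquivOfSurjective X.ι_surjective).toLinearEquiv
  apply ideal_eq_of_flat_quotient (A := A.carrier)
  · rwa [Ideal.span_singleton_le_iff_mem]
  · intro z hz
    have h2 : X.πS z ∈ Ideal.span {F} := by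
      rw [← Ideal.Quotient.eq_zero_iff_mem, ← X.πC_ι, hz, map_zero]
    obtain ⟨c, hc⟩ := Ideal.mem_span_singleton'.mp h2
    obtain ⟨c, rfl⟩ := X.closedFiberS.surjective c
    have h3 : z - c * s ∈ RingHom.ker X.πS := by
      rw [RingHom.mem_ker, map_sub, map_mul, hsF, hc, sub_self]
    rw [X.closedFiberS.ker_eq] at h3
    have := Submodule.add_mem_sup (Ideal.mul_mem_left _ c (Ideal.mem_span_singleton_self s)) h3
    rwa [add_sub_cancel] at this

/-- Two equations define isomorphic deformations if and only if they differ by a logarithmic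
automorphism and a unit, both trivial on the closed fibre. -/
theorem embeddedDeformation_equivalent_iff {A : ArtAlg k} {G G' : A.carrier ⊗[k] O}
    (hG : reduction O A G = F) (hG' : reduction O A G' = F) :
    (embeddedDeformation hSD hF A G hG).Equivalent (embeddedDeformation hSD hF A G' hG') ↔
      ∃ β : A.carrier ⊗[k] O ≃ₐ[A.carrier] A.carrier ⊗[k] O, IsLogAut A D β ∧
        ∃ u, reduction O A u = 1 ∧ β G = u * G' := by
  constructor
  · intro h
    obtain ⟨β, hπ, hD, hP, hC⟩ := h.exists_algEquiv_of_span
      (ker_embeddedDeformation_ι hSD hF A G hG) (ker_embeddedDeformation_ι hSD hF A G' hG')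
    change A.carrier ⊗[k] O ≃ₐ[A.carrier] A.carrier ⊗[k] O at β
    change Ideal.span {β G} = Ideal.span {G'} at hC
    have h1 : β G ∈ Ideal.span {G'} := hC ▸ Ideal.mem_span_singleton_self _
    obtain ⟨u, hu⟩ := Ideal.mem_span_singleton'.mp h1
    refine ⟨β, ⟨hπ, hD, hP⟩, u, ?_, hu.symm⟩
    have h2 := congrArg (reduction O A) hu
    have h3 : reduction O A (β G) = reduction O A G := hπ G
    rw [map_mul, h3, hG, hG'] at h2
    -- `u` reduces to `1` because `F` is not a zero divisor
    have h4 : (reduction O A u - 1) * F = 0 := by rw [sub_mul, h2, one_mul, sub_self]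
    exact sub_eq_zero.mp ((mem_nonZeroDivisors_iff.mp (hSD.mem_nonZeroDivisors hF)).2 _ h4)
  · rintro ⟨β, hβ, u, hu, h⟩
    refine LogDeformation.equivalent_of_algEquiv_of_span β hβ.reduction_apply hβ.map_D hβ.map_P
      (ker_embeddedDeformation_ι hSD hF A G hG) (ker_embeddedDeformation_ι hSD hF A G' hG') ?_
    change Ideal.span {β G} = Ideal.span {G'}
    rw [h, Ideal.span_singleton_mul_left_unit (isUnit_of_reduction_eq_one hu)]

theorem embeddedDeformation_containsMult_iff {A : ArtAlg k} {G : A.carrier ⊗[k] O}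
    (hG : reduction O A G = F) (m : ℕ) :
    (embeddedDeformation hSD hF A G hG).ContainsMult m ↔
      G ∈ extIdeal A (multIdeal D (maximalIdeal O) m) := by
  refine (LogDeformation.containsMult_iff_of_span (ker_embeddedDeformation_ι hSD hF A G hG)
    m).trans ?_
  rw [extIdeal, multIdeal, multIdeal, Ideal.map_sup, Ideal.map_pow]
  exact Iff.rfl

/-- The homomorphism `A ⊗ O → B ⊗ O` induced by `A → B`. -/
def mapBase (O : Type u) [CommRing O] [Algebra k O] {A B : ArtAlg k} (φ : A ⟶ B) :
    A.carrier ⊗[k] O →ₐ[k] B.carrier ⊗[k] O :=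
  Algebra.TensorProduct.map φ.1 (AlgHom.id k O)

theorem mapBase_tmul {O : Type u} [CommRing O] [Algebra k O] {A B : ArtAlg k} (φ : A ⟶ B)
    (a : A.carrier) (g : O) : mapBase O φ (a ⊗ₜ g) = φ.1 a ⊗ₜ g :=
  rfl

theorem reduction_mapBase {O : Type u} [CommRing O] [Algebra k O] {A B : ArtAlg k} (φ : A ⟶ B)
    (z : A.carrier ⊗[k] O) : reduction O B (mapBase O φ z) = reduction O A z := by
  have := φ.2
  induction z with
  | zero => simp
  | add x y hx hy => simp only [map_add, hx, hy]
  | tmul a g =>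
    rw [mapBase_tmul, reduction_tmul, reduction_tmul,
      A.hasResidueField.res_map B.hasResidueField]

theorem embeddedDeformation_pullback {A B : ArtAlg k} (φ : A ⟶ B) {G : A.carrier ⊗[k] O}
    (hG : reduction O A G = F) :
    ((embeddedDeformation hSD hF A G hG).pullback φ).Equivalent
      (embeddedDeformation hSD hF B (mapBase O φ G) ((reduction_mapBase φ G).trans hG)) := by
  let _ : Algebra A.carrier B.carrier := φ.1.toRingHom.toAlgebra
  have : IsScalarTower k A.carrier B.carrier :=
    IsScalarTower.of_algebraMap_eq fun c => (φ.1.commutes c).symm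
  have : IsLocalHom (algebraMap A.carrier B.carrier) := ⟨fun a ha => φ.2.map_nonunit a ha⟩
  let X := embeddedDeformation hSD hF A G hG
  let β : B.carrier ⊗[A.carrier] (A.carrier ⊗[k] O) ≃ₐ[B.carrier] B.carrier ⊗[k] O :=
    Algebra.TensorProduct.cancelBaseChange k A.carrier B.carrier B.carrier O
  have hβ : ∀ z : A.carrier ⊗[k] O, β (1 ⊗ₜ z) = mapBase O φ z := by
    intro z
    induction z with
    | zero => simp
    | add x y hx hy => rw [tmul_add, map_add, map_add, hx, hy]
    | tmul a g =>
      rw [mapBase_tmul]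
      change Algebra.TensorProduct.cancelBaseChange k A.carrier B.carrier B.carrier O _ = _
      rw [Algebra.TensorProduct.cancelBaseChange_tmul, Algebra.smul_def, mul_one]
      rfl
  have aux : ∀ I : Ideal O, ((extIdeal A I).map (Algebra.TensorProduct.includeRight :
      A.carrier ⊗[k] O →ₐ[A.carrier] B.carrier ⊗[A.carrier] (A.carrier ⊗[k] O))).map β =
      extIdeal B I := by
    intro I
    rw [extIdeal, ideal_map_map_eq' I _ _ (((Algebra.TensorProduct.includeRight :
        A.carrier ⊗[k] O →ₐ[A.carrier] B.carrier ⊗[A.carrier] (A.carrier ⊗[k] O)) :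
        A.carrier ⊗[k] O →+* B.carrier ⊗[A.carrier] (A.carrier ⊗[k] O)).comp
      ((Algebra.TensorProduct.includeRight : O →ₐ[k] A.carrier ⊗[k] O) :
        O →+* A.carrier ⊗[k] O)) fun x => rfl]
    exact ideal_map_map_eq' I _ _ _ fun x => by
      change β (1 ⊗ₜ (1 ⊗ₜ x)) = 1 ⊗ₜ x
      rw [hβ, mapBase_tmul, map_one]
  have h0 : RingHom.ker (X.baseChange A.hasResidueField B.hasResidueField).ι =
      (Ideal.span {1 ⊗ₜ G} : Ideal (B.carrier ⊗[A.carrier] (A.carrier ⊗[k] O))) := by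
    exact LogDeformation.ker_baseChange_ι_of_span (X := X) (ker_embeddedDeformation_ι hSD hF A G hG)
  refine LogDeformation.equivalent_of_algEquiv_of_span
    (X := X.baseChange A.hasResidueField B.hasResidueField) β ?_ (aux D) (aux _) h0
      (ker_embeddedDeformation_ι hSD hF B _ ((reduction_mapBase φ G).trans hG))
      (congrArg (fun z => Ideal.span {z}) (hβ G))
  · intro s
    change B.carrier ⊗[A.carrier] (A.carrier ⊗[k] O) at s
    change reduction O B (β s) =
      (isClosedFiber_reduction O A).baseChange A.hasResidueField B.hasResidueField s
    have h1 : ∀ (b : B.carrier) (z : A.carrier ⊗[k] O), β (b ⊗ₜ z) =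
        algebraMap B.carrier (B.carrier ⊗[k] O) b * mapBase O φ z := by
      intro b z
      rw [← hβ, ← β.commutes b, ← map_mul]
      congr 1
      rw [Algebra.TensorProduct.algebraMap_apply, Algebra.TensorProduct.tmul_mul_tmul, one_mul,
        mul_one]
      rfl
    induction s with
    | zero => simp
    | add x y hx hy => simp only [map_add, hx, hy]
    | tmul b z =>
      rw [h1, map_mul, reduction_mapBase, IsClosedFiber.baseChange_tmul,
        (isClosedFiber_reduction O B).map_algebraMap B.hasResidueField]

end embedded

/-! ### Ideals of the trivial deformation -/

section tensor

open CategoryTheory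

variable {k : Type u} [Field k] {O : Type u} [CommRing O] [Algebra k O]

theorem extIdeal_induction {O : Type u} [CommRing O] [Algebra k O] {A : ArtAlg k}
    {I : Ideal O} {p : A.carrier ⊗[k] O → Prop}
    (h0 : p 0) (hadd : ∀ x y, p x → p y → p (x + y)) (htmul : ∀ a, ∀ g ∈ I, p (a ⊗ₜ g))
    {z : A.carrier ⊗[k] O}
    (hz : z ∈ I.map (Algebra.TensorProduct.includeRight : O →ₐ[k] A.carrier ⊗[k] O)) : p z := by
  rw [← Submodule.restrictScalars_mem k, Ideal.map_includeRight_eq] at hz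
  obtain ⟨t, rfl⟩ := hz
  induction t with
  | zero => rwa [map_zero]
  | add x y hx hy => rw [map_add]; exact hadd _ _ hx hy
  | tmul a g => exact htmul a g g.2

theorem baseIdeal_induction {A : ArtAlg k} {J : Ideal A.carrier} {p : A.carrier ⊗[k] O → Prop}
    (h0 : p 0) (hadd : ∀ x y, p x → p y → p (x + y)) (htmul : ∀ a ∈ J, ∀ g, p (a ⊗ₜ g))
    {z : A.carrier ⊗[k] O} (hz : z ∈ baseIdeal O A J) : p z := by
  change z ∈ J.map (Algebra.TensorProduct.includeLeft : A.carrier →ₐ[k] A.carrier ⊗[k] O) at hz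
  rw [← Submodule.restrictScalars_mem k, Ideal.map_includeLeft_eq] at hz
  obtain ⟨t, rfl⟩ := hz
  induction t with
  | zero => rwa [map_zero]
  | add x y hx hy => rw [map_add]; exact hadd _ _ hx hy
  | tmul a g => exact htmul a a.2 g

theorem tmul_eq_smul (A : ArtAlg k) (a : A.carrier) (g : O) :
    a ⊗ₜ[k] g = a • ((1 : A.carrier) ⊗ₜ[k] g) := by
  rw [smul_tmul', smul_eq_mul, mul_one]

theorem tmul_mem_extIdeal {A : ArtAlg k} {I : Ideal O} (a : A.carrier) {g : O} (hg : g ∈ I) :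
    a ⊗ₜ[k] g ∈ I.map (Algebra.TensorProduct.includeRight : O →ₐ[k] A.carrier ⊗[k] O) := by
  rw [tmul_eq_smul, Algebra.smul_def]
  exact Ideal.mul_mem_left _ _ (Ideal.mem_map_of_mem
    (Algebra.TensorProduct.includeRight : O →ₐ[k] A.carrier ⊗[k] O) hg)

theorem smul_mem_baseIdeal {A : ArtAlg k} {J J' : Ideal A.carrier} {a : A.carrier} (ha : a ∈ J)
    {z : A.carrier ⊗[k] O} (hz : z ∈ baseIdeal O A J') : a • z ∈ baseIdeal O A (J * J') := by
  rw [Algebra.smul_def, baseIdeal, Ideal.map_mul]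
  exact Ideal.mul_mem_mul (Ideal.mem_map_of_mem _ ha) hz

theorem tmul_mem_baseIdeal {A : ArtAlg k} {J : Ideal A.carrier} {a : A.carrier} (ha : a ∈ J)
    (g : O) : a ⊗ₜ[k] g ∈ baseIdeal O A J := by
  rw [tmul_eq_smul, Algebra.smul_def]
  exact Ideal.mul_mem_right _ _ (Ideal.mem_map_of_mem _ ha)

theorem mul_mem_baseIdeal {A : ArtAlg k} {J J' : Ideal A.carrier} {z w : A.carrier ⊗[k] O}
    (hz : z ∈ baseIdeal O A J) (hw : w ∈ baseIdeal O A J') : z * w ∈ baseIdeal O A (J * J') := by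
  rw [baseIdeal, Ideal.map_mul]
  exact Ideal.mul_mem_mul hz hw

theorem flat_quotient_extIdeal {O : Type u} [CommRing O] [Algebra k O] (A : ArtAlg k)
    (I : Ideal O) : Module.Flat A.carrier (A.carrier ⊗[k] O ⧸
      I.map (Algebra.TensorProduct.includeRight : O →ₐ[k] A.carrier ⊗[k] O)) :=
  Module.Flat.of_linearEquiv
    (Algebra.TensorProduct.tensorQuotientEquiv (R := k) A.carrier O A.carrier I).symm.toLinearEquiv

/-- Elements of `J ⊗ O ∩ A ⊗ I` are sums of tensors `a ⊗ g` with `a ∈ J` and `g ∈ I`. -/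
theorem baseIdeal_inf_extIdeal_induction {A : ArtAlg k} {J : Ideal A.carrier} {I : Ideal O}
    {p : A.carrier ⊗[k] O → Prop}
    (h0 : p 0) (hadd : ∀ x y, p x → p y → p (x + y)) (htmul : ∀ a ∈ J, ∀ g ∈ I, p (a ⊗ₜ g))
    {z : A.carrier ⊗[k] O} (hz : z ∈ baseIdeal O A J)
    (hz' : z ∈ I.map (Algebra.TensorProduct.includeRight : O →ₐ[k] A.carrier ⊗[k] O)) : p z := by
  have := flat_quotient_extIdeal A I
  set E := I.map (Algebra.TensorProduct.includeRight : O →ₐ[k] A.carrier ⊗[k] O)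
  have hker : LinearMap.ker (Ideal.Quotient.mkₐ A.carrier E).toLinearMap =
      E.restrictScalars A.carrier := by
    ext x
    simp [Ideal.Quotient.eq_zero_iff_mem]
  have h1 := ker_inf_smul_top_le (Ideal.Quotient.mkₐ A.carrier E).toLinearMap
    (Ideal.Quotient.mkₐ_surjective A.carrier E) J
  rw [hker, Ideal.smul_top_eq_map] at h1
  refine Submodule.smul_induction_on (h1 ⟨hz', hz⟩) (fun a ha w hw => ?_) hadd
  refine extIdeal_induction (p := fun w => p (a • w)) (by rwa [smul_zero])
    (fun x y hx hy => by rw [smul_add]; exact hadd _ _ hx hy) (fun b g hg => ?_) hw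
  rw [smul_tmul', smul_eq_mul]
  exact htmul _ (J.mul_mem_right _ ha) g hg

/-! #### Change of coefficients along a `k`-linear map -/

variable {A B : ArtAlg k} (s : A.carrier →ₗ[k] B.carrier)

theorem rTensor_one_tmul_mul (g : O) (z : A.carrier ⊗[k] O) :
    s.rTensor O ((1 ⊗ₜ g) * z) = (1 ⊗ₜ g) * s.rTensor O z := by
  induction z with
  | zero => simp
  | add x y hx hy => rw [mul_add, map_add, hx, hy, map_add, mul_add]
  | tmul a h => simp

theorem rTensor_mem_extIdeal {I : Ideal O} {z : A.carrier ⊗[k] O}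
    (hz : z ∈ I.map (Algebra.TensorProduct.includeRight : O →ₐ[k] A.carrier ⊗[k] O)) :
    s.rTensor O z ∈ I.map (Algebra.TensorProduct.includeRight : O →ₐ[k] B.carrier ⊗[k] O) :=
  extIdeal_induction (p := fun z => s.rTensor O z ∈
    I.map (Algebra.TensorProduct.includeRight : O →ₐ[k] B.carrier ⊗[k] O))
    (by rw [map_zero]; exact zero_mem _)
    (fun x y hx hy => by rw [map_add]; exact add_mem hx hy)
    (fun a g hg => tmul_mem_extIdeal (s a) hg) hz

theorem rTensor_mem_baseIdeal {J : Ideal A.carrier} {J' : Ideal B.carrier}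
    (hs : ∀ a ∈ J, s a ∈ J') {z : A.carrier ⊗[k] O} (hz : z ∈ baseIdeal O A J) :
    s.rTensor O z ∈ baseIdeal O B J' :=
  baseIdeal_induction (p := fun z => s.rTensor O z ∈ baseIdeal O B J')
    (by rw [map_zero]; exact zero_mem _)
    (fun x y hx hy => by rw [map_add]; exact add_mem hx hy)
    (fun a ha g => tmul_mem_baseIdeal (hs a ha) g) hz

end tensor

/-! ### Logarithmic vector fields and their exponentials -/

section exp

open CategoryTheory

variable {k : Type u} [Field k] {O : Type u} [CommRing O] [IsLocalRing O] [Algebra k O]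

/-- A `k`-derivation `d : O → A ⊗ O` with values in `J ⊗ O`, preserving the ideals of `D` and of the
closed point: an infinitesimal automorphism of the trivial deformation of the pair with a
section. -/
structure IsLogVector (A : ArtAlg k) (D : Ideal O) (J : Ideal A.carrier)
    (d : O →ₗ[k] A.carrier ⊗[k] O) : Prop where
  leibniz : ∀ g h, d (g * h) = (1 ⊗ₜ g) * d h + (1 ⊗ₜ h) * d g
  mem_base : ∀ g, d g ∈ baseIdeal O A J
  mem_D : ∀ g ∈ D, d g ∈ extIdeal A D
  mem_P : ∀ g ∈ maximalIdeal O, d g ∈ extIdeal A (maximalIdeal O)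

/-- The `A`-linear extension `A ⊗ O → A ⊗ O` of `d : O → A ⊗ O`. -/
abbrev extendVector {A : ArtAlg k} (d : O →ₗ[k] A.carrier ⊗[k] O) :
    Module.End A.carrier (A.carrier ⊗[k] O) :=
  d.liftBaseChange A.carrier

namespace IsLogVector

variable {A : ArtAlg k} {D : Ideal O} {J : Ideal A.carrier} {d d' : O →ₗ[k] A.carrier ⊗[k] O}

theorem zero (A : ArtAlg k) (D : Ideal O) (J : Ideal A.carrier) : IsLogVector A D J 0 :=
  ⟨fun _ _ => by simp, fun _ => zero_mem _, fun _ _ => zero_mem _, fun _ _ => zero_mem _⟩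

theorem add (h : IsLogVector A D J d) (h' : IsLogVector A D J d') :
    IsLogVector A D J (d + d') where
  leibniz f g := by
    rw [LinearMap.add_apply, h.leibniz, h'.leibniz, LinearMap.add_apply, LinearMap.add_apply]
    ring
  mem_base g := add_mem (h.mem_base g) (h'.mem_base g)
  mem_D g hg := add_mem (h.mem_D g hg) (h'.mem_D g hg)
  mem_P g hg := add_mem (h.mem_P g hg) (h'.mem_P g hg)

theorem neg (h : IsLogVector A D J d) : IsLogVector A D J (-d) where
  leibniz f g := by
    rw [LinearMap.neg_apply, h.leibniz, LinearMap.neg_apply, LinearMap.neg_apply]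
    ring
  mem_base g := neg_mem (h.mem_base g)
  mem_D g hg := neg_mem (h.mem_D g hg)
  mem_P g hg := neg_mem (h.mem_P g hg)

theorem mono (h : IsLogVector A D J d) {J' : Ideal A.carrier} (hJ : J ≤ J') :
    IsLogVector A D J' d :=
  ⟨h.leibniz, fun g => Ideal.map_mono hJ (h.mem_base g), h.mem_D, h.mem_P⟩

theorem extend_mul (h : IsLogVector A D J d) (z w : A.carrier ⊗[k] O) :
    extendVector d (z * w) = z * extendVector d w + extendVector d z * w := by
  induction z with
  | zero => simp
  | add x y hx hy => rw [add_mul, map_add, hx, hy, map_add]; ring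
  | tmul a f =>
    induction w with
    | zero => simp
    | add x y hx hy => rw [mul_add, map_add, hx, hy, map_add]; ring
    | tmul b g =>
      rw [Algebra.TensorProduct.tmul_mul_tmul, LinearMap.liftBaseChange_tmul,
        LinearMap.liftBaseChange_tmul, LinearMap.liftBaseChange_tmul, h.leibniz, tmul_eq_smul A a,
        tmul_eq_smul A b]
      simp only [Algebra.smul_def, map_mul]
      ring

theorem extend_mem_baseIdeal (h : IsLogVector A D J d) {J' : Ideal A.carrier}
    {z : A.carrier ⊗[k] O} (hz : z ∈ baseIdeal O A J') :
    extendVector d z ∈ baseIdeal O A (J' * J) :=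
  baseIdeal_induction (p := fun z => extendVector d z ∈ baseIdeal O A (J' * J))
    (by rw [map_zero]; exact zero_mem _)
    (fun x y hx hy => by rw [map_add]; exact add_mem hx hy)
    (fun a ha g => by
      rw [LinearMap.liftBaseChange_tmul]
      exact smul_mem_baseIdeal ha (h.mem_base g)) hz

theorem pow_extend_mem_baseIdeal (h : IsLogVector A D J d) (n : ℕ) (z : A.carrier ⊗[k] O) :
    (extendVector d ^ n) z ∈ baseIdeal O A (J ^ n) := by
  induction n with
  | zero => simp [baseIdeal, Ideal.map_top]
  | succ n ih =>
    rw [pow_succ' (extendVector d), Module.End.mul_apply, pow_succ J]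
    exact h.extend_mem_baseIdeal (J' := J ^ n) ih

theorem extend_mem_extIdeal {O : Type u} [CommRing O] [Algebra k O]
    {d : O →ₗ[k] A.carrier ⊗[k] O} {I : Ideal O} (hI : ∀ g ∈ I, d g ∈ extIdeal A I)
    {z : A.carrier ⊗[k] O} (hz : z ∈ extIdeal A I) : extendVector d z ∈ extIdeal A I :=
  extIdeal_induction (p := fun z => extendVector d z ∈ extIdeal A I)
    (by rw [map_zero]; exact zero_mem _)
    (fun x y hx hy => by rw [map_add]; exact add_mem hx hy)
    (fun a g hg => by
      rw [LinearMap.liftBaseChange_tmul, Algebra.smul_def]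
      exact Ideal.mul_mem_left _ _ (hI g hg)) hz

theorem pow_extend_mem_extIdeal {O : Type u} [CommRing O] [Algebra k O]
    {d : O →ₗ[k] A.carrier ⊗[k] O} {I : Ideal O} (hI : ∀ g ∈ I, d g ∈ extIdeal A I) (n : ℕ)
    {z : A.carrier ⊗[k] O} (hz : z ∈ extIdeal A I) : (extendVector d ^ n) z ∈ extIdeal A I := by
  induction n with
  | zero => simpa using hz
  | succ n ih =>
    rw [pow_succ', Module.End.mul_apply]
    exact extend_mem_extIdeal hI ih

theorem pow_extend_eq_zero (h : IsLogVector A D J d) {n : ℕ} (hn : J ^ n = ⊥) :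
    extendVector d ^ n = 0 := by
  refine LinearMap.ext fun z => ?_
  have h1 := h.pow_extend_mem_baseIdeal n z
  rwa [hn, baseIdeal, Ideal.map_bot, Ideal.mem_bot] at h1

/-- In characteristic zero a logarithmic vector field with nilpotent coefficients can be
exponentiated. -/
theorem exists_exp [CharZero k] (h : IsLogVector A D J d) (hJ : J ≤ maximalIdeal A.carrier) :
    ∃ β : A.carrier ⊗[k] O ≃ₐ[A.carrier] A.carrier ⊗[k] O, ∀ n, J ^ n = ⊥ → ∀ z,
      β z = ∑ i ∈ Finset.range n, ((i.factorial : k)⁻¹) • (extendVector d ^ i) z := by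
  let _ : Module ℚ (A.carrier ⊗[k] O) := Module.compHom _ (algebraMap ℚ k)
  obtain ⟨N, hN⟩ : ∃ N, J ^ N = ⊥ := by
    obtain ⟨N, hN⟩ := exists_pow_maximalIdeal_eq_bot A.carrier
    exact ⟨N, le_bot_iff.mp ((Ideal.pow_right_mono hJ N).trans hN.le)⟩
  have hformula : ∀ {d : O →ₗ[k] A.carrier ⊗[k] O}, IsLogVector A D J d → ∀ n, J ^ n = ⊥ → ∀ z,
      IsNilpotent.exp (extendVector d) z =
        ∑ i ∈ Finset.range n, ((i.factorial : k)⁻¹) • (extendVector d ^ i) z := by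
    intro d hd n hn z
    rw [IsNilpotent.exp_eq_sum (hd.pow_extend_eq_zero hn), LinearMap.sum_apply]
    refine Finset.sum_congr rfl fun i _ => ?_
    change (algebraMap ℚ k (i.factorial : ℚ)⁻¹) • (extendVector d ^ i) z = _
    rw [map_inv₀, map_natCast]
  have hone : ∀ {d : O →ₗ[k] A.carrier ⊗[k] O}, IsLogVector A D J d →
      IsNilpotent.exp (extendVector d) 1 = 1 := by
    intro d hd
    have h1 : extendVector d 1 = 0 := by
      have := hd.extend_mul 1 1
      rw [mul_one, mul_one, one_mul] at this
      exact left_eq_add.mp this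
    rw [hformula hd (N + 1) (by rw [pow_succ, hN, Ideal.bot_mul]), Finset.sum_range_succ',
      Finset.sum_eq_zero fun i _ => by
        rw [pow_succ, Module.End.mul_apply, h1, map_zero, smul_zero]]
    simp
  let E : ∀ {d : O →ₗ[k] A.carrier ⊗[k] O}, IsLogVector A D J d →
      (A.carrier ⊗[k] O →ₐ[A.carrier] A.carrier ⊗[k] O) := fun {d} hd =>
    AlgHom.ofLinearMap (IsNilpotent.exp (extendVector d)) (hone hd)
      (Module.End.exp_mul_of_derivation A.carrier (A.carrier ⊗[k] O) (extendVector d)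
        hd.extend_mul ⟨N, hd.pow_extend_eq_zero hN⟩)
  have hneg : extendVector (-d) = -extendVector d := by
    refine LinearMap.ext fun z => ?_
    induction z with
    | zero => simp
    | add x y hx hy => rw [map_add, hx, hy, map_add]
    | tmul a g => simp
  have hexp : IsNilpotent.exp (extendVector d) * IsNilpotent.exp (extendVector (-d)) = 1 ∧
      IsNilpotent.exp (extendVector (-d)) * IsNilpotent.exp (extendVector d) = 1 := by
    have h1 : IsNilpotent (extendVector d) := ⟨N, h.pow_extend_eq_zero hN⟩
    rw [hneg]
    exact ⟨IsNilpotent.exp_mul_exp_neg_self h1, IsNilpotent.exp_neg_mul_exp_self h1⟩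
  exact ⟨AlgEquiv.ofAlgHom (E h) (E h.neg)
    (AlgHom.ext fun z => DFunLike.congr_fun hexp.1 z)
    (AlgHom.ext fun z => DFunLike.congr_fun hexp.2 z), hformula h⟩

end IsLogVector

end exp

section logAut

open CategoryTheory

variable {k : Type u} [Field k] {O : Type u} [CommRing O] [IsLocalRing O] [Algebra k O]

/-! ### The automorphisms of the trivial deformation of a pair with a section -/

theorem algEquiv_mem_baseIdeal {O : Type u} [CommRing O] [Algebra k O] {A : ArtAlg k}
    (β : A.carrier ⊗[k] O ≃ₐ[A.carrier] A.carrier ⊗[k] O) {J : Ideal A.carrier}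
    {z : A.carrier ⊗[k] O} (hz : z ∈ baseIdeal O A J) : β z ∈ baseIdeal O A J := by
  have h1 := Ideal.mem_map_of_mem (β : A.carrier ⊗[k] O →+* A.carrier ⊗[k] O) hz
  rw [baseIdeal, Ideal.map_map] at h1
  have h2 : (β : A.carrier ⊗[k] O →+* A.carrier ⊗[k] O).comp (algebraMap A.carrier _) =
      algebraMap A.carrier _ := RingHom.ext β.commutes
  rwa [h2] at h1

theorem IsLogAut.symm {A : ArtAlg k} {D : Ideal O}
    {β : A.carrier ⊗[k] O ≃ₐ[A.carrier] A.carrier ⊗[k] O} (hβ : IsLogAut A D β) :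
    IsLogAut A D β.symm := by
  have h : ∀ I : Ideal (A.carrier ⊗[k] O), I.map β = I → I.map β.symm = I := fun I hI => by
    conv_lhs => rw [← hI]
    exact (ideal_map_map_eq' I β β.symm (RingHom.id _) β.symm_apply_apply).trans (Ideal.map_id I)
  exact ⟨fun z => by rw [← hβ.reduction_apply, β.apply_symm_apply], h _ hβ.map_D, h _ hβ.map_P⟩

/-- By flatness, an automorphism that is trivial on the closed fibre and maps the ideals of `D` and
`P` into themselves maps them onto themselves. -/
theorem IsLogAut.of_mem {A : ArtAlg k} {D : Ideal O}
    {β : A.carrier ⊗[k] O ≃ₐ[A.carrier] A.carrier ⊗[k] O}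
    (hβ : ∀ z, β z - z ∈ baseIdeal O A (maximalIdeal A.carrier))
    (hD : ∀ z ∈ extIdeal A D, β z ∈ extIdeal A D)
    (hP : ∀ z ∈ extIdeal A (maximalIdeal O), β z ∈ extIdeal A (maximalIdeal O)) :
    IsLogAut A D β := by
  have h : ∀ I : Ideal O, (∀ z ∈ extIdeal A I, β z ∈ extIdeal A I) →
      (extIdeal A I).map β = extIdeal A I := by
    intro I hI
    have := flat_quotient_extIdeal A I
    apply ideal_eq_of_flat_quotient (A := A.carrier)
    · rw [Ideal.map_le_iff_le_comap]
      exact hI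
    · intro z hz
      have := Submodule.add_mem_sup (Ideal.mem_map_of_mem β hz) (neg_mem (hβ z))
      rwa [← sub_eq_add_neg, sub_sub_cancel] at this
  refine ⟨fun z => ?_, h D hD, h _ hP⟩
  have h1 := hβ z
  rw [← ker_reduction, RingHom.mem_ker, map_sub, sub_eq_zero] at h1
  exact h1

/-- The exponential of a logarithmic vector field `d` with coefficients in `J` is an automorphism
of the pair with its section, and equals `1 + d` modulo `J²`. -/
theorem IsLogVector.exists_isLogAut [CharZero k] {A : ArtAlg k} {D : Ideal O}
    {J : Ideal A.carrier} {d : O →ₗ[k] A.carrier ⊗[k] O} (h : IsLogVector A D J d)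
    (hJ : J ≤ maximalIdeal A.carrier) :
    ∃ β : A.carrier ⊗[k] O ≃ₐ[A.carrier] A.carrier ⊗[k] O, IsLogAut A D β ∧
      (∀ n, J ^ n = ⊥ → ∀ z,
        β z = ∑ i ∈ Finset.range n, ((i.factorial : k)⁻¹) • (extendVector d ^ i) z) ∧
      ∀ z, β z - z - extendVector d z ∈ baseIdeal O A (J * J) := by
  obtain ⟨β, hβ⟩ := h.exists_exp hJ
  obtain ⟨N, hN⟩ : ∃ N, J ^ N = ⊥ := by
    obtain ⟨N, hN⟩ := exists_pow_maximalIdeal_eq_bot A.carrier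
    exact ⟨N, le_bot_iff.mp ((Ideal.pow_right_mono hJ N).trans hN.le)⟩
  have hsmul : ∀ (I : Ideal (A.carrier ⊗[k] O)) (c : k) {z}, z ∈ I → c • z ∈ I := fun I c z hz => by
    rw [Algebra.smul_def]
    exact I.mul_mem_left _ hz
  have h2 : ∀ z, β z - z - extendVector d z ∈ baseIdeal O A (J * J) := by
    intro z
    rw [hβ (N + 2) (by rw [pow_add, hN, Ideal.bot_mul]), Finset.sum_range_succ',
      Finset.sum_range_succ']
    simp only [zero_add, pow_one, pow_zero, Nat.factorial_zero, Nat.factorial_one, Nat.cast_one,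
      inv_one, one_smul, Module.End.one_apply, add_sub_cancel_right]
    refine sum_mem fun i _ => hsmul _ _ ?_
    rw [← pow_two]
    exact Ideal.map_mono (Ideal.pow_le_pow_right (by omega))
      (h.pow_extend_mem_baseIdeal (i + 1 + 1) z)
  have hI : ∀ I : Ideal O, (∀ g ∈ I, d g ∈ extIdeal A I) → ∀ z ∈ extIdeal A I,
      β z ∈ extIdeal A I := by
    intro I hI z hz
    rw [hβ N hN]
    exact sum_mem fun i _ => hsmul _ _ (IsLogVector.pow_extend_mem_extIdeal hI i hz)
  refine ⟨β, IsLogAut.of_mem (fun z => ?_) (hI D h.mem_D) (hI _ h.mem_P), hβ, h2⟩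
  have h3 := h.pow_extend_mem_baseIdeal 1 z
  rw [pow_one, pow_one] at h3
  have := add_mem (Ideal.map_mono ((Ideal.mul_le_left (I := J)).trans hJ) (h2 z))
    (Ideal.map_mono hJ h3)
  rwa [sub_add_cancel] at this

/-- To first order, an automorphism which is trivial modulo `J` is given by a logarithmic vector
field: modulo `𝔪 J` the map `β - 1` is a derivation, and a `k`-linear projection along `𝔪 J` turns
it into a derivation on the nose. -/
theorem IsLogAut.exists_isLogVector {A : ArtAlg k} {D : Ideal O}
    {β : A.carrier ⊗[k] O ≃ₐ[A.carrier] A.carrier ⊗[k] O} (hβ : IsLogAut A D β)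
    {J : Ideal A.carrier} (hJ : J ≤ maximalIdeal A.carrier)
    (h : ∀ z, β z - z ∈ baseIdeal O A J) :
    ∃ d, IsLogVector A D J d ∧
      ∀ z, β z - z - extendVector d z ∈ baseIdeal O A (maximalIdeal A.carrier * J) := by
  obtain ⟨M, hM⟩ : ∃ M : Ideal A.carrier, M = maximalIdeal A.carrier * J := ⟨_, rfl⟩
  have hMJ : M ≤ J := hM ▸ Ideal.mul_le_right
  rw [← hM]
  obtain ⟨s, hs⟩ := ((M.restrictScalars k).mkQ).exists_rightInverse_of_surjective
    (LinearMap.range_eq_top.mpr (Submodule.mkQ_surjective _))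
  let p : A.carrier →ₗ[k] A.carrier := s ∘ₗ (M.restrictScalars k).mkQ
  have hpM : ∀ a ∈ M, p a = 0 := fun a ha => by
    have : (M.restrictScalars k).mkQ a = 0 := (Submodule.Quotient.mk_eq_zero _).mpr ha
    simp only [p, LinearMap.comp_apply, this, map_zero]
  have hp : ∀ a, a - p a ∈ M := fun a => by
    have h1 : (M.restrictScalars k).mkQ (a - p a) = 0 := by
      rw [map_sub, sub_eq_zero]
      exact (DFunLike.congr_fun hs ((M.restrictScalars k).mkQ a)).symm
    exact (Submodule.Quotient.mk_eq_zero (M.restrictScalars k)).mp h1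
  have hpJ : ∀ a ∈ J, p a ∈ J := fun a ha => by
    have := sub_mem ha (hMJ (hp a))
    rwa [sub_sub_cancel] at this
  have hTM : ∀ z ∈ baseIdeal O A M, p.rTensor O z = 0 := fun z hz => by
    have := rTensor_mem_baseIdeal (J' := ⊥) p (fun a ha => hpM a ha) hz
    rwa [baseIdeal, Ideal.map_bot, Ideal.mem_bot] at this
  have hT : ∀ z : A.carrier ⊗[k] O, z - p.rTensor O z ∈ baseIdeal O A M := fun z => by
    induction z with
    | zero => simp
    | add x y hx hy => rw [map_add, add_sub_add_comm]; exact add_mem hx hy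
    | tmul a g =>
      rw [LinearMap.rTensor_tmul, ← sub_tmul]
      exact tmul_mem_baseIdeal (hp a) g
  let inc : O →ₗ[k] A.carrier ⊗[k] O :=
    (Algebra.TensorProduct.includeRight : O →ₐ[k] A.carrier ⊗[k] O).toLinearMap
  let d : O →ₗ[k] A.carrier ⊗[k] O :=
    p.rTensor O ∘ₗ ((β.toLinearMap.restrictScalars k) ∘ₗ inc - inc)
  have hd : ∀ g, d g = p.rTensor O (β (1 ⊗ₜ g) - 1 ⊗ₜ g) := fun _ => rfl
  have hmem : ∀ I : Ideal O, (extIdeal A I).map β = extIdeal A I → ∀ g ∈ I, d g ∈ extIdeal A I := by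
    intro I hI g hg
    have h1 : (1 : A.carrier) ⊗ₜ[k] g ∈ extIdeal A I := tmul_mem_extIdeal 1 hg
    have h2 := Ideal.mem_map_of_mem β h1
    rw [hI] at h2
    exact rTensor_mem_extIdeal p (sub_mem h2 h1)
  have hd1 : ∀ g, β (1 ⊗ₜ g) - 1 ⊗ₜ g - d g ∈ baseIdeal O A M := fun g => hT _
  refine ⟨d, ⟨fun f g => ?_, fun g => rTensor_mem_baseIdeal p hpJ (h _), hmem D hβ.map_D,
    hmem _ hβ.map_P⟩, fun z => ?_⟩
  · have h1 : β (1 ⊗ₜ (f * g)) - 1 ⊗ₜ (f * g) =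
        (β (1 ⊗ₜ f) - 1 ⊗ₜ f) * (β (1 ⊗ₜ g) - 1 ⊗ₜ g) +
          ((1 ⊗ₜ f) * (β (1 ⊗ₜ g) - 1 ⊗ₜ g) + (1 ⊗ₜ g) * (β (1 ⊗ₜ f) - 1 ⊗ₜ f)) := by
      have h2 : (1 : A.carrier) ⊗ₜ[k] (f * g) = (1 ⊗ₜ f) * (1 ⊗ₜ g) := by simp
      rw [h2, map_mul]
      ring
    rw [hd, h1, map_add, hTM _ (Ideal.map_mono ((Ideal.mul_mono_left hJ).trans hM.ge)
      (mul_mem_baseIdeal (h _) (h _))), zero_add, map_add, rTensor_one_tmul_mul,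
      rTensor_one_tmul_mul, hd, hd]
  · induction z with
    | zero => simp
    | add x y hx hy =>
      have := add_mem hx hy
      rw [map_add, map_add]
      convert this using 1
      ring
    | tmul a g =>
      rw [LinearMap.liftBaseChange_tmul, tmul_eq_smul, map_smul, ← smul_sub, ← smul_sub,
        Algebra.smul_def]
      exact Ideal.mul_mem_left _ _ (hd1 g)

theorem mapBase_smul {O : Type u} [CommRing O] [Algebra k O] {A B : ArtAlg k} (φ : B ⟶ A)
    (b : B.carrier) (z : B.carrier ⊗[k] O) : mapBase O φ (b • z) = φ.1 b • mapBase O φ z := by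
  induction z with
  | zero => simp
  | add x y hx hy => rw [smul_add, map_add, hx, hy, map_add, smul_add]
  | tmul a g =>
    rw [smul_tmul', mapBase_tmul, mapBase_tmul, smul_tmul', smul_eq_mul, map_mul, smul_eq_mul]

/-- A logarithmic vector field lifts along a surjection `B → A` by applying a `k`-linear section of
it to the coefficients. -/
theorem IsLogVector.exists_lift {A B : ArtAlg k} (p : B ⟶ A) (hp : Function.Surjective p.1)
    {D : Ideal O} {d : O →ₗ[k] A.carrier ⊗[k] O}
    (hd : IsLogVector A D (maximalIdeal A.carrier) d) :
    ∃ d', IsLogVector B D (maximalIdeal B.carrier) d' ∧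
      ∀ z, mapBase O p (extendVector d' z) = extendVector d (mapBase O p z) := by
  obtain ⟨s, hs⟩ := p.1.toLinearMap.exists_rightInverse_of_surjective
    (LinearMap.range_eq_top.mpr hp)
  have hs' : ∀ a, p.1 (s a) = a := fun a => DFunLike.congr_fun hs a
  have hsm : ∀ a ∈ maximalIdeal A.carrier, s a ∈ maximalIdeal B.carrier := fun a ha hu => by
    have := hu.map p.1
    rw [hs'] at this
    exact ha this
  refine ⟨s.rTensor O ∘ₗ d, ⟨fun f g => ?_, fun g => rTensor_mem_baseIdeal s hsm (hd.mem_base g),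
    fun g hg => rTensor_mem_extIdeal s (hd.mem_D g hg),
    fun g hg => rTensor_mem_extIdeal s (hd.mem_P g hg)⟩, fun z => ?_⟩
  · simp only [LinearMap.comp_apply]
    rw [hd.leibniz, map_add, rTensor_one_tmul_mul, rTensor_one_tmul_mul]
  · have h1 : ∀ w : A.carrier ⊗[k] O, mapBase O p (s.rTensor O w) = w := fun w => by
      induction w with
      | zero => simp
      | add x y hx hy => rw [map_add, map_add, hx, hy]
      | tmul a g => rw [LinearMap.rTensor_tmul, mapBase_tmul, hs']
    induction z with
    | zero => simp
    | add x y hx hy => simp only [map_add, hx, hy]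
    | tmul b g =>
      rw [LinearMap.liftBaseChange_tmul, mapBase_smul, mapBase_tmul, LinearMap.comp_apply, h1,
        LinearMap.liftBaseChange_tmul]

/-- Automorphisms lift along surjections of artinian algebras: by the preceding statements they are
products of exponentials of logarithmic vector fields, whose coefficients can be lifted. -/
theorem IsLogAut.exists_lift [CharZero k] {A B : ArtAlg k} (p : B ⟶ A)
    (hp : Function.Surjective p.1) {D : Ideal O}
    {β : A.carrier ⊗[k] O ≃ₐ[A.carrier] A.carrier ⊗[k] O} (hβ : IsLogAut A D β) :
    ∃ γ : B.carrier ⊗[k] O ≃ₐ[B.carrier] B.carrier ⊗[k] O, IsLogAut B D γ ∧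
      ∀ z, mapBase O p (γ z) = β (mapBase O p z) := by
  obtain ⟨N, hN⟩ := exists_pow_maximalIdeal_eq_bot A.carrier
  suffices key : ∀ i j : ℕ, N ≤ i + j → 1 ≤ j →
      ∀ β : A.carrier ⊗[k] O ≃ₐ[A.carrier] A.carrier ⊗[k] O, IsLogAut A D β →
      (∀ z, β z - z ∈ baseIdeal O A (maximalIdeal A.carrier ^ j)) →
      ∃ γ : B.carrier ⊗[k] O ≃ₐ[B.carrier] B.carrier ⊗[k] O, IsLogAut B D γ ∧
        ∀ z, mapBase O p (γ z) = β (mapBase O p z) by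
    refine key N 1 (Nat.le_succ N) le_rfl β hβ fun z => ?_
    rw [pow_one, ← ker_reduction, RingHom.mem_ker, map_sub, hβ.reduction_apply, sub_self]
  intro i
  -- an automorphism trivial modulo `𝔪ʲ` is, modulo `𝔪ʲ⁺¹`, the exponential `ε` of a vector field
  -- `d`; the exponential `ε'` of a lift of `d` lifts `ε`, which reduces `β` to `ε⁻¹ β`
  induction i with
  | zero =>
    intro j hj _ β _ h
    refine ⟨AlgEquiv.refl, IsLogAut.refl B D, fun z => ?_⟩
    have h1 := h (mapBase O p z)
    rw [zero_add] at hj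
    have h2 : maximalIdeal A.carrier ^ j = ⊥ :=
      le_bot_iff.mp ((Ideal.pow_le_pow_right hj).trans hN.le)
    rw [h2, baseIdeal, Ideal.map_bot, Ideal.mem_bot, sub_eq_zero] at h1
    exact h1.symm
  | succ i ih =>
    intro j hj hj1 β hβ h
    have hJ : maximalIdeal A.carrier ^ j ≤ maximalIdeal A.carrier :=
      Ideal.pow_le_self (by omega)
    obtain ⟨d, hd, hdβ⟩ := hβ.exists_isLogVector hJ h
    obtain ⟨ε, hε, hεf, hdε⟩ := hd.exists_isLogAut hJ
    obtain ⟨d', hd', hdd'⟩ := (hd.mono hJ).exists_lift p hp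
    obtain ⟨ε', hε', hε'f, -⟩ := hd'.exists_isLogAut le_rfl
    have hjj : maximalIdeal A.carrier ^ j * maximalIdeal A.carrier ^ j ≤
        maximalIdeal A.carrier ^ (j + 1) := by
      rw [← pow_add]
      exact Ideal.pow_le_pow_right (by omega)
    have hεε' : ∀ z, mapBase O p (ε' z) = ε (mapBase O p z) := by
      intro z
      obtain ⟨N', hN'⟩ := exists_pow_maximalIdeal_eq_bot B.carrier
      have h1 : (maximalIdeal A.carrier ^ j) ^ (N + N') = ⊥ := by
        refine le_bot_iff.mp (le_trans ?_ hN.le)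
        rw [← pow_mul]
        exact Ideal.pow_le_pow_right (Nat.le_trans (by omega) (Nat.le_mul_of_pos_left (N + N') hj1))
      rw [hε'f (N + N') (by rw [pow_add, hN', Ideal.mul_bot]), hεf (N + N') h1, map_sum]
      refine Finset.sum_congr rfl fun i hi => ?_
      clear hi
      rw [map_smul]
      congr 1
      induction i with
      | zero => rfl
      | succ i hi => rw [pow_succ', pow_succ', Module.End.mul_apply, Module.End.mul_apply, hdd', hi]
    obtain ⟨γ, hγ, hγβ⟩ := ih (j + 1) (by omega) (by omega) (β.trans ε.symm) (hβ.trans hε.symm)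
      fun z => by
        have h1 : β z - ε z ∈ baseIdeal O A (maximalIdeal A.carrier ^ (j + 1)) := by
          have h2 := hdβ z
          rw [← pow_succ'] at h2
          have := sub_mem h2 (Ideal.map_mono hjj (hdε z))
          convert this using 1
          ring
        have h2 := algEquiv_mem_baseIdeal ε.symm h1
        rwa [map_sub, ε.symm_apply_apply] at h2
    refine ⟨γ.trans ε', hγ.trans hε', fun z => ?_⟩
    rw [AlgEquiv.trans_apply, hεε', hγβ, AlgEquiv.trans_apply, ε.apply_symm_apply]

end logAut

section moving

open CategoryTheory

variable {k : Type u} [Field k] {O : Type u} [CommRing O] [IsLocalRing O] [Algebra k O]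

/-! ### First order changes of the equation -/

theorem mem_relEquianalyticIdeal {D : Ideal O} {F g : O} :
    g ∈ relEquianalyticIdeal k D F ↔
      ∃ δ ∈ logDerivations k D (maximalIdeal O), ∃ h, g = δ F + h * F := by
  rw [relEquianalyticIdeal, Submodule.mem_sup]
  constructor
  · rintro ⟨_, ⟨δ, hδ, rfl⟩, z, hz, rfl⟩
    obtain ⟨h, rfl⟩ := Ideal.mem_span_singleton'.mp hz
    exact ⟨δ, hδ, h, rfl⟩
  · rintro ⟨δ, hδ, h, rfl⟩
    exact ⟨_, Submodule.mem_map_of_mem hδ, _, Ideal.mem_span_singleton'.mpr ⟨h, rfl⟩, rfl⟩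

theorem sub_one_tmul_mem_baseIdeal {O : Type u} [CommRing O] [Algebra k O] {A : ArtAlg k}
    {F : O} {G : A.carrier ⊗[k] O} (hG : reduction O A G = F) :
    G - 1 ⊗ₜ F ∈ baseIdeal O A (maximalIdeal A.carrier) := by
  rw [← ker_reduction, RingHom.mem_ker, map_sub, hG, reduction_one_tmul, sub_self]

theorem reduction_of_sub_mem {O : Type u} [CommRing O] [Algebra k O] {A : ArtAlg k}
    {z w : A.carrier ⊗[k] O} (h : z - w ∈ baseIdeal O A (maximalIdeal A.carrier)) :
    reduction O A z = reduction O A w := by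
  rw [← ker_reduction, RingHom.mem_ker, map_sub, sub_eq_zero] at h
  exact h

/-- The change `G ↦ G - dF - hF` of the equation by a logarithmic vector field `d` and a function
`h`, both with coefficients in `J`, is realized up to terms in `𝔪 J` by the automorphism `exp (-d)`
and the unit `1 - h`. -/
theorem IsLogVector.exists_isLogAut_sub_mem [CharZero k] {A : ArtAlg k} {D : Ideal O}
    {J : Ideal A.carrier} {d : O →ₗ[k] A.carrier ⊗[k] O} (hd : IsLogVector A D J d)
    (hJ : J ≤ maximalIdeal A.carrier) {F : O} {G h : A.carrier ⊗[k] O}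
    (hG : reduction O A G = F) (hh : h ∈ baseIdeal O A J) :
    ∃ β : A.carrier ⊗[k] O ≃ₐ[A.carrier] A.carrier ⊗[k] O, IsLogAut A D β ∧
      ∃ u, reduction O A u = 1 ∧
        u * β G - (G - d F - h * (1 ⊗ₜ F)) ∈ baseIdeal O A (maximalIdeal A.carrier * J) := by
  obtain ⟨β, hβ, -, hβd⟩ := hd.neg.exists_isLogAut hJ
  refine ⟨β, hβ, 1 - h, ?_, ?_⟩
  · have : (1 - h) - 1 ∈ baseIdeal O A (maximalIdeal A.carrier) := by
      rw [sub_sub_cancel_left]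
      exact neg_mem (Ideal.map_mono hJ hh)
    rw [reduction_of_sub_mem this, map_one]
  · have h1 := Ideal.map_mono (f := algebraMap A.carrier (A.carrier ⊗[k] O))
      (Ideal.mul_mono hJ (le_refl J)) (hβd G)
    have h2 := hd.neg.extend_mem_baseIdeal (sub_one_tmul_mem_baseIdeal hG)
    rw [map_sub, LinearMap.liftBaseChange_tmul, one_smul, LinearMap.neg_apply] at h2
    have h3 := mul_mem_baseIdeal
      (sub_one_tmul_mem_baseIdeal ((hβ.reduction_apply G).trans hG)) hh
    have := sub_mem (add_mem h1 h2) h3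
    convert this using 1
    ring

/-- If `f₁, …, fᵣ` generate `I` modulo `I^ea`, then every perturbation in `I` with coefficients in
`J` is a combination of the `fᵢ` and of a perturbation `dF + hF` as above. -/
theorem exists_decomposition {A : ArtAlg k} {D : Ideal O} {F : O} {I : Ideal O} {r : ℕ}
    {f : Fin r → O}
    (hI : ∀ g ∈ I, ∃ c : Fin r → k, g - ∑ i, c i • f i ∈ relEquianalyticIdeal k D F)
    {J : Ideal A.carrier} {z : A.carrier ⊗[k] O} (hz : z ∈ baseIdeal O A J)
    (hz' : z ∈ extIdeal A I) :
    ∃ c : Fin r → A.carrier, (∀ i, c i ∈ J) ∧ ∃ d, IsLogVector A D J d ∧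
      ∃ h ∈ baseIdeal O A J, z = ∑ i, c i ⊗ₜ f i + d F + h * (1 ⊗ₜ F) := by
  refine baseIdeal_inf_extIdeal_induction (p := fun z => ∃ c : Fin r → A.carrier,
    (∀ i, c i ∈ J) ∧ ∃ d, IsLogVector A D J d ∧
      ∃ h ∈ baseIdeal O A J, z = ∑ i, c i ⊗ₜ f i + d F + h * (1 ⊗ₜ F)) ?_ ?_ ?_ hz hz'
  · exact ⟨0, fun _ => zero_mem _, 0, IsLogVector.zero A D J, 0, zero_mem _, by simp⟩
  · rintro x y ⟨c, hc, d, hd, h, hh, hx⟩ ⟨c', hc', d', hd', h', hh', hy⟩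
    refine ⟨c + c', fun i => add_mem (hc i) (hc' i), d + d', hd.add hd', h + h',
      add_mem hh hh', ?_⟩
    simp only [hx, hy, Pi.add_apply, add_tmul, Finset.sum_add_distrib, LinearMap.add_apply]
    ring
  · intro a ha g hg
    obtain ⟨c, hc⟩ := hI g hg
    obtain ⟨δ, hδ, h, hh⟩ := mem_relEquianalyticIdeal.mp hc
    refine ⟨fun i => c i • a, fun i => ?_, (TensorProduct.mk k A.carrier O a) ∘ₗ δ.toLinearMap,
      ⟨fun g h => ?_, fun g => tmul_mem_baseIdeal ha _, fun g hg => tmul_mem_extIdeal a (hδ.1 g hg),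
        fun g hg => tmul_mem_extIdeal a (hδ.2 g hg)⟩, a ⊗ₜ h, tmul_mem_baseIdeal ha h, ?_⟩
    · change c i • a ∈ J
      rw [Algebra.smul_def]
      exact J.mul_mem_left _ ha
    · change a ⊗ₜ δ (g * h) = (1 ⊗ₜ g) * (a ⊗ₜ δ h) + (1 ⊗ₜ h) * (a ⊗ₜ δ g)
      rw [δ.leibniz, Algebra.TensorProduct.tmul_mul_tmul, Algebra.TensorProduct.tmul_mul_tmul,
        one_mul, tmul_add, smul_eq_mul, smul_eq_mul]
    · change _ = _ + a ⊗ₜ δ F + _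
      have h1 : g = ∑ i, c i • f i + (δ F + h * F) := by rw [← hh, add_sub_cancel]
      conv_lhs => rw [h1]
      rw [Algebra.TensorProduct.tmul_mul_tmul, mul_one, tmul_add, tmul_add, tmul_sum, add_assoc]
      congr 1
      exact Finset.sum_congr rfl fun i _ => (smul_tmul _ _ _).symm

end moving

section classes

open CategoryTheory

variable {k : Type u} [Field k] {O : Type u} [CommRing O] [IsLocalRing O] [Algebra k O]
  {D : Ideal O} (hSD : IsFormalSurfacePair k D) {F : O} (hF : F ∉ D) {m : ℕ}

/-! ### Isomorphism classes of embedded deformations -/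

/-- The class of the embedded deformation `V(G)`, for `G` in the ideal of `mP`. -/
def embeddedClass (A : ArtAlg k) (G : A.carrier ⊗[k] O) (hG : reduction O A G = F)
    (hGm : G ∈ extIdeal A (multIdeal D (maximalIdeal O) m)) :
    (logDef k (Ideal.span {F}) D m).obj A :=
  ⟨⟦embeddedDeformation hSD hF A G hG⟧, _,
    (embeddedDeformation_containsMult_iff hSD hF hG m).mpr hGm, rfl⟩

theorem embeddedClass_congr {A : ArtAlg k} {G G' : A.carrier ⊗[k] O} (h : G = G')
    (hG : reduction O A G = F) (hG' : reduction O A G' = F)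
    (hGm : G ∈ extIdeal A (multIdeal D (maximalIdeal O) m))
    (hGm' : G' ∈ extIdeal A (multIdeal D (maximalIdeal O) m)) :
    embeddedClass hSD hF A G hG hGm = embeddedClass hSD hF A G' hG' hGm' := by
  subst h
  rfl

theorem embeddedClass_eq_iff {A : ArtAlg k} {G G' : A.carrier ⊗[k] O}
    (hG : reduction O A G = F) (hG' : reduction O A G' = F)
    (hGm : G ∈ extIdeal A (multIdeal D (maximalIdeal O) m))
    (hGm' : G' ∈ extIdeal A (multIdeal D (maximalIdeal O) m)) :
    embeddedClass hSD hF A G hG hGm = embeddedClass hSD hF A G' hG' hGm' ↔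
      ∃ β : A.carrier ⊗[k] O ≃ₐ[A.carrier] A.carrier ⊗[k] O, IsLogAut A D β ∧
        ∃ u, reduction O A u = 1 ∧ β G = u * G' := by
  rw [← embeddedDeformation_equivalent_iff hSD hF hG hG']
  exact Subtype.ext_iff.trans
    (Quotient.eq (r := LogDeformation.setoid (Ideal.span {F}) D A.carrier))

theorem exists_embeddedClass_eq {A : ArtAlg k} (η : (logDef k (Ideal.span {F}) D m).obj A) :
    ∃ G hG hGm, embeddedClass hSD hF A G hG hGm = η := by
  obtain ⟨_, X, hX, rfl⟩ := η
  obtain ⟨G, hG, h⟩ := X.exists_equivalent_embeddedDeformation hSD hF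
  exact ⟨G, hG, (embeddedDeformation_containsMult_iff hSD hF hG m).mp (hX.of_equivalent h.symm),
    Subtype.ext (Quotient.sound (s := LogDeformation.setoid (Ideal.span {F}) D A.carrier) h)⟩

theorem mapBase_mem_extIdeal {O : Type u} [CommRing O] [Algebra k O] {A B : ArtAlg k} (φ : A ⟶ B)
    {I : Ideal O} {z : A.carrier ⊗[k] O} (hz : z ∈ extIdeal A I) :
    mapBase O φ z ∈ extIdeal B I :=
  rTensor_mem_extIdeal φ.1.toLinearMap hz

theorem map_embeddedClass {A B : ArtAlg k} (φ : A ⟶ B) {G : A.carrier ⊗[k] O}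
    (hG : reduction O A G = F) (hGm : G ∈ extIdeal A (multIdeal D (maximalIdeal O) m)) :
    (logDef k (Ideal.span {F}) D m).map φ (embeddedClass hSD hF A G hG hGm) =
      embeddedClass hSD hF B (mapBase O φ G) ((reduction_mapBase φ G).trans hG)
        (mapBase_mem_extIdeal φ hGm) :=
  Subtype.ext (Quotient.sound (s := LogDeformation.setoid (Ideal.span {F}) D B.carrier)
    (embeddedDeformation_pullback hSD hF φ hG))

/-- The equations `G` and `u β(G)` define isomorphic deformations. -/
theorem IsLogAut.embeddedClass_mul_eq {A : ArtAlg k}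
    {β : A.carrier ⊗[k] O ≃ₐ[A.carrier] A.carrier ⊗[k] O} (hβ : IsLogAut A D β)
    {u : A.carrier ⊗[k] O} (hu : reduction O A u = 1) {G : A.carrier ⊗[k] O}
    (hG : reduction O A G = F) (hGm : G ∈ extIdeal A (multIdeal D (maximalIdeal O) m)) :
    ∃ hG' hGm', embeddedClass hSD hF A (u * β G) hG' hGm' = embeddedClass hSD hF A G hG hGm := by
  have hG' : reduction O A (u * β G) = F := by rw [map_mul, hu, hβ.reduction_apply, hG, one_mul]
  have hGm' : u * β G ∈ extIdeal A (multIdeal D (maximalIdeal O) m) := by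
    have := Ideal.mem_map_of_mem β hGm
    rw [hβ.map_multIdeal] at this
    exact Ideal.mul_mem_left _ u this
  refine ⟨hG', hGm', ((embeddedClass_eq_iff hSD hF hG hG' hGm hGm').mpr ?_).symm⟩
  obtain ⟨v, hv⟩ := (isUnit_of_reduction_eq_one hu).exists_left_inv
  refine ⟨β, hβ, v, ?_, by rw [← mul_assoc, hv, one_mul]⟩
  have := congrArg (reduction O A) hv
  rwa [map_mul, hu, mul_one, map_one] at this

/-- A perturbation of the family with coefficients in `J` can be absorbed, up to terms in `𝔪 J`,
into the parameters of the family. -/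
theorem exists_embeddedClass_eq_of_sub_mem [CharZero k] {A : ArtAlg k} {r : ℕ} {f : Fin r → O}
    {I : Ideal O} (hI : ∀ g ∈ I, ∃ c : Fin r → k, g - ∑ i, c i • f i ∈ relEquianalyticIdeal k D F)
    {J : Ideal A.carrier} (hJ : J ≤ maximalIdeal A.carrier) {G z : A.carrier ⊗[k] O}
    (hG : reduction O A G = F) (hGm : G ∈ extIdeal A (multIdeal D (maximalIdeal O) m))
    (hz : G - z ∈ baseIdeal O A J) (hzI : G - z ∈ extIdeal A I) :
    ∃ c : Fin r → A.carrier, (∀ i, c i ∈ J) ∧ ∃ G' hG' hGm',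
      embeddedClass hSD hF A G' hG' hGm' = embeddedClass hSD hF A G hG hGm ∧
        G' - (z + ∑ i, c i ⊗ₜ f i) ∈ baseIdeal O A (maximalIdeal A.carrier * J) := by
  obtain ⟨c, hc, d, hd, h, hh, hw⟩ := exists_decomposition hI hz hzI
  obtain ⟨β, hβ, u, hu, hu'⟩ := hd.exists_isLogAut_sub_mem hJ hG hh
  obtain ⟨hG', hGm', h'⟩ := hβ.embeddedClass_mul_eq hSD hF hu hG hGm
  refine ⟨c, hc, _, hG', hGm', h', ?_⟩
  convert hu' using 2
  rw [sub_sub, eq_sub_iff_add_eq, add_assoc, ← add_assoc, add_assoc, ← add_assoc _ (d F), ← hw,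
    add_sub_cancel]

theorem family_mem_extIdeal {O : Type u} [CommRing O] [Algebra k O] {I : Ideal O} {F : O}
    (hFI : F ∈ I) {A : ArtAlg k} {r : ℕ} {f : Fin r → O} (hf : ∀ i, f i ∈ I)
    (a : Fin r → A.carrier) : 1 ⊗ₜ F + ∑ i, a i ⊗ₜ f i ∈ extIdeal A I :=
  add_mem (tmul_mem_extIdeal 1 hFI) (sum_mem fun i _ => tmul_mem_extIdeal (a i) (hf i))

/-- The class of the family `F + ∑ᵢ aᵢ fᵢ`. -/
def familyClass (hFm : F ∈ multIdeal D (maximalIdeal O) m) {r : ℕ}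
    (f : Fin r → multIdeal D (maximalIdeal O) m) (A : ArtAlg k) (a : Fin r → A.carrier)
    (ha : ∀ i, a i ∈ maximalIdeal A.carrier) : (logDef k (Ideal.span {F}) D m).obj A :=
  embeddedClass hSD hF A (1 ⊗ₜ F + ∑ i, a i ⊗ₜ (f i : O)) (reduction_add_sum A F _ a ha)
    (family_mem_extIdeal hFm (fun i => (f i).2) a)

variable {hSD hF}

theorem hom_mem_maximalIdeal {A B : ArtAlg k} (φ : A ⟶ B) {a : A.carrier}
    (ha : a ∈ maximalIdeal A.carrier) : φ.1 a ∈ maximalIdeal B.carrier :=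
  fun hu => ha (φ.2.map_nonunit a hu)

theorem map_familyClass (hFm : F ∈ multIdeal D (maximalIdeal O) m) {r : ℕ}
    {f : Fin r → multIdeal D (maximalIdeal O) m} {A B : ArtAlg k} (φ : A ⟶ B)
    {a : Fin r → A.carrier} (ha : ∀ i, a i ∈ maximalIdeal A.carrier) :
    (logDef k (Ideal.span {F}) D m).map φ (familyClass hSD hF hFm f A a ha) =
      familyClass hSD hF hFm f B (fun i => φ.1 (a i)) fun i => hom_mem_maximalIdeal φ (ha i) := by
  rw [familyClass, map_embeddedClass]
  apply embeddedClass_congr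
  rw [map_add, map_sum, mapBase_tmul, map_one]
  rfl

theorem familyClass_congr (hFm : F ∈ multIdeal D (maximalIdeal O) m) {r : ℕ}
    {f : Fin r → multIdeal D (maximalIdeal O) m} {A : ArtAlg k} {a b : Fin r → A.carrier}
    (hab : a = b) (ha : ∀ i, a i ∈ maximalIdeal A.carrier)
    (hb : ∀ i, b i ∈ maximalIdeal A.carrier) :
    familyClass hSD hF hFm f A a ha = familyClass hSD hF hFm f A b hb := by
  subst hab
  rfl

/-- The family `F + ∑ᵢ tᵢ fᵢ` is versal: a lift of one of its members to an infinitesimally larger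
base is again, up to isomorphism, a member of the family, with lifted parameters. -/
theorem exists_familyClass_eq_of_map_eq [CharZero k] (hFm : F ∈ multIdeal D (maximalIdeal O) m)
    {r : ℕ} {f : Fin r → multIdeal D (maximalIdeal O) m}
    (hI : ∀ g ∈ multIdeal D (maximalIdeal O) m,
      ∃ c : Fin r → k, g - ∑ i, c i • (f i : O) ∈ relEquianalyticIdeal k D F)
    {A B : ArtAlg k} (p : B ⟶ A) (hp : Function.Surjective p.1) {a : Fin r → A.carrier}
    (ha : ∀ i, a i ∈ maximalIdeal A.carrier) (η : (logDef k (Ideal.span {F}) D m).obj B)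
    (hη : (logDef k (Ideal.span {F}) D m).map p η = familyClass hSD hF hFm f A a ha) :
    ∃ (b : Fin r → B.carrier) (hb : ∀ i, b i ∈ maximalIdeal B.carrier), (∀ i, p.1 (b i) = a i) ∧
      familyClass hSD hF hFm f B b hb = η := by
  obtain ⟨G, hG, hGm, rfl⟩ := exists_embeddedClass_eq hSD hF η
  obtain ⟨K, hK⟩ : ∃ K : Ideal B.carrier, K = RingHom.ker p.1 := ⟨_, rfl⟩
  have hKm : K ≤ maximalIdeal B.carrier := fun x hx hu => by
    rw [hK, RingHom.mem_ker] at hx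
    exact not_isUnit_zero (hx ▸ hu.map p.1)
  suffices key : ∀ j : ℕ, ∃ (b : Fin r → B.carrier) (_ : ∀ i, b i ∈ maximalIdeal B.carrier),
      (∀ i, p.1 (b i) = a i) ∧ ∃ G' hG' hGm',
        embeddedClass hSD hF B G' hG' hGm' = embeddedClass hSD hF B G hG hGm ∧
        G' - (1 ⊗ₜ F + ∑ i, b i ⊗ₜ (f i : O)) ∈
          baseIdeal O B (maximalIdeal B.carrier ^ j * K) by
    obtain ⟨N, hN⟩ := exists_pow_maximalIdeal_eq_bot B.carrier
    obtain ⟨b, hb, hba, G', hG', hGm', h, h'⟩ := key N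
    rw [hN, Ideal.bot_mul, baseIdeal, Ideal.map_bot, Ideal.mem_bot, sub_eq_zero] at h'
    exact ⟨b, hb, hba, (embeddedClass_congr hSD hF h'.symm _ _ _ _).trans h⟩
  intro j
  induction j with
  | zero =>
    -- the isomorphism with the family over `A` is lifted to `B` and applied to `G`; the parameters
    -- are lifted arbitrarily
    rw [map_embeddedClass] at hη
    obtain ⟨β, hβ, u, hu, hβu⟩ := (embeddedClass_eq_iff hSD hF _ _ _ _).mp hη
    obtain ⟨γ, hγ, hγβ⟩ := hβ.exists_lift p hp
    have hp' : Function.Surjective (mapBase O p) := LinearMap.rTensor_surjective O hp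
    obtain ⟨w, rfl⟩ := hp' u
    rw [reduction_mapBase] at hu
    obtain ⟨v, hv⟩ := (isUnit_of_reduction_eq_one hu).exists_left_inv
    have hv1 : reduction O B v = 1 := by
      have := congrArg (reduction O B) hv
      rwa [map_mul, hu, mul_one, map_one] at this
    obtain ⟨hG', hGm', h⟩ := hγ.embeddedClass_mul_eq hSD hF hv1 hG hGm
    choose b hb using fun i => hp (a i)
    have hbm : ∀ i, b i ∈ maximalIdeal B.carrier := fun i hu => by
      have := hu.map p.1
      rw [hb] at this
      exact ha i this
    refine ⟨b, hbm, hb, _, hG', hGm', h, ?_⟩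
    rw [pow_zero, one_mul, hK]
    refine (Algebra.TensorProduct.rTensor_ker (C := O) p.1 hp).le ?_
    rw [RingHom.mem_ker]
    change mapBase O p _ = 0
    rw [map_sub, map_mul, hγβ, hβu, ← mul_assoc, ← map_mul, hv, map_one, one_mul, map_add, map_sum,
      mapBase_tmul, map_one, sub_eq_zero]
    simp only [mapBase_tmul, hb]
  | succ j ih =>
    obtain ⟨b, hb, hba, G', hG', hGm', h, h'⟩ := ih
    -- the difference, with coefficients in `J = 𝔪ʲ K`, is moved into the parameters, whose change
    -- by elements of `J ⊆ K` is invisible over `A`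
    have hJ : maximalIdeal B.carrier ^ j * K ≤ K := Ideal.mul_le_right
    obtain ⟨c, hc, G₁, hG₁, hGm₁, h₁, h₁'⟩ := exists_embeddedClass_eq_of_sub_mem hSD hF hI
      (hJ.trans hKm) hG' hGm' h' (sub_mem hGm' (family_mem_extIdeal hFm (fun i => (f i).2) b))
    refine ⟨fun i => b i + c i, fun i => add_mem (hb i) (hKm (hJ (hc i))), fun i => ?_, G₁, hG₁,
      hGm₁, h₁.trans h, ?_⟩
    · have h2 := hJ (hc i)
      rw [hK, RingHom.mem_ker] at h2
      rw [map_add, hba, h2, add_zero]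
    · simp only [add_tmul, Finset.sum_add_distrib]
      rwa [pow_succ', mul_assoc, ← add_assoc]

end classes

section tangent

open CategoryTheory

variable {k : Type u} [Field k]

/-! ### First order deformations -/

section sqZero

variable {V : Type u} [AddCommGroup V] [Module k V] [Module kᵐᵒᵖ V] [IsCentralScalar k V]
  [Module.Finite k V]

/-- The inclusion of `V` into the square-zero extension `k ⊕ V`. -/
def ArtAlg.inr (k : Type u) [Field k] {V : Type u} [AddCommGroup V] [Module k V] [Module kᵐᵒᵖ V]
    [IsCentralScalar k V] [Module.Finite k V] : V →ₗ[k] (ArtAlg.sqZero k V).carrier :=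
  TrivSqZeroExt.inrHom k V

theorem ArtAlg.exists_eq_inr {a : (ArtAlg.sqZero k V).carrier}
    (ha : a ∈ maximalIdeal (ArtAlg.sqZero k V).carrier) : ∃ v : V, a = ArtAlg.inr k v := by
  refine ⟨TrivSqZeroExt.snd (R := k) (M := V) a, TrivSqZeroExt.ext ?_ rfl⟩
  by_contra h
  exact ha (TrivSqZeroExt.isUnit_iff_isUnit_fst.mpr (isUnit_iff_ne_zero.mpr h))

theorem ArtAlg.inr_mem_maximalIdeal (v : V) :
    ArtAlg.inr k v ∈ maximalIdeal (ArtAlg.sqZero k V).carrier :=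
  fun hu => not_isUnit_zero (TrivSqZeroExt.isUnit_iff_isUnit_fst.mp hu)

theorem ArtAlg.maximalIdeal_sqZero_mul (V : Type u) [AddCommGroup V] [Module k V] [Module kᵐᵒᵖ V]
    [IsCentralScalar k V] [Module.Finite k V] :
    maximalIdeal (ArtAlg.sqZero k V).carrier * maximalIdeal (ArtAlg.sqZero k V).carrier = ⊥ := by
  refine le_bot_iff.mp (Ideal.mul_le.mpr fun a ha b hb => ?_)
  obtain ⟨v, rfl⟩ := ArtAlg.exists_eq_inr ha
  obtain ⟨w, rfl⟩ := ArtAlg.exists_eq_inr hb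
  exact TrivSqZeroExt.inr_mul_inr k v w

theorem ArtAlg.sqZeroMap_inr {W : Type u} [AddCommGroup W] [Module k W] [Module kᵐᵒᵖ W]
    [IsCentralScalar k W] [Module.Finite k W] (l : V →ₗ[k] W) (v : V) :
    (ArtAlg.sqZeroMap l).1 (ArtAlg.inr k v) = ArtAlg.inr k (l v) :=
  TrivSqZeroExt.map_inr l v

end sqZero

theorem smul_dualEps (c : k) : c • dualEps k = ArtAlg.inr k c := by
  have : dualEps k = ArtAlg.inr k 1 := rfl
  rw [this, ← map_smul, smul_eq_mul, mul_one]

section contract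

variable {O : Type u} [CommRing O] [Algebra k O] {A : ArtAlg k}

/-- The map `A ⊗ O → O` induced by a linear functional on `A`. -/
def contract (O : Type u) [CommRing O] [Algebra k O] (l : A.carrier →ₗ[k] k) :
    A.carrier ⊗[k] O →ₗ[k] O :=
  (TensorProduct.lid k O).toLinearMap ∘ₗ l.rTensor O

theorem contract_tmul (l : A.carrier →ₗ[k] k) (a : A.carrier) (g : O) :
    contract O l (a ⊗ₜ g) = l a • g :=
  rfl

theorem contract_one_tmul_mul (l : A.carrier →ₗ[k] k) (g : O) (z : A.carrier ⊗[k] O) :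
    contract O l ((1 ⊗ₜ g) * z) = g * contract O l z := by
  induction z with
  | zero => simp
  | add x y hx hy => rw [mul_add, map_add, hx, hy, map_add, mul_add]
  | tmul a h =>
    rw [Algebra.TensorProduct.tmul_mul_tmul, one_mul, contract_tmul, contract_tmul,
      mul_smul_comm]

theorem contract_mem (l : A.carrier →ₗ[k] k) {I : Ideal O} {z : A.carrier ⊗[k] O}
    (hz : z ∈ extIdeal A I) : contract O l z ∈ I :=
  extIdeal_induction (p := fun z => contract O l z ∈ I) (by rw [map_zero]; exact zero_mem _)
    (fun x y hx hy => by rw [map_add]; exact add_mem hx hy)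
    (fun a g hg => by
      rw [contract_tmul, Algebra.smul_def]
      exact I.mul_mem_left _ hg) hz

end contract

variable {O : Type u} [CommRing O] [IsLocalRing O] [Algebra k O]
  {D : Ideal O} {hSD : IsFormalSurfacePair k D} {F : O} {hF : F ∉ D} {m : ℕ}

/-- Isomorphic first order deformations differ by an element of `I^ea`: to first order an
automorphism is given by a derivation, and a unit by a function. -/
theorem contract_sub_mem_of_embeddedClass_eq {A : ArtAlg k}
    (hA : maximalIdeal A.carrier * maximalIdeal A.carrier = ⊥) (l : A.carrier →ₗ[k] k)
    {G G' : A.carrier ⊗[k] O} {hG : reduction O A G = F} {hG' : reduction O A G' = F}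
    {hGm : G ∈ extIdeal A (multIdeal D (maximalIdeal O) m)}
    {hGm' : G' ∈ extIdeal A (multIdeal D (maximalIdeal O) m)}
    (h : embeddedClass hSD hF A G hG hGm = embeddedClass hSD hF A G' hG' hGm') :
    contract O l (G - G') ∈ relEquianalyticIdeal k D F := by
  obtain ⟨β, hβ, u, hu, h1⟩ := (embeddedClass_eq_iff hSD hF hG hG' hGm hGm').mp h
  have hbot : ∀ {z}, z ∈ baseIdeal O A (maximalIdeal A.carrier * maximalIdeal A.carrier) →
      z = 0 := fun {z} hz => by
    rwa [hA, baseIdeal, Ideal.map_bot, Ideal.mem_bot] at hz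
  obtain ⟨d, hd, hβd⟩ := hβ.exists_isLogVector le_rfl fun z => by
    rw [← ker_reduction, RingHom.mem_ker, map_sub, hβ.reduction_apply, sub_self]
  have h2 := hbot (hβd G)
  have h3 := hbot (hd.extend_mem_baseIdeal (sub_one_tmul_mem_baseIdeal hG))
  rw [map_sub, LinearMap.liftBaseChange_tmul, one_smul] at h3
  have hu1 : u - 1 ∈ baseIdeal O A (maximalIdeal A.carrier) := by
    rw [← ker_reduction, RingHom.mem_ker, map_sub, hu, map_one, sub_self]
  have h4 := hbot (mul_mem_baseIdeal hu1 (sub_one_tmul_mem_baseIdeal hG'))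
  have h5 : G - G' = (1 ⊗ₜ F) * (u - 1) - d F := by
    linear_combination -h2 - h3 + h1 + h4
  let δ : Derivation k O O := Derivation.mk' (contract O l ∘ₗ d) fun g h => by
    rw [LinearMap.comp_apply, hd.leibniz, map_add, contract_one_tmul_mul, contract_one_tmul_mul]
    rfl
  have hδ : δ ∈ logDerivations k D (maximalIdeal O) :=
    ⟨fun g hg => contract_mem l (hd.mem_D g hg), fun g hg => contract_mem l (hd.mem_P g hg)⟩
  refine mem_relEquianalyticIdeal.mpr ⟨-δ, neg_mem hδ, contract O l (u - 1), ?_⟩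
  rw [h5, map_sub, contract_one_tmul_mul]
  change _ = -contract O l (d F) + _
  ring

/-- If `𝔪_A² = 0`, a family depends only on the classes of the `fᵢ` modulo `I^ea`. -/
theorem familyClass_eq_of_sub_mem [CharZero k] (hFm : F ∈ multIdeal D (maximalIdeal O) m)
    {A : ArtAlg k} (hA : maximalIdeal A.carrier * maximalIdeal A.carrier = ⊥) {r : ℕ}
    {f g : Fin r → multIdeal D (maximalIdeal O) m}
    (h : ∀ i, (f i : O) - g i ∈ relEquianalyticIdeal k D F) {a : Fin r → A.carrier}
    (ha : ∀ i, a i ∈ maximalIdeal A.carrier) :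
    familyClass hSD hF hFm f A a ha = familyClass hSD hF hFm g A a ha := by
  have h1 : (1 ⊗ₜ F + ∑ i, a i ⊗ₜ (f i : O)) - (1 ⊗ₜ F + ∑ i, a i ⊗ₜ (g i : O)) =
      ∑ i, a i ⊗ₜ[k] ((f i : O) - g i) := by
    rw [add_sub_add_left_eq_sub, ← Finset.sum_sub_distrib]
    simp only [tmul_sub]
  -- perturbations in `I^ea` are absorbed by isomorphisms alone, without any parameters
  obtain ⟨c, -, G', hG', hGm', h2, h3⟩ := exists_embeddedClass_eq_of_sub_mem hSD hF
    (f := (Fin.elim0 : Fin 0 → O)) (I := relEquianalyticIdeal k D F)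
    (fun g hg => ⟨Fin.elim0, by simpa using hg⟩) le_rfl (reduction_add_sum A F _ a ha)
    (family_mem_extIdeal hFm (fun i => (f i).2) a)
    (z := 1 ⊗ₜ F + ∑ i, a i ⊗ₜ (g i : O))
    (by rw [h1]; exact sum_mem fun i _ => tmul_mem_baseIdeal (ha i) _)
    (by rw [h1]; exact sum_mem fun i _ => tmul_mem_extIdeal _ (h i))
  rw [hA, baseIdeal, Ideal.map_bot, Ideal.mem_bot, sub_eq_zero, Fin.sum_univ_zero,
    add_zero] at h3
  exact h2.symm.trans (embeddedClass_congr hSD hF h3 _ _ _ _)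

/-- If `a₁, …, aᵣ` span `𝔪_A` over `k`, every deformation over `A` is of the form `F + ∑ᵢ aᵢ fᵢ`. -/
theorem exists_familyClass_eq (hFm : F ∈ multIdeal D (maximalIdeal O) m) {A : ArtAlg k} {r : ℕ}
    {a : Fin r → A.carrier} (ha : ∀ i, a i ∈ maximalIdeal A.carrier)
    (hspan : ∀ x ∈ maximalIdeal A.carrier, ∃ c : Fin r → k, x = ∑ i, c i • a i)
    (η : (logDef k (Ideal.span {F}) D m).obj A) :
    ∃ f, familyClass hSD hF hFm f A a ha = η := by
  obtain ⟨G, hG, hGm, rfl⟩ := exists_embeddedClass_eq hSD hF η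
  suffices h : ∃ f : Fin r → multIdeal D (maximalIdeal O) m,
      G - 1 ⊗ₜ F = ∑ i, a i ⊗ₜ (f i : O) by
    obtain ⟨f, hf⟩ := h
    exact ⟨f, embeddedClass_congr hSD hF (by rw [← hf, add_sub_cancel]) _ _ _ _⟩
  refine baseIdeal_inf_extIdeal_induction (p := fun z =>
    ∃ f : Fin r → multIdeal D (maximalIdeal O) m, z = ∑ i, a i ⊗ₜ (f i : O)) ?_ ?_ ?_
    (sub_one_tmul_mem_baseIdeal hG) (sub_mem hGm (tmul_mem_extIdeal 1 hFm))
  · exact ⟨0, by simp⟩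
  · rintro x y ⟨f, rfl⟩ ⟨g, rfl⟩
    exact ⟨f + g, by simp [tmul_add, Finset.sum_add_distrib]⟩
  · intro x hx g hg
    obtain ⟨c, rfl⟩ := hspan x hx
    refine ⟨fun i => c i • ⟨g, hg⟩, ?_⟩
    rw [sum_tmul]
    exact Finset.sum_congr rfl fun i _ => smul_tmul _ _ _

/-- The class of the first order deformation `F + ε g`. -/
def firstOrderClass (hSD : IsFormalSurfacePair k D) (hF : F ∉ D)
    (hFm : F ∈ multIdeal D (maximalIdeal O) m) (g : multIdeal D (maximalIdeal O) m) :
    (logDef k (Ideal.span {F}) D m).obj (ArtAlg.dual k) :=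
  familyClass hSD hF hFm (fun _ : Fin 1 => g) (ArtAlg.dual k) (fun _ => dualEps k)
    fun _ => dualEps_mem

theorem LogTangent.mk_eq_mk_iff {g g' : multIdeal D (maximalIdeal O) m} :
    (LogTangent.mk g : LogTangent k D F m) = LogTangent.mk g' ↔
      (g : O) - g' ∈ relEquianalyticIdeal k D F :=
  Submodule.Quotient.eq _

theorem firstOrderClass_eq_iff [CharZero k] (hFm : F ∈ multIdeal D (maximalIdeal O) m)
    {g g' : multIdeal D (maximalIdeal O) m} :
    firstOrderClass hSD hF hFm g = firstOrderClass hSD hF hFm g' ↔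
      (LogTangent.mk g : LogTangent k D F m) = LogTangent.mk g' := by
  rw [LogTangent.mk_eq_mk_iff]
  constructor
  · intro h
    have := contract_sub_mem_of_embeddedClass_eq (ArtAlg.maximalIdeal_sqZero_mul k)
      (TrivSqZeroExt.sndHom k k : TrivSqZeroExt k k →ₗ[k] k)
      (hGm := family_mem_extIdeal hFm (fun _ => g.2) _)
      (hGm' := family_mem_extIdeal hFm (fun _ => g'.2) _) h
    rw [add_sub_add_left_eq_sub, Fin.sum_univ_one, Fin.sum_univ_one, ← tmul_sub] at this
    change (1 : k) • ((g : O) - g') ∈ _ at this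
    rwa [one_smul] at this
  · exact fun h => familyClass_eq_of_sub_mem hFm (ArtAlg.maximalIdeal_sqZero_mul k) (fun _ => h) _

theorem exists_firstOrderClass_eq (hFm : F ∈ multIdeal D (maximalIdeal O) m)
    (η : (logDef k (Ideal.span {F}) D m).obj (ArtAlg.dual k)) :
    ∃ g, firstOrderClass hSD hF hFm g = η := by
  obtain ⟨f, hf⟩ := exists_familyClass_eq (hSD := hSD) (hF := hF) hFm
    (a := fun _ : Fin 1 => dualEps k) (fun _ => dualEps_mem) (fun x hx => by
      obtain ⟨c, rfl⟩ := ArtAlg.exists_eq_inr hx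
      refine ⟨fun _ => c, ?_⟩
      rw [Fin.sum_univ_one, smul_dualEps]) η
  have : f = fun _ => f 0 := funext fun i => by rw [Subsingleton.elim i 0]
  exact ⟨f 0, by rw [firstOrderClass, ← this, hf]⟩

theorem familyClass_dual_eq (hFm : F ∈ multIdeal D (maximalIdeal O) m) {r : ℕ}
    (f : Fin r → multIdeal D (maximalIdeal O) m) {a : Fin r → (ArtAlg.dual k).carrier}
    (ha : ∀ i, a i ∈ maximalIdeal (ArtAlg.dual k).carrier) {c : Fin r → k}
    (hc : ∀ i, a i = ArtAlg.inr k (c i)) :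
    familyClass hSD hF hFm f (ArtAlg.dual k) a ha =
      firstOrderClass hSD hF hFm (∑ i, c i • f i) := by
  refine embeddedClass_congr hSD hF ?_ _ _ _
    (family_mem_extIdeal hFm (fun _ => (∑ i, c i • f i).2) _)
  rw [Fin.sum_univ_one, AddSubmonoidClass.coe_finsetSum, tmul_sum]
  congr 1
  refine Finset.sum_congr rfl fun i _ => ?_
  change _ = dualEps k ⊗ₜ (c i • (f i : O))
  rw [← smul_tmul]
  rw [hc, smul_dualEps]

theorem map_sqZeroMap_familyClass (hFm : F ∈ multIdeal D (maximalIdeal O) m) {r : ℕ}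
    (f : Fin r → multIdeal D (maximalIdeal O) m) {V : Type u} [AddCommGroup V] [Module k V]
    [Module kᵐᵒᵖ V] [IsCentralScalar k V] [Module.Finite k V] (v : Fin r → V) (l : V →ₗ[k] k)
    (hv : ∀ i, ArtAlg.inr k (v i) ∈ maximalIdeal (ArtAlg.sqZero k V).carrier) :
    (logDef k (Ideal.span {F}) D m).map (ArtAlg.sqZeroMap l)
        (familyClass hSD hF hFm f (ArtAlg.sqZero k V)
          (fun i => ArtAlg.inr k (v i)) hv) =
      firstOrderClass hSD hF hFm (∑ i, l (v i) • f i) := by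
  rw [map_familyClass]
  exact familyClass_dual_eq hFm f _ fun i => ArtAlg.sqZeroMap_inr l (v i)

/-- The identification of `I_{mP} / I^ea` with the tangent space, `g ↦ [V(F + ε g)]`. -/
def tangentClass (hSD : IsFormalSurfacePair k D) (hF : F ∉ D)
    (hFm : F ∈ multIdeal D (maximalIdeal O) m) (t : LogTangent k D F m) :
    (logDef k (Ideal.span {F}) D m).obj (ArtAlg.dual k) :=
  firstOrderClass hSD hF hFm (Function.surjInv (Submodule.Quotient.mk_surjective _) t)

theorem tangentClass_mk [CharZero k] (hFm : F ∈ multIdeal D (maximalIdeal O) m)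
    (g : multIdeal D (maximalIdeal O) m) :
    tangentClass hSD hF hFm (LogTangent.mk g) = firstOrderClass hSD hF hFm g :=
  (firstOrderClass_eq_iff hFm).mpr
    (Function.surjInv_eq (Submodule.Quotient.mk_surjective _) (LogTangent.mk g))

theorem tangentClass_bijective [CharZero k] (hFm : F ∈ multIdeal D (maximalIdeal O) m) :
    Function.Bijective (tangentClass hSD hF hFm) := by
  constructor
  · intro s t h
    obtain ⟨g, rfl⟩ := Submodule.Quotient.mk_surjective _ s
    obtain ⟨g', rfl⟩ := Submodule.Quotient.mk_surjective _ t
    exact (firstOrderClass_eq_iff (hSD := hSD) (hF := hF) hFm).mp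
      ((tangentClass_mk hFm g).symm.trans (h.trans (tangentClass_mk hFm g')))
  · intro η
    obtain ⟨g, rfl⟩ := exists_firstOrderClass_eq (hSD := hSD) (hF := hF) hFm η
    exact ⟨_, tangentClass_mk hFm g⟩

theorem isTangentSpace_tangentClass [CharZero k] (hFm : F ∈ multIdeal D (maximalIdeal O) m) :
    IsTangentSpace (logDef k (Ideal.span {F}) D m) (LogTangent k D F m)
      (tangentClass hSD hF hFm) := by
  have hv : ∀ i, ArtAlg.inr k ((![(1, 0), (0, 1)] : Fin 2 → k × k) i) ∈
      maximalIdeal (ArtAlg.sqZero k (k × k)).carrier :=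
    fun i => ArtAlg.inr_mem_maximalIdeal _
  have hmap : ∀ (f : Fin 2 → multIdeal D (maximalIdeal O) m) (l : k × k →ₗ[k] k),
      (logDef k (Ideal.span {F}) D m).map (ArtAlg.sqZeroMap l)
        (familyClass hSD hF hFm f (ArtAlg.sqZero k (k × k)) _ hv) =
      tangentClass hSD hF hFm (LogTangent.mk (l (1, 0) • f 0 + l (0, 1) • f 1)) := fun f l => by
    rw [map_sqZeroMap_familyClass, tangentClass_mk, Fin.sum_univ_two]
    rfl
  have hex : ∀ z : (logDef k (Ideal.span {F}) D m).obj (ArtAlg.sqZero k (k × k)),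
      ∃ f, familyClass hSD hF hFm f (ArtAlg.sqZero k (k × k)) _ hv = z :=
    exists_familyClass_eq hFm hv fun x hx => by
      obtain ⟨⟨c, c'⟩, rfl⟩ := ArtAlg.exists_eq_inr hx
      refine ⟨![c, c'], ?_⟩
      rw [Fin.sum_univ_two]
      change _ = c • ArtAlg.inr k (1, 0) + c' • ArtAlg.inr k (0, 1)
      rw [← map_smul, ← map_smul, ← map_add]
      simp
  have hfst : ∀ f : Fin 2 → multIdeal D (maximalIdeal O) m,
      (logDef k (Ideal.span {F}) D m).map (ArtAlg.sqZeroMap (LinearMap.fst k k k))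
        (familyClass hSD hF hFm f (ArtAlg.sqZero k (k × k)) _ hv) =
      tangentClass hSD hF hFm (LogTangent.mk (f 0)) := fun f => by
    rw [hmap]
    simp
  have hsnd : ∀ f : Fin 2 → multIdeal D (maximalIdeal O) m,
      (logDef k (Ideal.span {F}) D m).map (ArtAlg.sqZeroMap (LinearMap.snd k k k))
        (familyClass hSD hF hFm f (ArtAlg.sqZero k (k × k)) _ hv) =
      tangentClass hSD hF hFm (LogTangent.mk (f 1)) := fun f => by
    rw [hmap]
    simp
  have hinj := (tangentClass_bijective (hSD := hSD) (hF := hF) hFm).injective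
  refine ⟨tangentClass_bijective hFm, fun s t => ?_, fun s t z hs ht => ?_, fun c t => ?_⟩
  · obtain ⟨g, rfl⟩ := Submodule.Quotient.mk_surjective _ s
    obtain ⟨g', rfl⟩ := Submodule.Quotient.mk_surjective _ t
    refine ⟨familyClass hSD hF hFm ![g, g'] (ArtAlg.sqZero k (k × k)) _ hv,
      ⟨hfst ![g, g'], hsnd ![g, g']⟩, ?_⟩
    rintro z ⟨hs, ht⟩
    obtain ⟨f, rfl⟩ := hex z
    have h1 : (f 0 : O) - g ∈ relEquianalyticIdeal k D F :=
      LogTangent.mk_eq_mk_iff.mp (hinj ((hfst f).symm.trans hs))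
    have h2 : (f 1 : O) - g' ∈ relEquianalyticIdeal k D F :=
      LogTangent.mk_eq_mk_iff.mp (hinj ((hsnd f).symm.trans ht))
    exact familyClass_eq_of_sub_mem hFm (ArtAlg.maximalIdeal_sqZero_mul _)
      (Fin.forall_fin_two.mpr ⟨h1, h2⟩) _
  · obtain ⟨f, rfl⟩ := hex z
    rw [hmap, ← hinj ((hfst f).symm.trans hs), ← hinj ((hsnd f).symm.trans ht)]
    simp only [LinearMap.add_apply, LinearMap.fst_apply, LinearMap.snd_apply, add_zero, zero_add,
      one_smul]
    rfl
  · obtain ⟨g, rfl⟩ := Submodule.Quotient.mk_surjective _ t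
    have h1 : tangentClass hSD hF hFm (Submodule.Quotient.mk g) = firstOrderClass hSD hF hFm g :=
      tangentClass_mk hFm g
    rw [h1]
    refine (tangentClass_mk hFm (c • g)).trans ?_
    refine Eq.trans ?_ (map_sqZeroMap_familyClass hFm (fun _ : Fin 1 => g) (fun _ => 1) _ _).symm
    rw [Fin.sum_univ_one]
    simp

end tangent

section formal

open CategoryTheory

variable {k : Type u} [Field k] {O : Type u} [CommRing O] [IsLocalRing O] [Algebra k O]
  {D : Ideal O} {F : O} {m : ℕ}

/-! ### The formal family -/

/-- The formal family `F + ∑ᵢ tᵢ fᵢ` over `k[[t₁, …, tᵣ]]`. -/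
def formalFamily (hSD : IsFormalSurfacePair k D) (hF : F ∉ D)
    (hFm : F ∈ multIdeal D (maximalIdeal O) m) {r : ℕ}
    (f : Fin r → multIdeal D (maximalIdeal O) m) :
    FormalElement (logDef k (Ideal.span {F}) D m) (CompAlg.powerSeries k r) :=
  ⟨fun n => familyClass hSD hF hFm f ((CompAlg.powerSeries k r).trunc n) (truncX k n)
    (truncX_mem n), fun n => map_familyClass hFm _ (truncX_mem (n + 1))⟩

theorem X_mem_maximalIdeal {r : ℕ} (i : Fin r) :
    (MvPowerSeries.X i : MvPowerSeries (Fin r) k) ∈ maximalIdeal (MvPowerSeries (Fin r) k) := by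
  rw [maximalIdeal_mvPowerSeries]
  exact Ideal.subset_span ⟨i, rfl⟩

theorem LocalAlgHom.apply_mem_maximalIdeal {R A : Type*} [CommRing R] [CommRing A] [Algebra k R]
    [Algebra k A] [IsLocalRing R] [IsLocalRing A] (φ : LocalAlgHom k R A) {a : R}
    (ha : a ∈ maximalIdeal R) : φ.1 a ∈ maximalIdeal A :=
  fun hu => ha (φ.2.map_nonunit a hu)

variable {hSD : IsFormalSurfacePair k D} {hF : F ∉ D}

theorem formalFamily_toMap (hFm : F ∈ multIdeal D (maximalIdeal O) m) {r : ℕ}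
    {f : Fin r → multIdeal D (maximalIdeal O) m} {A : ArtAlg k}
    (φ : LocalAlgHom k (MvPowerSeries (Fin r) k) A.carrier) :
    (formalFamily hSD hF hFm f).toMap A φ =
      familyClass hSD hF hFm f A (fun i => φ.1 (MvPowerSeries.X i))
        fun i => φ.apply_mem_maximalIdeal (X_mem_maximalIdeal i) :=
  map_familyClass hFm _ (truncX_mem _)

theorem ArtAlg.localAlgHom_ext {r : ℕ} {A : ArtAlg k}
    {φ ψ : LocalAlgHom k (MvPowerSeries (Fin r) k) A.carrier}
    (h : ∀ i, φ.1 (MvPowerSeries.X i) = ψ.1 (MvPowerSeries.X i)) : φ = ψ := by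
  obtain ⟨N, hN⟩ := exists_pow_maximalIdeal_eq_bot A.carrier
  have := isHausdorff_of_pow_eq_bot hN
  exact Subtype.ext (mvPowerSeries_algHom_ext (maximalIdeal A.carrier)
    (fun i => φ.apply_mem_maximalIdeal (X_mem_maximalIdeal i)) h)

theorem ArtAlg.exists_localAlgHom {r : ℕ} {A : ArtAlg k} {a : Fin r → A.carrier}
    (ha : ∀ i, a i ∈ maximalIdeal A.carrier) :
    ∃ φ : LocalAlgHom k (MvPowerSeries (Fin r) k) A.carrier,
      ∀ i, φ.1 (MvPowerSeries.X i) = a i := by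
  obtain ⟨N, hN⟩ := exists_pow_maximalIdeal_eq_bot A.carrier
  obtain ⟨φ, hφ⟩ := exists_mvPowerSeries_algHom_of_isNilpotent (k := k) a fun i =>
    ⟨N, by simpa [hN] using Ideal.pow_mem_pow (ha i) N⟩
  refine ⟨⟨φ, ⟨fun x hx => ?_⟩⟩, hφ⟩
  by_contra h
  have h1 := map_maximalIdeal_mvPowerSeries_le (maximalIdeal A.carrier) φ
    (fun i => (hφ i).symm ▸ ha i)
  exact h1 (Ideal.mem_map_of_mem φ h) hx

theorem isVersal_formalFamily [CharZero k] (hFm : F ∈ multIdeal D (maximalIdeal O) m) {r : ℕ}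
    {f : Fin r → multIdeal D (maximalIdeal O) m}
    (hI : ∀ g ∈ multIdeal D (maximalIdeal O) m,
      ∃ c : Fin r → k, g - ∑ i, c i • (f i : O) ∈ relEquianalyticIdeal k D F) :
    (formalFamily hSD hF hFm f).IsVersal := by
  intro B A p hp φ η hη
  obtain ⟨b, hb, hba, hbη⟩ := exists_familyClass_eq_of_map_eq hFm hI p hp _ η
    (hη.trans (formalFamily_toMap hFm φ))
  obtain ⟨ψ, hψ⟩ := ArtAlg.exists_localAlgHom hb
  refine ⟨ψ, ArtAlg.localAlgHom_ext fun i => ?_, ?_⟩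
  · change p.1 (ψ.1 _) = _
    rw [hψ, hba]
  · rw [← hbη]
    exact (formalFamily_toMap hFm ψ).trans (familyClass_congr hFm (funext hψ) _ _)

/-- The tangent map of the family sends the homomorphism with `tᵢ ↦ cᵢ ε` to `∑ᵢ cᵢ fᵢ`. -/
theorem formalFamily_toMap_dual [CharZero k] (hFm : F ∈ multIdeal D (maximalIdeal O) m) {r : ℕ}
    {f : Fin r → multIdeal D (maximalIdeal O) m}
    {φ : LocalAlgHom k (MvPowerSeries (Fin r) k) (ArtAlg.dual k).carrier} {c : Fin r → k}
    (hc : ∀ i, φ.1 (MvPowerSeries.X i) = ArtAlg.inr k (c i)) :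
    (formalFamily hSD hF hFm f).toMap (ArtAlg.dual k) φ =
      tangentClass hSD hF hFm (∑ i, c i • LogTangent.mk (f i)) := by
  rw [formalFamily_toMap, familyClass_dual_eq hFm f _ hc, ← tangentClass_mk]
  congr 1
  exact map_sum ((Submodule.mkQ _).restrictScalars k) _ _

theorem isSemiuniversal_formalFamily [CharZero k] (hFm : F ∈ multIdeal D (maximalIdeal O) m)
    {r : ℕ} {f : Fin r → multIdeal D (maximalIdeal O) m}
    (b : Module.Basis (Fin r) k (LogTangent k D F m)) (hb : ∀ i, b i = LogTangent.mk (f i)) :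
    (formalFamily hSD hF hFm f).IsSemiuniversal := by
  have hbij := tangentClass_bijective (hSD := hSD) (hF := hF) hFm
  have hX : ∀ φ : LocalAlgHom k (MvPowerSeries (Fin r) k) (ArtAlg.dual k).carrier,
      ∃ c : Fin r → k, ∀ i, φ.1 (MvPowerSeries.X i) = ArtAlg.inr k (c i) := fun φ => by
    choose c hc using fun i => ArtAlg.exists_eq_inr
      (φ.apply_mem_maximalIdeal (X_mem_maximalIdeal i))
    exact ⟨c, hc⟩
  refine ⟨isVersal_formalFamily hFm fun g hg => ?_, fun φ ψ h => ?_, fun η => ?_⟩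
  · refine ⟨b.repr (LogTangent.mk ⟨g, hg⟩), ?_⟩
    have h1 := b.sum_repr (LogTangent.mk ⟨g, hg⟩)
    simp only [hb] at h1
    have h2 : (LogTangent.mk ⟨g, hg⟩ : LogTangent k D F m) =
        LogTangent.mk (∑ i, b.repr (LogTangent.mk ⟨g, hg⟩) i • f i) := by
      conv_lhs => rw [← h1]
      exact (map_sum ((Submodule.mkQ _).restrictScalars k) _ _).symm
    have h3 := LogTangent.mk_eq_mk_iff.mp h2
    rwa [AddSubmonoidClass.coe_finsetSum] at h3
  · obtain ⟨c, hc⟩ := hX φ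
    obtain ⟨c', hc'⟩ := hX ψ
    have h1 := hbij.injective ((formalFamily_toMap_dual hFm hc).symm.trans
      (Eq.trans h (formalFamily_toMap_dual hFm hc')))
    simp only [← hb] at h1
    have h2 : c = c' := by
      have := congrArg b.equivFun h1
      simpa only [← b.equivFun_symm_apply, LinearEquiv.apply_symm_apply] using this
    exact ArtAlg.localAlgHom_ext fun i => by rw [hc, hc', h2]
  · obtain ⟨t, rfl⟩ := hbij.surjective η
    obtain ⟨φ, hφ⟩ := ArtAlg.exists_localAlgHom (A := ArtAlg.dual k)
      (a := fun i => ArtAlg.inr k (b.repr t i)) fun i => ArtAlg.inr_mem_maximalIdeal _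
    refine ⟨φ, (formalFamily_toMap_dual hFm hφ).trans ?_⟩
    simp only [← hb, b.sum_repr]

/-- Functionals on the cotangent space of `k[[t₁, …, tᵣ]]` are given by their values on the
coordinates. -/
theorem exists_dual_cotangent_linearEquiv (k : Type u) [Field k] (r : ℕ) :
    ∃ e : Module.Dual k (maximalIdeal (MvPowerSeries (Fin r) k)).Cotangent ≃ₗ[k] (Fin r → k),
      ∀ l i, e l i = l ((maximalIdeal (MvPowerSeries (Fin r) k)).toCotangent
        ⟨MvPowerSeries.X i, X_mem_maximalIdeal i⟩) := by
  let x : Fin r → maximalIdeal (MvPowerSeries (Fin r) k) := fun i =>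
    ⟨MvPowerSeries.X i, X_mem_maximalIdeal i⟩
  let q := ((maximalIdeal (MvPowerSeries (Fin r) k)).toCotangent).restrictScalars k
  have hq : Function.Surjective q := Ideal.toCotangent_surjective _
  let T : Module.Dual k (maximalIdeal (MvPowerSeries (Fin r) k)).Cotangent →ₗ[k] (Fin r → k) :=
    LinearMap.pi fun i => LinearMap.applyₗ (q (x i))
  refine ⟨LinearEquiv.ofBijective T ⟨?_, fun c => ?_⟩, fun _ _ => rfl⟩
  · rw [← LinearMap.ker_eq_bot, LinearMap.ker_eq_bot']
    intro l hl
    have hsmul : ∀ (g : MvPowerSeries (Fin r) k) y,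
        l (g • y) = MvPowerSeries.constantCoeff g • l y := fun g y => by
      have h1 : g - MvPowerSeries.C (MvPowerSeries.constantCoeff g) ∈
          maximalIdeal (MvPowerSeries (Fin r) k) := by
        rw [mem_maximalIdeal, mem_nonunits_iff, MvPowerSeries.isUnit_iff_constantCoeff]
        simp
      have h2 := Ideal.Cotangent.smul_eq_zero_of_mem h1 y
      rw [sub_smul, sub_eq_zero] at h2
      rw [h2, ← map_smul]
      exact congrArg l (algebraMap_smul (MvPowerSeries (Fin r) k) _ y)
    refine LinearMap.ext fun y => ?_
    obtain ⟨⟨a, ha⟩, rfl⟩ := hq y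
    obtain ⟨g, hg⟩ := exists_eq_C_add_sum_X_mul a
    have h0 : MvPowerSeries.constantCoeff a = 0 := by
      rwa [mem_maximalIdeal, mem_nonunits_iff, MvPowerSeries.isUnit_iff_constantCoeff,
        isUnit_iff_ne_zero, not_not] at ha
    rw [h0, map_zero, zero_add] at hg
    have h1 : (⟨a, ha⟩ : maximalIdeal (MvPowerSeries (Fin r) k)) = ∑ i, g i • x i :=
      Subtype.ext (by rw [AddSubmonoidClass.coe_finsetSum]; exact hg)
    have h2 : q ⟨a, ha⟩ = ∑ i, g i • q (x i) := by
      rw [h1]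
      exact (map_sum (Ideal.toCotangent _) _ _).trans
        (Finset.sum_congr rfl fun i _ => map_smul (Ideal.toCotangent _) _ _)
    rw [h2, map_sum]
    refine Finset.sum_eq_zero fun i _ => ?_
    have h3 : l (q (x i)) = 0 := congrFun hl i
    rw [hsmul, h3, smul_zero]
  · obtain ⟨φ, hφ⟩ := ArtAlg.exists_localAlgHom (A := ArtAlg.dual k)
      (a := fun i => ArtAlg.inr k (c i)) fun i => ArtAlg.inr_mem_maximalIdeal _
    let s : maximalIdeal (MvPowerSeries (Fin r) k) →ₗ[k] k :=
      (TrivSqZeroExt.sndHom k k) ∘ₗ φ.1.toLinearMap ∘ₗ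
        ((maximalIdeal (MvPowerSeries (Fin r) k)).subtype.restrictScalars k)
    have hs : ∀ a b, s (a * b) = 0 := fun a b => by
      have h1 := Ideal.mul_mem_mul (φ.apply_mem_maximalIdeal a.2) (φ.apply_mem_maximalIdeal b.2)
      rw [ArtAlg.maximalIdeal_sqZero_mul, Ideal.mem_bot, ← map_mul] at h1
      exact congrArg TrivSqZeroExt.snd h1
    refine ⟨Ideal.Cotangent.lift s hs, funext fun i => ?_⟩
    exact (Ideal.Cotangent.lift_toCotangent s hs (x i)).trans
      (congrArg TrivSqZeroExt.snd (hφ i))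

/-- The tangent map of the family is the linear isomorphism that sends the basis dual to the `tᵢ`
to the classes of the `fᵢ`. -/
theorem exists_cotangentDual_linearEquiv [CharZero k]
    (hFm : F ∈ multIdeal D (maximalIdeal O) m) {r : ℕ}
    {f : Fin r → multIdeal D (maximalIdeal O) m} (b : Module.Basis (Fin r) k (LogTangent k D F m))
    (hb : ∀ i, b i = LogTangent.mk (f i)) :
    ∃ κ : Module.Dual k (maximalIdeal (MvPowerSeries (Fin r) k)).Cotangent ≃ₗ[k]
        LogTangent k D F m,
      ∀ (ℓ : Module.Dual k (maximalIdeal (MvPowerSeries (Fin r) k)).Cotangent)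
        (v : LocalAlgHom k (MvPowerSeries (Fin r) k) (TrivSqZeroExt k k)),
        (∀ a : maximalIdeal (MvPowerSeries (Fin r) k),
          ℓ ((maximalIdeal (MvPowerSeries (Fin r) k)).toCotangent a) =
            (v.1 (a : MvPowerSeries (Fin r) k)).snd) →
        (formalFamily hSD hF hFm f).toMap (ArtAlg.dual k) v = tangentClass hSD hF hFm (κ ℓ) := by
  obtain ⟨e, he⟩ := exists_dual_cotangent_linearEquiv k r
  refine ⟨e.trans b.equivFun.symm, fun ℓ v h => ?_⟩
  have hc : ∀ i, v.1 (MvPowerSeries.X i) = ArtAlg.inr k (e ℓ i) := fun i => by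
    let w : LocalAlgHom k (MvPowerSeries (Fin r) k) (ArtAlg.dual k).carrier := v
    obtain ⟨c, hc⟩ := ArtAlg.exists_eq_inr (w.apply_mem_maximalIdeal (X_mem_maximalIdeal i))
    have h1 : e ℓ i = c := (he ℓ i).trans ((h _).trans (congrArg TrivSqZeroExt.snd hc))
    exact hc.trans (congrArg (ArtAlg.inr k) h1.symm)
  refine (formalFamily_toMap_dual hFm hc).trans ?_
  rw [LinearEquiv.trans_apply, b.equivFun_symm_apply]
  simp only [hb]

end formal

/-! ### The ideals of `mP` and of the equianalytic deformations -/

section ideals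

variable {k : Type u} [Field k] {O : Type u} [CommRing O] [IsLocalRing O] [Algebra k O]
  {D : Ideal O}

/-- If `F` restricts to a unit times `xⁿ` on `D = Spec k[[x]]`, then `C.D ≤ n`; so `m ≤ C.D`
implies that `F` is divisible by `xᵐ` modulo the ideal of `D`. -/
theorem mem_multIdeal_of_le_intersectionMultiplicity (hSD : IsFormalSurfacePair k D) {F : O}
    (hF : F ∉ D) {m : ℕ} (hm : m ≤ intersectionMultiplicity k (Ideal.span {F}) D) :
    F ∈ multIdeal D (maximalIdeal O) m := by
  obtain ⟨c⟩ := hSD.curve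
  let q : O →ₐ[k] PowerSeries k := (c : (O ⧸ D) →ₐ[k] PowerSeries k).comp (Ideal.Quotient.mkₐ k D)
  have hq : Function.Surjective q := c.surjective.comp (Ideal.Quotient.mkₐ_surjective k D)
  have hq0 : ∀ g, q g = 0 ↔ g ∈ D := fun g => by
    rw [← Ideal.Quotient.eq_zero_iff_mem, ← map_eq_zero_iff c c.injective]
    rfl
  have hf : q F ≠ 0 := fun h => hF ((hq0 F).mp h)
  obtain ⟨n, u, v, huv, hu⟩ : ∃ (n : ℕ) (u v : PowerSeries k), v * u = 1 ∧
      q F = PowerSeries.X ^ n * u :=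
    ⟨_, PowerSeries.divXPowOrder (q F), (PowerSeries.Unit_of_divided_by_X_pow_order (q F))⁻¹.1, by
      rw [← PowerSeries.Unit_of_divided_by_X_pow_order_nonzero hf, Units.inv_mul],
      PowerSeries.X_pow_order_mul_divXPowOrder.symm⟩
  obtain ⟨x, hx⟩ := hq PowerSeries.X
  -- `O / (F, D)` is spanned by the classes of `xⁱ` with `i < n`
  have hle : intersectionMultiplicity k (Ideal.span {F}) D ≤ n := by
    let T : (Fin n → k) →ₗ[k] O ⧸ (Ideal.span {F} ⊔ D) :=
      Fintype.linearCombination k fun i : Fin n =>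
        Ideal.Quotient.mk (Ideal.span {F} ⊔ D) (x ^ (i : ℕ))
    have hT : Function.Surjective T := fun z => by
      obtain ⟨g, rfl⟩ := Ideal.Quotient.mk_surjective z
      obtain ⟨h, hh⟩ := hq (v * PowerSeries.mk fun i => PowerSeries.coeff (i + n) (q g))
      refine ⟨fun i => PowerSeries.coeff i (q g), ?_⟩
      have h1 : T (fun i => PowerSeries.coeff i (q g)) = Ideal.Quotient.mk (Ideal.span {F} ⊔ D)
          (∑ i : Fin n, PowerSeries.coeff i (q g) • x ^ (i : ℕ)) := by
        rw [Fintype.linearCombination_apply, map_sum]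
        rfl
      rw [h1, Ideal.Quotient.mk_eq_mk_iff_sub_mem, ← neg_mem_iff, neg_sub]
      have h2 : g - ∑ i : Fin n, PowerSeries.coeff i (q g) • x ^ (i : ℕ) - h * F ∈ D := by
        rw [← hq0, map_sub, map_sub, map_mul, hh, hu, map_sum]
        simp only [map_smul, map_pow, hx]
        have h3 := PowerSeries.eq_X_pow_mul_shift_add_trunc n (q g)
        have h4 : ((q g).trunc n : PowerSeries k) =
            ∑ i : Fin n, PowerSeries.coeff i (q g) • (PowerSeries.X : PowerSeries k) ^ (i : ℕ) := by
          ext j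
          rw [Polynomial.coeff_coe, PowerSeries.coeff_trunc, map_sum]
          simp only [map_smul, PowerSeries.coeff_X_pow, smul_eq_mul, mul_ite, mul_one, mul_zero]
          rw [Finset.sum_ite, Finset.sum_const_zero, add_zero]
          split_ifs with hj
          · rw [Finset.sum_eq_single ⟨j, hj⟩] <;> simp [Fin.ext_iff]
            intro a ha hne
            exact absurd ha.symm hne
          · symm
            refine Finset.sum_eq_zero fun i hi => ?_
            exact absurd ((Finset.mem_filter.mp hi).2 ▸ i.2) hj
        rw [← h4]
        linear_combination h3 - (PowerSeries.X ^ n *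
          PowerSeries.mk fun i => PowerSeries.coeff (i + n) (q g)) * huv
      have := add_mem (show _ ∈ Ideal.span {F} ⊔ D from Ideal.mem_sup_right h2)
        (Ideal.mem_sup_left (Ideal.mul_mem_left _ h (Ideal.mem_span_singleton_self F)))
      rwa [sub_add_cancel] at this
    exact (LinearMap.finrank_le_finrank_of_surjective hT).trans (by simp)
  obtain ⟨h, hh⟩ := hq (PowerSeries.X ^ (n - m) * u)
  have h1 : F - x ^ m * h ∈ D := by
    rw [← hq0, map_sub, map_mul, map_pow, hx, hh, hu]
    nth_rewrite 1 [← Nat.add_sub_cancel' (hm.trans hle)]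
    ring
  have hxm : x ∈ maximalIdeal O := fun hxu => by
    have := hxu.map q
    rw [hx] at this
    exact PowerSeries.X_ne_zero (R := k) (by
      have h2 := PowerSeries.isUnit_iff_constantCoeff.mp this
      simp at h2)
  have := Submodule.add_mem_sup h1 (Ideal.mul_mem_right h _ (Ideal.pow_mem_pow hxm m))
  rwa [sub_add_cancel] at this

theorem derivation_apply_mem_pow {R : Type*} [CommRing R] [Algebra k R] (δ : Derivation k R R)
    {P : Ideal R} (hP : ∀ g ∈ P, δ g ∈ P) (n : ℕ) : ∀ g ∈ P ^ n, δ g ∈ P ^ n := by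
  induction n with
  | zero => simp
  | succ n ih =>
    intro g hg
    rw [pow_succ] at hg ⊢
    refine Submodule.mul_induction_on hg (fun a ha b hb => ?_) fun a b ha hb => ?_
    · rw [δ.leibniz]
      exact add_mem (Ideal.mul_mem_mul ha (hP b hb)) (by
        rw [smul_eq_mul, mul_comm b]
        exact Ideal.mul_mem_mul (ih a ha) hb)
    · rw [map_add]
      exact add_mem ha hb

theorem relEquianalyticIdeal_le_multIdeal {F : O} {m : ℕ}
    (hFm : F ∈ multIdeal D (maximalIdeal O) m) :
    relEquianalyticIdeal k D F ≤ multIdeal D (maximalIdeal O) m := by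
  intro g hg
  obtain ⟨δ, hδ, h, rfl⟩ := mem_relEquianalyticIdeal.mp hg
  refine add_mem ?_ (Ideal.mul_mem_left _ h hFm)
  obtain ⟨a, ha, b, hb, rfl⟩ := Submodule.mem_sup.mp hFm
  rw [map_add]
  exact Submodule.add_mem_sup (hδ.1 a ha) (derivation_apply_mem_pow δ hδ.2 m b hb)

/-- Transport of a derivation along an isomorphism. -/
def derivationTransport {R : Type*} [CommRing R] [Algebra k R] (e : O ≃ₐ[k] R)
    (δ : Derivation k O O) : Derivation k R R :=
  Derivation.mk' (e.toLinearMap ∘ₗ δ.toLinearMap ∘ₗ e.symm.toLinearMap) fun a b => by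
    change e (δ (e.symm (a * b))) = a * e (δ (e.symm b)) + b * e (δ (e.symm a))
    rw [map_mul, δ.leibniz, map_add, smul_eq_mul, smul_eq_mul, map_mul, map_mul,
      e.apply_symm_apply, e.apply_symm_apply]

theorem mem_map_algEquiv_iff {O R : Type*} [CommRing O] [Algebra k O] [CommRing R] [Algebra k R]
    (e : O ≃ₐ[k] R) {I : Ideal O} {y : R} : y ∈ I.map e ↔ e.symm y ∈ I := by
  refine (Ideal.mem_map_of_equiv e y).trans ⟨?_, fun h => ⟨_, h, e.apply_symm_apply y⟩⟩
  rintro ⟨x, hx, rfl⟩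
  rwa [e.symm_apply_apply]

theorem map_relEquianalyticIdeal_le {R : Type u} [CommRing R] [IsLocalRing R] [Algebra k R]
    (e : O ≃ₐ[k] R) (D : Ideal O) (F : O) :
    (relEquianalyticIdeal k D F).map e ≤ relEquianalyticIdeal k (D.map e) (e F) := by
  rw [Ideal.map_le_iff_le_comap]
  intro g hg
  obtain ⟨δ, hδ, h, rfl⟩ := mem_relEquianalyticIdeal.mp hg
  refine mem_relEquianalyticIdeal.mpr ⟨derivationTransport e δ, ⟨fun g hg => ?_, fun g hg => ?_⟩,
    e h, ?_⟩
  · exact Ideal.mem_map_of_mem e (hδ.1 _ ((mem_map_algEquiv_iff e).mp hg))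
  · rw [← map_maximalIdeal_of_algEquiv e] at hg ⊢
    exact Ideal.mem_map_of_mem e (hδ.2 _ ((mem_map_algEquiv_iff e).mp hg))
  · change e (δ F + h * F) = e (δ (e.symm (e F))) + _
    rw [e.symm_apply_apply, map_add, map_mul]

theorem map_relEquianalyticIdeal {R : Type u} [CommRing R] [IsLocalRing R] [Algebra k R]
    (e : O ≃ₐ[k] R) (D : Ideal O) (F : O) :
    (relEquianalyticIdeal k D F).map e = relEquianalyticIdeal k (D.map e) (e F) := by
  refine le_antisymm (map_relEquianalyticIdeal_le e D F) fun y hy => ?_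
  have h1 := map_relEquianalyticIdeal_le e.symm (D.map e) (e F) (Ideal.mem_map_of_mem e.symm hy)
  rw [ideal_map_map_eq' D e e.symm (RingHom.id O) e.symm_apply_apply, Ideal.map_id,
    e.symm_apply_apply] at h1
  exact (mem_map_algEquiv_iff e).mpr h1

end ideals

/-! ### Coordinates `x, y` with `D = V(y)` -/

section coordinates

variable {k : Type u} [Field k]

open MvPowerSeries

theorem maximalIdeal_mvPowerSeries_two :
    maximalIdeal (MvPowerSeries (Fin 2) k) = Ideal.span {X 0, X 1} := by
  rw [maximalIdeal_mvPowerSeries]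
  congr 1
  ext y
  simp [Fin.exists_fin_two, eq_comm]

/-- A derivation of `k[[x, y]]` is determined by its values on the coordinates. -/
theorem derivation_mvPowerSeries_two_apply
    (δ : Derivation k (MvPowerSeries (Fin 2) k) (MvPowerSeries (Fin 2) k))
    (g : MvPowerSeries (Fin 2) k) :
    δ g = δ (X 0) * pderiv k 0 g + δ (X 1) * pderiv k 1 g := by
  let η : Derivation k (MvPowerSeries (Fin 2) k) (MvPowerSeries (Fin 2) k) :=
    δ - (δ (X 0) • pderiv k 0 + δ (X 1) • pderiv k 1)
  have hη : ∀ g, η g = δ g - (δ (X 0) * pderiv k 0 g + δ (X 1) * pderiv k 1 g) := fun _ => rfl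
  have hX : ∀ i, η (X i) = 0 := by
    rw [Fin.forall_fin_two]
    constructor
    · rw [hη, pderiv_X_self, pderiv_X_of_ne (by decide : (0 : Fin 2) ≠ 1)]
      ring
    · rw [hη, pderiv_X_self, pderiv_X_of_ne (by decide : (1 : Fin 2) ≠ 0)]
      ring
  have key : ∀ (n : ℕ) (g), η g ∈ maximalIdeal (MvPowerSeries (Fin 2) k) ^ n := by
    intro n
    induction n with
    | zero => simp
    | succ n ih =>
      intro g
      obtain ⟨f, hf⟩ := exists_eq_C_add_sum_X_mul g
      have h1 : η (MvPowerSeries.C (constantCoeff g)) = 0 := η.map_algebraMap (constantCoeff g)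
      rw [hf, map_add, h1, zero_add, map_sum]
      refine sum_mem fun i _ => ?_
      rw [η.leibniz, hX, smul_zero, zero_add, smul_eq_mul, mul_comm, pow_succ]
      exact Ideal.mul_mem_mul (ih (f i)) (X_mem_maximalIdeal i)
  have h0 : η g = 0 := by
    have : IsAdicComplete (maximalIdeal (MvPowerSeries (Fin 2) k)) (MvPowerSeries (Fin 2) k) :=
      (CompAlg.powerSeries k 2).isAdicComplete
    refine IsHausdorff.haus (I := maximalIdeal (MvPowerSeries (Fin 2) k)) inferInstance (η g)
      fun n => ?_
    rw [SModEq.zero, smul_eq_mul, Ideal.mul_top]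
    exact key n g
  rw [hη, sub_eq_zero] at h0
  exact h0

theorem multIdeal_span_X_one (m : ℕ) :
    multIdeal (Ideal.span {X 1}) (maximalIdeal (MvPowerSeries (Fin 2) k)) m =
      Ideal.span {X 0 ^ m, X 1} := by
  have key : ∀ K : Ideal (MvPowerSeries (Fin 2) k), Ideal.span {X 1} ⊔ K =
      (K.map (Ideal.Quotient.mk (Ideal.span {X 1}))).comap
        (Ideal.Quotient.mk (Ideal.span {X 1})) := fun K => by
    rw [Ideal.comap_map_of_surjective _ Ideal.Quotient.mk_surjective, ← RingHom.ker_eq_comap_bot,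
      Ideal.mk_ker, sup_comm]
  have h1 : (Ideal.span {X 1} : Ideal (MvPowerSeries (Fin 2) k)).map
      (Ideal.Quotient.mk (Ideal.span {X 1})) = ⊥ := Ideal.map_quotient_self _
  rw [multIdeal, key, Ideal.map_pow, maximalIdeal_mvPowerSeries_two, Ideal.span_insert,
    Ideal.map_sup, h1, sup_bot_eq, ← Ideal.map_pow, ← key, Ideal.span_singleton_pow,
    Ideal.span_insert, sup_comm]

theorem map_multIdeal {O : Type u} [CommRing O] [IsLocalRing O] [Algebra k O] {D : Ideal O}
    (e : O ≃ₐ[k] MvPowerSeries (Fin 2) k) (he : D.map e = Ideal.span {X 1}) (m : ℕ) :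
    (multIdeal D (maximalIdeal O) m).map e = Ideal.span {X 0 ^ m, X 1} := by
  rw [← multIdeal_span_X_one, multIdeal, multIdeal, Ideal.map_sup, Ideal.map_pow, he,
    map_maximalIdeal_of_algEquiv]

theorem derivation_mem_logDerivations
    {δ : Derivation k (MvPowerSeries (Fin 2) k) (MvPowerSeries (Fin 2) k)}
    (h0 : δ (X 0) ∈ maximalIdeal (MvPowerSeries (Fin 2) k)) (h1 : δ (X 1) ∈ Ideal.span {X 1}) :
    δ ∈ logDerivations k (Ideal.span {X 1}) (maximalIdeal (MvPowerSeries (Fin 2) k)) := by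
  constructor
  · intro g hg
    obtain ⟨a, rfl⟩ := Ideal.mem_span_singleton'.mp hg
    rw [δ.leibniz]
    exact add_mem (Ideal.mul_mem_left _ a h1)
      (Ideal.mul_mem_right _ _ (Ideal.mem_span_singleton_self _))
  · intro g hg
    rw [derivation_mvPowerSeries_two_apply]
    refine add_mem (Ideal.mul_mem_right _ _ h0) (Ideal.mul_mem_right _ _ ?_)
    exact (Ideal.span_singleton_le_iff_mem _).mpr (X_mem_maximalIdeal 1) h1

theorem relEquianalyticIdeal_span_X_one (F : MvPowerSeries (Fin 2) k) :
    relEquianalyticIdeal k (Ideal.span {X 1}) F =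
      Ideal.span {X 0 * pderiv k 0 F, X 1 * pderiv k 0 F, X 1 * pderiv k 1 F, F} := by
  apply le_antisymm
  · intro g hg
    obtain ⟨δ, hδ, h, rfl⟩ := mem_relEquianalyticIdeal.mp hg
    have h0 := hδ.2 _ (X_mem_maximalIdeal 0)
    have h1 := hδ.1 _ (Ideal.mem_span_singleton_self (X 1))
    rw [maximalIdeal_mvPowerSeries_two] at h0
    obtain ⟨a, b, hab⟩ := Ideal.mem_span_pair.mp h0
    obtain ⟨c, hc⟩ := Ideal.mem_span_singleton'.mp h1
    rw [derivation_mvPowerSeries_two_apply δ, ← hab, ← hc]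
    have h2 : (a * X 0 + b * X 1) * pderiv k 0 F + c * X 1 * pderiv k 1 F + h * F =
        a * (X 0 * pderiv k 0 F) + b * (X 1 * pderiv k 0 F) + c * (X 1 * pderiv k 1 F) + h * F := by
      ring
    rw [h2]
    refine add_mem (add_mem (add_mem ?_ ?_) ?_) ?_ <;>
      exact Ideal.mul_mem_left _ _ (Ideal.subset_span (by simp))
  · rw [Ideal.span_le]
    have hmem : ∀ (a : MvPowerSeries (Fin 2) k) (i : Fin 2),
        (a • pderiv k i) (X 0) ∈ maximalIdeal (MvPowerSeries (Fin 2) k) →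
        (a • pderiv k i) (X 1) ∈ Ideal.span {(X 1 : MvPowerSeries (Fin 2) k)} →
        a * pderiv k i F ∈ relEquianalyticIdeal k (Ideal.span {X 1}) F := fun a i h0 h1 =>
      mem_relEquianalyticIdeal.mpr ⟨a • pderiv k i, derivation_mem_logDerivations h0 h1, 0, by
        rw [zero_mul, add_zero]
        rfl⟩
    have h01 : (pderiv k (0 : Fin 2)) (X 1) = 0 := pderiv_X_of_ne (by decide)
    have h10 : (pderiv k (1 : Fin 2)) (X 0) = 0 := pderiv_X_of_ne (by decide)
    rintro _ (rfl | rfl | rfl | rfl)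
    · refine hmem _ _ ?_ ?_
      · rw [Derivation.smul_apply, pderiv_X_self, smul_eq_mul, mul_one]
        exact X_mem_maximalIdeal 0
      · rw [Derivation.smul_apply, h01, smul_zero]
        exact zero_mem _
    · refine hmem _ _ ?_ ?_
      · rw [Derivation.smul_apply, pderiv_X_self, smul_eq_mul, mul_one]
        exact X_mem_maximalIdeal 1
      · rw [Derivation.smul_apply, h01, smul_zero]
        exact zero_mem _
    · refine hmem _ _ ?_ ?_
      · rw [Derivation.smul_apply, h10, smul_zero]
        exact zero_mem _
      · rw [Derivation.smul_apply, pderiv_X_self, smul_eq_mul, mul_one]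
        exact Ideal.mem_span_singleton_self _
    · exact mem_relEquianalyticIdeal.mpr ⟨0, zero_mem _, 1, by simp⟩

end coordinates

/-! ### Finite dimensionality -/

section finite

variable {k : Type u} [Field k]

open MvPowerSeries

/-- A prime strictly larger than the ideal of `D ≅ Spec k[[x]]` is maximal. -/
theorem IsFormalSurfacePair.isMaximal_of_le {k : Type*} [Field k] {O : Type*} [CommRing O]
    [Algebra k O] {D : Ideal O} (hSD : IsFormalSurfacePair k D) {q : Ideal O} [hq : q.IsPrime]
    (hD : D ≤ q) {F : O} (hF : F ∉ D) (hFq : F ∈ q) : q.IsMaximal := by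
  obtain ⟨c⟩ := hSD.curve
  have hc : Function.Surjective ((c : (O ⧸ D) →+* PowerSeries k).comp (Ideal.Quotient.mk D)) :=
    c.surjective.comp Ideal.Quotient.mk_surjective
  set π : O →+* PowerSeries k := (c : (O ⧸ D) →+* PowerSeries k).comp (Ideal.Quotient.mk D)
  have hker : RingHom.ker π = D := by
    ext g
    rw [RingHom.mem_ker, ← Ideal.Quotient.eq_zero_iff_mem, ← map_eq_zero_iff c c.injective]
    rfl
  have hp : (q.map π).IsPrime := Ideal.map_isPrime_of_surjective hc (hker.trans_le hD)
  have hne : q.map π ≠ ⊥ := fun h => hF (by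
    have h1 := Ideal.mem_map_of_mem π hFq
    rwa [h, Ideal.mem_bot, ← RingHom.mem_ker, hker] at h1)
  have hmax : (q.map π).IsMaximal := IsPrime.to_maximal_ideal hne
  have hcomap : (q.map π).comap π = q := by
    rw [Ideal.comap_map_of_surjective _ hc, ← RingHom.ker_eq_comap_bot, hker, sup_eq_left]
    exact hD
  rw [← hcomap]
  exact Ideal.comap_isMaximal_of_surjective π hc

/-- At a minimal prime `q` of a radical ideal `I`, the localization of `R / I` is a field, that is,
the elements of `q` vanish in it. -/
theorem exists_mul_mem_of_mem_minimalPrimes_of_isRadical {R : Type*} [CommRing R] {I q : Ideal R}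
    (hI : I.IsRadical) (hq : q ∈ I.minimalPrimes) {x : R} (hx : x ∈ q) : ∃ s ∉ q, s * x ∈ I := by
  have := hq.isPrime
  have h1 := Ideal.mem_map_of_mem (algebraMap R (Localization.AtPrime q)) hx
  rw [← IsLocalization.AtPrime.radical_map_of_mem_minimalPrimes _ q I hq] at h1
  obtain ⟨n, hn⟩ := h1
  rw [← map_pow, IsLocalization.algebraMap_mem_map_algebraMap_iff q.primeCompl] at hn
  obtain ⟨s, hs, hsn⟩ := hn
  refine ⟨s, hs, hI ⟨n + 1, ?_⟩⟩
  have : (s * x) ^ (n + 1) = s ^ n * x * (s * x ^ n) := by ring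
  rw [this]
  exact I.mul_mem_left _ hsn

/-- In characteristic zero, a proper ideal of `k[[x, y]]` stable under the partial derivatives
vanishes: the coefficients of its elements are constant coefficients of iterated derivatives. -/
theorem eq_bot_of_pderiv_mem [CharZero k] {q : Ideal (MvPowerSeries (Fin 2) k)}
    (hq : q ≤ maximalIdeal (MvPowerSeries (Fin 2) k)) (h : ∀ i, ∀ g ∈ q, pderiv k i g ∈ q) :
    q = ⊥ := by
  have key : ∀ (n : ℕ) (d : Fin 2 →₀ ℕ), d.degree = n → ∀ g ∈ q, coeff d g = 0 := by
    intro n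
    induction n with
    | zero =>
      intro d hd g hg
      rw [Finsupp.degree_eq_zero_iff] at hd
      have h1 := hq hg
      rwa [mem_maximalIdeal, mem_nonunits_iff, isUnit_iff_constantCoeff, isUnit_iff_ne_zero,
        not_not, ← coeff_zero_eq_constantCoeff_apply, ← hd] at h1
    | succ n ih =>
      intro d hd g hg
      obtain ⟨i, hi⟩ : ∃ i, d i ≠ 0 := by
        by_contra! h0
        have h1 : d = 0 := Finsupp.ext h0
        rw [h1, map_zero] at hd
        omega
      have hd' : d - Finsupp.single i 1 + Finsupp.single i 1 = d :=
        tsub_add_cancel_of_le (Finsupp.single_le_iff.mpr (Nat.one_le_iff_ne_zero.mpr hi))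
      have h1 : (d - Finsupp.single i 1).degree = n := by
        have h2 := congrArg Finsupp.degree hd'
        rw [map_add, Finsupp.degree_single, hd] at h2
        omega
      have h2 := ih _ h1 _ (h i g hg)
      rw [coeff_pderiv, hd'] at h2
      exact (mul_eq_zero.mp h2).resolve_right (Nat.cast_add_one_ne_zero _)
  rw [eq_bot_iff]
  intro g hg
  exact MvPowerSeries.ext fun d => key _ d rfl g hg

/-- A non-maximal prime containing `F ≠ 0` is a component of `V(F)`, since `k[[x, y]]` has dimension
at most two by Krull's height theorem. -/
theorem mem_minimalPrimes_span_singleton {F : MvPowerSeries (Fin 2) k} (hF : F ≠ 0)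
    {q : Ideal (MvPowerSeries (Fin 2) k)} [hq : q.IsPrime] (hFq : F ∈ q)
    (hqm : q ≠ maximalIdeal (MvPowerSeries (Fin 2) k)) : q ∈ (Ideal.span {F}).minimalPrimes := by
  have : IsNoetherianRing (MvPowerSeries (Fin 2) k) := (CompAlg.powerSeries k 2).isNoetherianRing
  have : IsDomain (MvPowerSeries (Fin 2) k) := NoZeroDivisors.to_isDomain _
  obtain ⟨p, hp, hpq⟩ := Ideal.exists_minimalPrimes_le
    ((Ideal.span_singleton_le_iff_mem q).mpr hFq)
  have := hp.isPrime
  rcases hpq.eq_or_lt with rfl | hlt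
  · exact hp
  exfalso
  have h0 : (⊥ : Ideal (MvPowerSeries (Fin 2) k)) < p := bot_lt_iff_ne_bot.mpr fun h => hF (by
    have := hp.le (Ideal.mem_span_singleton_self F)
    rwa [h] at this)
  have h1 := Ideal.height_add_one_le_of_lt_of_isPrime h0
  have h2 := Ideal.height_add_one_le_of_lt_of_isPrime hlt
  have h3 := Ideal.height_add_one_le_of_lt_of_isPrime
    (lt_of_le_of_ne (IsLocalRing.le_maximalIdeal hq.ne_top) hqm)
  have h4 : (maximalIdeal (MvPowerSeries (Fin 2) k)).spanFinrank ≤ 2 := by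
    rw [maximalIdeal_mvPowerSeries_two]
    exact (Submodule.spanFinrank_span_le_ncard_of_finite (Set.toFinite _)).trans
      ((Set.ncard_insert_le _ _).trans (by rw [Set.ncard_singleton]))
  have h5 := Ideal.height_le_spanFinrank (maximalIdeal (MvPowerSeries (Fin 2) k))
    (maximalIdeal.isMaximal _).ne_top
  have h6 : (0 + 1 + 1 + 1 : ℕ∞) ≤ 2 :=
    calc (0 + 1 + 1 + 1 : ℕ∞) ≤ (⊥ : Ideal (MvPowerSeries (Fin 2) k)).height + 1 + 1 + 1 := by
          gcongr
          exact zero_le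
      _ ≤ p.height + 1 + 1 := by gcongr
      _ ≤ q.height + 1 := by gcongr
      _ ≤ (maximalIdeal (MvPowerSeries (Fin 2) k)).height := h3
      _ ≤ ((maximalIdeal (MvPowerSeries (Fin 2) k)).spanFinrank : ℕ∞) := h5
      _ ≤ 2 := by exact_mod_cast h4
  exact absurd h6 (by decide)

/-- A reduced plane curve has an isolated singularity: a non-maximal prime containing `F` and its
partial derivatives would be a component of the curve stable under all derivations. -/
theorem eq_maximalIdeal_of_pderiv_mem [CharZero k] {F : MvPowerSeries (Fin 2) k} (hF : F ≠ 0)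
    (hred : IsReduced (MvPowerSeries (Fin 2) k ⧸ Ideal.span {F}))
    {q : Ideal (MvPowerSeries (Fin 2) k)} [hq : q.IsPrime] (hFq : F ∈ q)
    (h : ∀ i, pderiv k i F ∈ q) : q = maximalIdeal (MvPowerSeries (Fin 2) k) := by
  by_contra hqm
  have hmin := mem_minimalPrimes_span_singleton hF hFq hqm
  have hrad : (Ideal.span {F}).IsRadical := (Ideal.isRadical_iff_quotient_reduced _).mpr hred
  have hbot := eq_bot_of_pderiv_mem (IsLocalRing.le_maximalIdeal hq.ne_top) fun i g hg => by
    obtain ⟨s, hs, hsg⟩ := exists_mul_mem_of_mem_minimalPrimes_of_isRadical hrad hmin hg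
    obtain ⟨c, hc⟩ := Ideal.mem_span_singleton'.mp hsg
    have h1 := congrArg (pderiv k i) hc
    rw [Derivation.leibniz, Derivation.leibniz, smul_eq_mul, smul_eq_mul, smul_eq_mul,
      smul_eq_mul] at h1
    have h2 : s * pderiv k i g ∈ q := by
      rw [← eq_sub_iff_add_eq] at h1
      have h3 : s * pderiv k i g =
          c * pderiv k i F + F * pderiv k i c - g * pderiv k i s := by linear_combination -h1
      rw [h3]
      exact sub_mem (add_mem (Ideal.mul_mem_left _ _ (h i)) (Ideal.mul_mem_right _ _ hFq))
        (Ideal.mul_mem_right _ _ hg)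
    exact (hq.mem_or_mem h2).resolve_left hs
  rw [hbot] at hFq
  exact hF hFq

/-- `I^ea` contains a power of the maximal ideal: a prime containing `I^ea` either contains `y`, and
then is maximal since `F` does not vanish on `D`, or it contains `F, ∂ₓF, ∂_yF`. -/
theorem exists_pow_le_relEquianalyticIdeal_span_X_one [CharZero k]
    (hSD : IsFormalSurfacePair k (Ideal.span {(X 1 : MvPowerSeries (Fin 2) k)}))
    {F : MvPowerSeries (Fin 2) k} (hF : F ∉ Ideal.span {(X 1 : MvPowerSeries (Fin 2) k)})
    (hred : IsReduced (MvPowerSeries (Fin 2) k ⧸ Ideal.span {F})) :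
    ∃ n, maximalIdeal (MvPowerSeries (Fin 2) k) ^ n ≤
      relEquianalyticIdeal k (Ideal.span {X 1}) F := by
  have : IsNoetherianRing (MvPowerSeries (Fin 2) k) := (CompAlg.powerSeries k 2).isNoetherianRing
  have hF0 : F ≠ 0 := fun h => hF (h ▸ zero_mem _)
  refine Ideal.exists_pow_le_of_le_radical_of_fg ?_ (IsNoetherian.noetherian _)
  rw [Ideal.radical_eq_sInf, le_sInf_iff]
  rintro q ⟨hJq, hq⟩
  rw [relEquianalyticIdeal_span_X_one, Ideal.span_le] at hJq
  have h1 : X 0 * pderiv k 0 F ∈ q := hJq (by simp)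
  have h2 : X 1 * pderiv k 0 F ∈ q := hJq (by simp)
  have h3 : X 1 * pderiv k 1 F ∈ q := hJq (by simp)
  have hFq : F ∈ q := hJq (by simp)
  by_cases hX : X 1 ∈ q
  · have := hSD.isMaximal_of_le ((Ideal.span_singleton_le_iff_mem q).mpr hX) hF hFq
    exact (IsLocalRing.eq_maximalIdeal this).ge
  · refine (eq_maximalIdeal_of_pderiv_mem hF0 hred hFq (Fin.forall_fin_two.mpr
      ⟨(hq.mem_or_mem h2).resolve_left hX, (hq.mem_or_mem h3).resolve_left hX⟩)).ge

theorem IsFormalSurfacePair.map_algEquiv {k : Type*} [Field k] {O R : Type*} [CommRing O]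
    [Algebra k O] [CommRing R] [Algebra k R] {D : Ideal O} (h : IsFormalSurfacePair k D)
    (e : O ≃ₐ[k] R) : IsFormalSurfacePair k (D.map e) := by
  obtain ⟨e₀⟩ := h.surface
  obtain ⟨c⟩ := h.curve
  exact ⟨⟨e.symm.trans e₀⟩, ⟨(Ideal.quotientEquivAlg D (D.map e) e rfl).symm.trans c⟩⟩

theorem exists_pow_le_relEquianalyticIdeal [CharZero k] {O : Type u} [CommRing O] [IsLocalRing O]
    [Algebra k O] {D : Ideal O} (hSD : IsFormalSurfacePair k D) {F : O}
    (hred : IsReduced (O ⧸ Ideal.span {F})) (hF : F ∉ D) :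
    ∃ n, maximalIdeal O ^ n ≤ relEquianalyticIdeal k D F := by
  obtain ⟨e, he⟩ := hSD.exists_coordinates
  have hSD' := hSD.map_algEquiv e
  rw [he] at hSD'
  have hF' : e F ∉ Ideal.span {(X 1 : MvPowerSeries (Fin 2) k)} := by
    rw [← he, mem_map_algEquiv_iff, e.symm_apply_apply]
    exact hF
  have hred' : IsReduced (MvPowerSeries (Fin 2) k ⧸ Ideal.span {e F}) := by
    have e' : (O ⧸ Ideal.span {F}) ≃ₐ[k] MvPowerSeries (Fin 2) k ⧸ Ideal.span {e F} :=
      Ideal.quotientEquivAlg _ _ e (by rw [Ideal.map_span, Set.image_singleton]; rfl)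
    exact isReduced_of_injective e'.symm e'.symm.injective
  obtain ⟨n, hn⟩ := exists_pow_le_relEquianalyticIdeal_span_X_one hSD' hF' hred'
  rw [← he, ← map_relEquianalyticIdeal, ← map_maximalIdeal_of_algEquiv e, ← Ideal.map_pow] at hn
  refine ⟨n, fun g hg => ?_⟩
  have := hn (Ideal.mem_map_of_mem e hg)
  rwa [mem_map_algEquiv_iff, e.symm_apply_apply] at this

/-- Modulo each power of its maximal ideal, a local algebra with residue field `k` and finitely
generated maximal ideal is spanned by a finite-dimensional subspace. -/
theorem HasResidueField.exists_fg_sup_pow_eq_top {k O : Type*} [Field k] [CommRing O]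
    [IsLocalRing O] [Algebra k O] (h : HasResidueField k O) (hfg : (maximalIdeal O).FG) (n : ℕ) :
    ∃ V : Submodule k O, V.FG ∧ V ⊔ (maximalIdeal O ^ n).restrictScalars k = ⊤ := by
  obtain ⟨s, hs⟩ := hfg
  induction n with
  | zero =>
    refine ⟨⊥, Submodule.fg_bot, ?_⟩
    rw [pow_zero, Ideal.one_eq_top, Submodule.restrictScalars_top, sup_top_eq]
  | succ n ih =>
    obtain ⟨V, hV, hVn⟩ := ih
    refine ⟨k ∙ (1 : O) ⊔ s.sup fun x => V.map (LinearMap.mulRight k x),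
      (Submodule.fg_span_singleton 1).sup (Submodule.fg_finset_sup s _ fun x _ => hV.map _), ?_⟩
    rw [eq_top_iff]
    intro g _
    have key : ∀ y ∈ maximalIdeal O, y ∈ (s.sup fun x => V.map (LinearMap.mulRight k x)) ⊔
        (maximalIdeal O ^ (n + 1)).restrictScalars k := by
      intro y hy
      rw [← hs] at hy
      refine Submodule.span_induction (p := fun y _ => ∀ a : O, a * y ∈
        (s.sup fun x => V.map (LinearMap.mulRight k x)) ⊔
        (maximalIdeal O ^ (n + 1)).restrictScalars k) ?_ ?_ ?_ ?_ hy 1 |> fun h => by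
          rwa [one_mul] at h
      · intro x hx a
        have ha : a ∈ V ⊔ (maximalIdeal O ^ n).restrictScalars k := hVn ▸ Submodule.mem_top
        obtain ⟨v, hv, w, hw, rfl⟩ := Submodule.mem_sup.mp ha
        rw [add_mul]
        refine Submodule.add_mem_sup (Finset.le_sup (f := fun x => V.map (LinearMap.mulRight k x))
          hx (Submodule.mem_map_of_mem hv)) ?_
        rw [Submodule.restrictScalars_mem, pow_succ]
        exact Ideal.mul_mem_mul hw (hs ▸ Ideal.subset_span hx)
      · intro a
        rw [mul_zero]
        exact zero_mem _
      · intro x y _ _ hx hy a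
        rw [mul_add]
        exact add_mem (hx a) (hy a)
      · intro b x _ hx a
        rw [smul_eq_mul, ← mul_assoc]
        exact hx _
    have h1 := key _ (h.sub_res_mem g)
    rw [sup_assoc]
    have := Submodule.add_mem_sup (Submodule.smul_mem (k ∙ (1 : O)) (h.res g)
      (Submodule.mem_span_singleton_self _)) h1
    rwa [← Algebra.algebraMap_eq_smul_one, add_sub_cancel] at this

theorem finite_logTangent [CharZero k] {O : Type u} [CommRing O] [IsLocalRing O]
    [Algebra k O] {D : Ideal O} (hSD : IsFormalSurfacePair k D) {F : O}
    (hred : IsReduced (O ⧸ Ideal.span {F})) (hF : F ∉ D) (m : ℕ) :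
    Module.Finite k (LogTangent k D F m) := by
  have := hSD.isNoetherianRing
  obtain ⟨n, hn⟩ := exists_pow_le_relEquianalyticIdeal hSD hred hF
  obtain ⟨V, hV, hVn⟩ := hSD.hasResidueField.exists_fg_sup_pow_eq_top
    (IsNoetherian.noetherian (maximalIdeal O)) n
  have hfin : Module.Finite k (O ⧸ relEquianalyticIdeal k D F) := by
    have : Module.Finite k V := Module.Finite.iff_fg.mpr hV
    let T : V →ₗ[k] O ⧸ relEquianalyticIdeal k D F :=
      (Ideal.Quotient.mkₐ k (relEquianalyticIdeal k D F)).toLinearMap ∘ₗ V.subtype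
    refine Module.Finite.of_surjective T fun y => ?_
    obtain ⟨g, rfl⟩ := Ideal.Quotient.mk_surjective y
    have hg : g ∈ V ⊔ (maximalIdeal O ^ n).restrictScalars k := hVn ▸ Submodule.mem_top
    obtain ⟨v, hv, w, hw, rfl⟩ := Submodule.mem_sup.mp hg
    refine ⟨⟨v, hv⟩, ?_⟩
    change Ideal.Quotient.mk _ v = _
    rw [map_add, Ideal.Quotient.eq_zero_iff_mem.mpr (hn hw), add_zero]
  let T : LogTangent k D F m →ₗ[O] O ⧸ relEquianalyticIdeal k D F :=
    Submodule.mapQ _ _ (multIdeal D (maximalIdeal O) m).subtype le_rfl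
  have hT : Function.Injective T := by
    rw [← LinearMap.ker_eq_bot]
    exact (Submodule.ker_mapQ _ _ _ _).trans (Submodule.mkQ_map_self _)
  exact Module.Finite.of_injective (T.restrictScalars k) hT

end finite

end

theorem mainTheorem3 {k : Type u} [Field k] [IsAlgClosed k] [CharZero k]
    {O : Type u} [CommRing O] [IsLocalRing O] [Algebra k O]
    {D : Ideal O} (hSD : IsFormalSurfacePair k D)
    {F : O} (hred : IsReduced (O ⧸ Ideal.span {F})) (hF : F ∉ D)
    {m : ℕ} (hm : m ≤ intersectionMultiplicity k (Ideal.span {F}) D) :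
    -- `I^ea_{rel, D, P}(C) ⊆ I_{mP}`, and the quotient has a finite basis
    relEquianalyticIdeal k D F ≤ multIdeal D (maximalIdeal O) m ∧
    (∃ (r : ℕ) (f : Fin r → multIdeal D (maximalIdeal O) m)
      (b : Module.Basis (Fin r) k (LogTangent k D F m)), ∀ i, b i = LogTangent.mk (f i)) ∧
    -- the tangent space of the functor is `I_{mP} / I^ea_{rel, D, P}(C)`, via `g ↦ F + ε g`
    ∃ θ : LogTangent k D F m → (logDef k (Ideal.span {F}) D m).obj (ArtAlg.dual k),
      (∀ g : multIdeal D (maximalIdeal O) m,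
        (θ (LogTangent.mk g)).1 = ⟦firstOrderFamily hSD hF (g : O)⟧) ∧
      IsTangentSpace (logDef k (Ideal.span {F}) D m) (LogTangent k D F m) θ ∧
      -- every basis gives the semiuniversal family `F + ∑ᵢ tᵢ fᵢ` over `k[[t₁, …, tᵣ]]`
      (∀ (r : ℕ) (f : Fin r → multIdeal D (maximalIdeal O) m)
        (b : Module.Basis (Fin r) k (LogTangent k D F m)), (∀ i, b i = LogTangent.mk (f i)) →
        ∃ ξ : FormalElement (logDef k (Ideal.span {F}) D m) (CompAlg.powerSeries k r),
          (∀ n, (ξ.1 n).1 = ⟦truncatedFamily hSD hF (fun i => (f i : O)) n⟧) ∧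
          ξ.IsSemiuniversal ∧
          -- the induced identification of the tangent space of the base
          ∃ κ : Module.Dual k (maximalIdeal (MvPowerSeries (Fin r) k)).Cotangent ≃ₗ[k]
              LogTangent k D F m,
            ∀ (ℓ : Module.Dual k (maximalIdeal (MvPowerSeries (Fin r) k)).Cotangent)
              (v : LocalAlgHom k (MvPowerSeries (Fin r) k) (TrivSqZeroExt k k)),
              (∀ a : maximalIdeal (MvPowerSeries (Fin r) k),
                ℓ ((maximalIdeal (MvPowerSeries (Fin r) k)).toCotangent a) =
                  (v.1 (a : MvPowerSeries (Fin r) k)).snd) →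
              ξ.toMap (ArtAlg.dual k) v = θ (κ ℓ)) ∧
      -- the two ideals in coordinates `x, y` of `S` with `D = V(y)`
      ∀ e : O ≃ₐ[k] MvPowerSeries (Fin 2) k, D.map e = Ideal.span {MvPowerSeries.X 1} →
        (multIdeal D (maximalIdeal O) m).map e =
          Ideal.span {MvPowerSeries.X 0 ^ m, MvPowerSeries.X 1} ∧
        (relEquianalyticIdeal k D F).map e =
          Ideal.span {MvPowerSeries.X 0 * MvPowerSeries.pderiv k 0 (e F),
            MvPowerSeries.X 1 * MvPowerSeries.pderiv k 0 (e F),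
            MvPowerSeries.X 1 * MvPowerSeries.pderiv k 1 (e F), e F} := by
  have hFm := mem_multIdeal_of_le_intersectionMultiplicity hSD hF hm
  have hfin := finite_logTangent hSD hred hF m
  refine ⟨relEquianalyticIdeal_le_multIdeal hFm, ?_, tangentClass hSD hF hFm,
    fun g => congrArg Subtype.val (tangentClass_mk hFm g), isTangentSpace_tangentClass hFm,
    fun r f b hb => ⟨formalFamily hSD hF hFm f, fun n => rfl,
      isSemiuniversal_formalFamily hFm b hb, exists_cotangentDual_linearEquiv hFm b hb⟩,
    fun e he => ⟨map_multIdeal e he m, ?_⟩⟩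
  · let b := Module.finBasis k (LogTangent k D F m)
    choose f hf using fun i => Submodule.Quotient.mk_surjective _ (b i)
    exact ⟨_, f, b, fun i => (hf i).symm⟩
  · rw [map_relEquianalyticIdeal, he, relEquianalyticIdeal_span_X_one]
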